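/- **Setting.** For $p\ge 1$ let $\boldsymbol\Sigma_0\in\mathbb R^{p\times p}$ be positive definite, $\boldsymbol\mu\in\mathbb R^p$, let $\boldsymbol u$ be uniform on the unit sphere of $\mathbb R^p$ and $r$ a real random variable independent of $\boldsymbol u$ with $\mathbb E[r^2]=p$. Let $\boldsymbol X_1,\dots,\boldsymbol X_n$ be i.i.d. copies of $\boldsymbol X=\boldsymbol\mu+r\,\boldsymbol\Sigma_0^{1/2}\boldsymbol u$. Put $\boldsymbol\Lambda_0=\frac{p}{\operatorname{tr}\boldsymbol\Sigma_0}\boldsymbol\Sigma_0$ and $\mathbf V_0=(v^0_{ij})=\boldsymbol\Lambda_0^{-1}$. Let $U(x)=x/\|x\|_2$ for $x\neq0$, $U(0)=0$, and $\mathbf S=\mathbb E[U(\boldsymbol X-\boldsymbol\mu)U(\boldsymbol X-\boldsymbol\mu)^\top]$. **Estimator.** Let $\hat{\boldsymbol\mu}$ be a minimizer of $m\mapsto\sum_{i=1}^n\|\boldsymbol X_i-m\|_2$ and $\hat{\mathbf S}=\frac1n\sum_{i=1}^nU(\boldsymbol X_i-\hat{\boldsymbol\mu})U(\boldsymbol X_i-\hat{\boldsymbol\mu})^\top$.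 Let $\hat{\mathbf V}_1=(\hat v^1_{ij})$ minimize $\sum_{i,j}|v_{ij}|$ over all $\mathbf V\in\mathbb R^{p\times p}$ with $\max_{i,j}|(p\hat{\mathbf S}\mathbf V-\mathbf I_p)_{ij}|\le\lambda_n$. The SCLIME estimator $\hat{\mathbf V}=(\hat v_{ij})$ is the symmetric matrix in which $\hat v_{ij}=\hat v_{ji}$ is whichever of $\hat v^1_{ij},\hat v^1_{ji}$ has the smaller absolute value (in a tie, either one). For $\tau_n>0$ let $\tilde v_{ij}=\hat v_{ij}\mathbf 1\{|\hat v_{ij}|\ge\tau_n\}$. **Assumptions**, with positive constants $T,\eta,M,c_0,\zeta,\psi,K_\nu$, and with $0\le q<1$, $s_0>0$: (a) $\max_j\sum_i|v^0_{ij}|\le T$ and $\max_i\sum_j|v^0_{ij}|^q\le s_0$ (with $0^0=0$); (b) all eigenvalues of $\boldsymbol\Sigma_0$ lie in $(\eta,1/\eta)$, all entries of $\boldsymbol\Sigma_0$ are less than $M$ in absolute value, and $c_0p\le\operatorname{tr}\boldsymbol\Sigma_0\le p/c_0$; (c) with $\xi=\|\boldsymbol X-\boldsymbol\mu\|_2$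 (almost surely nonzero), $\zeta_k=\mathbb E[\xi^{-k}]<\infty$ and $\nu=\zeta_1^{-1}\xi^{-1}$: $\zeta_k\zeta_1^{-k}<\zeta$ for $k=1,2,3,4$; $\|\mathbf S\|_{\mathrm{op}}<1-\psi$; and $\|\nu\|_{\psi_2}=\sup_{k\ge1}k^{-1/2}(\mathbb E|\nu|^k)^{1/k}\le K_\nu$ (supremum over integers $k\ge1$). **Theorem.** There are positive constants $C_{c_0,\eta,T,M}$, depending only on $c_0,\eta,T,M$, and $C$, depending only on $\zeta,\psi,K_\nu$, such that the following holds under (a)–(c) whenever $n$ and $p$ are sufficiently large (larger than a threshold that depends only on $c_0,\eta,T,M,\zeta,\psi,K_\nu$) and $n>(3\log p)^{1/3}$. Let $$\lambda_n=T\left(\frac{\sqrt2\,C\,(8+\eta^2C_{c_0,\eta,T,M})}{\eta^2}\sqrt{\frac{\log p}{n}}+\frac{C_{c_0,\eta,T,M}}{\sqrt p}\right),$$ let $\tau_n>4T\lambda_n$, and suppose that $\theta_{\min}=\min\{|v^0_{ij}|:v^0_{ij}\ne0\}>2\tau_n$. Then, on an event of probability larger than $1-2p^{-2}$, a sample spatial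 median exists and, for every choice of it, a SCLIME estimator exists and every SCLIME estimator satisfies $$\operatorname{sgn}(\tilde v_{ij})=\operatorname{sgn}(v^0_{ij})\qquad\text{for all }1\le i,j\le p.$$ -/

import Mathlib

open MeasureTheory ProbabilityTheory
open scoped ENNReal MatrixOrder

namespace Sclime

/-! ### Elliptical distributions -/

/-- The uniform probability distribution on the unit sphere of `ℝ^p`. -/
noncomputable def sphereUniform (p : ℕ) :
    Measure (Metric.sphere (0 : EuclideanSpace ℝ (Fin p)) 1) :=
  ProbabilityTheory.cond (volume : Measure (EuclideanSpace ℝ (Fin p))).toSphere Set.univ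

/-- The elliptical law `EC_p(m, Sig, r)`: the law of `m + r • Sig^{1/2} u`, where `u` is uniform on
the unit sphere, `r` has law `ρ`, and `r`, `u` are independent. -/
noncomputable def ellipticalLaw {p : ℕ} (m : EuclideanSpace ℝ (Fin p))
    (Sig : Matrix (Fin p) (Fin p) ℝ) (ρ : Measure ℝ) : Measure (EuclideanSpace ℝ (Fin p)) :=
  (ρ.prod (sphereUniform p)).map
    (fun z => m + z.1 • Matrix.toEuclideanCLM (𝕜 := ℝ) (CFC.sqrt Sig) z.2.1)

/-- The standing model: `Sig` is positive definite, `ρ` is the law of a real random variable `r`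
with `E[r^2] = p`, and `X 0, …, X (n-1)` are i.i.d. with law `EC_p(m, Sig, r)`. -/
structure IsEllipticalSample {Ω : Type*} [MeasurableSpace Ω] (P : Measure Ω) {n p : ℕ}
    (X : Fin n → Ω → EuclideanSpace ℝ (Fin p)) (m : EuclideanSpace ℝ (Fin p))
    (Sig : Matrix (Fin p) (Fin p) ℝ) (ρ : Measure ℝ) : Prop where
  posDef : Sig.PosDef
  isProbabilityMeasure : IsProbabilityMeasure ρ
  memLp : MemLp (fun t : ℝ => t) 2 ρ
  secondMoment : ∫ t, t ^ 2 ∂ρ = (p : ℝ)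
  indep : iIndepFun X P
  law : ∀ i, HasLaw (X i) (ellipticalLaw m Sig ρ) P

/-- The shape matrix `Λ₀ = (p / tr Sig) Sig`. -/
noncomputable def shapeMatrix {p : ℕ} (Sig : Matrix (Fin p) (Fin p) ℝ) :
    Matrix (Fin p) (Fin p) ℝ :=
  ((p : ℝ) / Sig.trace) • Sig

/-- The (scaled) precision matrix `V₀ = Λ₀⁻¹`. -/
noncomputable def precisionMatrix {p : ℕ} (Sig : Matrix (Fin p) (Fin p) ℝ) :
    Matrix (Fin p) (Fin p) ℝ :=
  (shapeMatrix Sig)⁻¹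

/-! ### Spatial signs -/

/-- The spatial sign `U(x) = x / ‖x‖` for `x ≠ 0`, and `U(0) = 0`. -/
noncomputable def spatialSign {p : ℕ} (x : EuclideanSpace ℝ (Fin p)) :
    EuclideanSpace ℝ (Fin p) :=
  ‖x‖⁻¹ • x

/-- The spatial-sign covariance matrix `S = E[U(X - m) U(X - m)ᵀ]` of a law `L` centred at `m`. -/
noncomputable def spatialSignCov {p : ℕ} (L : Measure (EuclideanSpace ℝ (Fin p)))
    (m : EuclideanSpace ℝ (Fin p)) : Matrix (Fin p) (Fin p) ℝ :=
  Matrix.of fun j k => ∫ x, spatialSign (x - m) j * spatialSign (x - m) k ∂L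

/-- `mhat` is a sample spatial median of the points `x 0, …, x (n-1)`. -/
def IsSpatialMedian {n p : ℕ} (x : Fin n → EuclideanSpace ℝ (Fin p))
    (mhat : EuclideanSpace ℝ (Fin p)) : Prop :=
  ∀ m : EuclideanSpace ℝ (Fin p), ∑ i, ‖x i - mhat‖ ≤ ∑ i, ‖x i - m‖

/-- The sample spatial-sign covariance matrix of the points `x i`, centred at `mhat`. -/
noncomputable def sampleSpatialSignCov {n p : ℕ} (x : Fin n → EuclideanSpace ℝ (Fin p))
    (mhat : EuclideanSpace ℝ (Fin p)) : Matrix (Fin p) (Fin p) ℝ :=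
  Matrix.of fun j k =>
    (1 / (n : ℝ)) * ∑ i, spatialSign (x i - mhat) j * spatialSign (x i - mhat) k

/-! ### The estimator -/

/-- The elementwise `ℓ₁` norm. -/
def elementwiseL1 {p : ℕ} (V : Matrix (Fin p) (Fin p) ℝ) : ℝ :=
  ∑ i, ∑ j, |V i j|

/-- The constraint `‖p Shat V - I‖_∞ ≤ lam` (elementwise maximum norm). -/
def IsFeasible {p : ℕ} (Shat : Matrix (Fin p) (Fin p) ℝ) (lam : ℝ)
    (V : Matrix (Fin p) (Fin p) ℝ) : Prop :=
  ∀ i j, |(((p : ℝ) • Shat) * V - 1) i j| ≤ lam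

/-- `V₁` solves: minimise `‖V‖₁` subject to `‖p Shat V - I‖_∞ ≤ lam`. -/
def IsSclimeSolution {p : ℕ} (Shat : Matrix (Fin p) (Fin p) ℝ) (lam : ℝ)
    (V₁ : Matrix (Fin p) (Fin p) ℝ) : Prop :=
  IsFeasible Shat lam V₁ ∧
    ∀ V : Matrix (Fin p) (Fin p) ℝ, IsFeasible Shat lam V → elementwiseL1 V₁ ≤ elementwiseL1 V

/-- `V` is the symmetrization of `V₁`: it is symmetric, and `V i j = V j i` is whichever of `V₁ i j`
and `V₁ j i` has the smaller absolute value. If the two have equal absolute value and opposite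
signs, either one may be taken. -/
def IsSymmetrization {p : ℕ} (V₁ V : Matrix (Fin p) (Fin p) ℝ) : Prop :=
  ∀ i j, V i j = V j i ∧ (V i j = V₁ i j ∨ V i j = V₁ j i) ∧ |V i j| = min |V₁ i j| |V₁ j i|

/-- `V` is a SCLIME estimator with tuning parameter `lam`, computed from the points `x i` with
the sample spatial median `mhat`. -/
def IsSclimeEstimator {n p : ℕ} (x : Fin n → EuclideanSpace ℝ (Fin p))
    (mhat : EuclideanSpace ℝ (Fin p)) (lam : ℝ) (V : Matrix (Fin p) (Fin p) ℝ) : Prop :=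
  ∃ V₁, IsSclimeSolution (sampleSpatialSignCov x mhat) lam V₁ ∧ IsSymmetrization V₁ V

/-- Hard thresholding at level `τ`: entries with absolute value below `τ` are set to zero. -/
noncomputable def hardThreshold {p : ℕ} (τ : ℝ) (V : Matrix (Fin p) (Fin p) ℝ) :
    Matrix (Fin p) (Fin p) ℝ :=
  Matrix.of fun i j => if τ ≤ |V i j| then V i j else 0

/-- The sign pattern of a matrix. -/
noncomputable def signPattern {p : ℕ} (V : Matrix (Fin p) (Fin p) ℝ) : Fin p → Fin p → SignType :=
  fun i j => SignType.sign (V i j)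

/-- The smallest absolute value of a nonzero entry (the infimum is over a finite set, which is
nonempty as soon as `V ≠ 0`). -/
noncomputable def thetaMin {p : ℕ} (V : Matrix (Fin p) (Fin p) ℝ) : ℝ :=
  sInf {t : ℝ | ∃ i j, V i j ≠ 0 ∧ t = |V i j|}

/-! ### Assumptions -/

/-- Sparsity of the precision matrix `V`: its matrix `ℓ₁` norm (largest absolute column sum) is at
most `T`, and `max_i ∑_j |v_ij|^q ≤ s₀`, where `0^q = 0` also for `q = 0`. -/
structure SparsePrecision {p : ℕ} (V : Matrix (Fin p) (Fin p) ℝ) (T q s₀ : ℝ) : Prop where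
  colSum : ∀ j, ∑ i, |V i j| ≤ T
  rowSum : ∀ i, ∑ j, (if V i j = 0 then 0 else |V i j| ^ q) ≤ s₀

/-- All eigenvalues of `Sig` lie in `(η, 1/η)`, all entries are less than `M` in absolute value, and
`c₀ p ≤ tr Sig ≤ p / c₀`. -/
structure BoundedCovariance {p : ℕ} (Sig : Matrix (Fin p) (Fin p) ℝ) (c₀ η M : ℝ) : Prop where
  eigenvalues : ∃ h : Sig.IsHermitian, ∀ i, η < h.eigenvalues i ∧ h.eigenvalues i < 1 / η
  entries : ∀ i j, |Sig i j| < M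
  trace_lower : c₀ * (p : ℝ) ≤ Sig.trace
  trace_upper : Sig.trace ≤ 1 / c₀ * (p : ℝ)

/-- The inverse radial moments `ζ_k = E[‖X - m‖^{-k}]` of a law `L`. -/
noncomputable def invMoment {p : ℕ} (L : Measure (EuclideanSpace ℝ (Fin p)))
    (m : EuclideanSpace ℝ (Fin p)) (k : ℕ) : ℝ :=
  ∫ x, (‖x - m‖⁻¹) ^ k ∂L

/-- The sub-Gaussian norm `‖Y‖_{ψ₂} = sup_{k ≥ 1} k^{-1/2} (E|Y|^k)^{1/k}`. -/
noncomputable def psi2Norm {α : Type*} [MeasurableSpace α] (Y : α → ℝ) (L : Measure α) : ℝ≥0∞ :=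
  ⨆ k : ℕ, ⨆ _ : 1 ≤ k, ENNReal.ofReal ((k : ℝ) ^ (-(1 / 2) : ℝ)) * eLpNorm Y (k : ℝ≥0∞) L

/-- The radial conditions on a law `L` centred at `m`, with `ξ = ‖X - m‖` and `ν = ζ₁⁻¹ ξ⁻¹`:
`ξ` is almost surely nonzero, the inverse moments `ζ_1, …, ζ_4` are finite and satisfy
`ζ_k ζ_1^{-k} < ζ`; the spatial-sign covariance matrix has operator norm less than `1 - ψ`; and
`‖ν‖_{ψ₂} ≤ K`. -/
structure RadialConditions {p : ℕ} (L : Measure (EuclideanSpace ℝ (Fin p)))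
    (m : EuclideanSpace ℝ (Fin p)) (ζ ψ K : ℝ) : Prop where
  ae_ne : ∀ᵐ x ∂L, x ≠ m
  integrable : ∀ k ∈ Finset.Icc 1 4, Integrable (fun x => (‖x - m‖⁻¹) ^ k) L
  moments : ∀ k ∈ Finset.Icc 1 4, invMoment L m k * (invMoment L m 1 ^ k)⁻¹ < ζ
  opNorm : ‖Matrix.toEuclideanCLM (𝕜 := ℝ) (spatialSignCov L m)‖ < 1 - ψ
  subGaussian :
    psi2Norm (fun x => (invMoment L m 1)⁻¹ * ‖x - m‖⁻¹) L ≤ ENNReal.ofReal K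

/-- The tuning parameter
`λ_n = T (√2 C (8 + η² A) / η² · √(log p / n) + A / √p)`, with constants `A` and `C`. -/
noncomputable def tuning (n p : ℕ) (η T A C : ℝ) : ℝ :=
  T * (Real.sqrt 2 * C * (8 + η ^ 2 * A) / η ^ 2 * Real.sqrt (Real.log p / n)
    + A / Real.sqrt p)

end Sclime

/-! Everything reduces to an entrywise bound |p Ŝ − Λ₀| ≤ δ, where λ_n = Tδ
(`sclime_sign_consistent`). Such a bound makes V₀ feasible. The ℓ₁ program splits over columns, so
the columns of a solution V₁ have ℓ₁ norm at most T, and V₁ − V₀ = V₀((Λ₀ − pŜ)V₁ + (pŜV₁ − I)) is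
entrywise at most 2Tλ_n. This is below τ_n while the nonzero entries of V₀ exceed 2τ_n, so
thresholding recovers the signs.

The error δ has two parts. For the bias, S = E[Bu(Bu)ᵀ/‖Bu‖²] with B = Σ₀^{1/2}, and ‖Bu‖² has
variance O(1/p) about tr Σ₀/p; replacing it by this mean costs O(1/√p) in pS
(`abs_spatialSignCov_sub_le`). The sampling error is of order √(log p/n)
(`abs_sampleSpatialSignCov_sub_le`), and the difficulty there is that Ŝ is centred at the sample
median. Let U_i be the signs about μ, ν_i the inverse radii divided by their mean ζ₁, and h = ζ₁(μ̂
− μ). The recentred sign is U_i − ν_i h, normalised. Probability enters only through `GoodSample`,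
seven estimates on the U_i and ν_i that fail with total probability at most 7p⁻³. They rest on E
exp⟪g, U⟫ ≤ exp(D‖g‖²/p) with D = η⁻² and on the Gaussian tails of ν. On a good sample convexity
confines h to a ball of radius 65D/√n (`GoodSample.norm_median_le`), the first-order condition
improves this to coordinates of order √(log p/(np)) (`abs_coord_median_le`), and expanding the
products of recentred signs gives the rate (`abs_sum_recentred_sub_le`).

All this needs log p to be small against n. The signal condition provides it: 4Tλ_n < τ_n < θ_min/2
≤ T/2 forces λ_n < 1/8, and the constants in λ_n are so large that √(log p/n) must then be small
(`rate_le_of_tuning_le`). -/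

namespace Sclime

/-! ### Moments of the uniform distribution on the sphere -/

section SphereMoments

variable {p : ℕ}

-- The surface measure of a set is computed from the volume of the cone over it; a linear isometry
-- preserves volume and maps cones to cones.
open scoped Pointwise in
lemma toSphere_map_linearIsometryEquiv
    (L : EuclideanSpace ℝ (Fin p) ≃ₗᵢ[ℝ] EuclideanSpace ℝ (Fin p)) :
    ((volume : Measure (EuclideanSpace ℝ (Fin p))).toSphere).map
      (fun u : Metric.sphere (0 : EuclideanSpace ℝ (Fin p)) 1 =>
        (⟨L u, by simp⟩ : Metric.sphere (0 : EuclideanSpace ℝ (Fin p)) 1)) =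
      (volume : Measure (EuclideanSpace ℝ (Fin p))).toSphere := by
  have hc : Measurable
      (fun u : Metric.sphere (0 : EuclideanSpace ℝ (Fin p)) 1 =>
        (⟨L u, by simp⟩ : Metric.sphere (0 : EuclideanSpace ℝ (Fin p)) 1)) := by
    apply Continuous.measurable
    fun_prop
  ext s hs
  rw [Measure.map_apply hc hs, Measure.toSphere_apply' _ hs, Measure.toSphere_apply' _ (hc hs)]
  congr 1
  rw [← (L.measurePreserving).measure_preimage_equiv (f := L.toMeasurableEquiv)
    (Set.Ioo (0 : ℝ) 1 • (Subtype.val '' s))]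
  congr 1
  ext x
  simp only [Set.mem_smul, Set.mem_image, Set.mem_preimage, Subtype.exists, exists_and_right,
    exists_eq_right]
  constructor
  · rintro ⟨r, hr, y, ⟨hy, hy'⟩, rfl⟩
    exact ⟨r, hr, L y, ⟨by simpa using hy, hy'⟩, (L.map_smul r y).symm⟩
  · rintro ⟨r, hr, y, ⟨hy, hy'⟩, hx⟩
    refine ⟨r, hr, L.symm y, ⟨by simpa using hy, by simpa using hy'⟩, ?_⟩
    apply L.injective
    rw [L.map_smul, L.apply_symm_apply]
    exact hx

lemma sphereUniform_map_linearIsometryEquiv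
    (L : EuclideanSpace ℝ (Fin p) ≃ₗᵢ[ℝ] EuclideanSpace ℝ (Fin p)) :
    (sphereUniform p).map
      (fun u : Metric.sphere (0 : EuclideanSpace ℝ (Fin p)) 1 =>
        (⟨L u, by simp⟩ : Metric.sphere (0 : EuclideanSpace ℝ (Fin p)) 1)) =
      sphereUniform p := by
  simp only [sphereUniform, ProbabilityTheory.cond, Measure.restrict_univ]
  rw [Measure.map_smul, toSphere_map_linearIsometryEquiv]

lemma integral_sphereUniform_comp {f : EuclideanSpace ℝ (Fin p) → ℝ} (hf : Measurable f)
    (L : EuclideanSpace ℝ (Fin p) ≃ₗᵢ[ℝ] EuclideanSpace ℝ (Fin p)) :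
    ∫ u, f (L u) ∂(sphereUniform p) = ∫ u, f u ∂(sphereUniform p) := by
  conv_rhs => rw [← sphereUniform_map_linearIsometryEquiv L]
  rw [integral_map]
  · apply Continuous.aemeasurable
    fun_prop
  · exact (hf.comp measurable_subtype_coe).aestronglyMeasurable

lemma isProbabilityMeasure_sphereUniform (hp : 0 < p) :
    IsProbabilityMeasure (sphereUniform p) := by
  have : Nonempty (Fin p) := ⟨⟨0, hp⟩⟩
  apply ProbabilityTheory.cond_isProbabilityMeasure_of_finite
  · rw [Ne, Measure.measure_univ_eq_zero]
    have : Nontrivial (EuclideanSpace ℝ (Fin p)) := inferInstance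
    exact Measure.toSphere_ne_zero _
  · exact measure_ne_top _ _

/-- The reflection that exchanges z and w preserves the uniform measure. Hence the law of ⟪z, u⟫
depends on ‖z‖ only, and all moments below follow by comparing well-chosen vectors of equal norm. -/
lemma integral_sphereUniform_inner {g : ℝ → ℝ} (hg : Measurable g)
    {z w : EuclideanSpace ℝ (Fin p)} (h : ‖z‖ = ‖w‖) :
    ∫ u, g (inner ℝ z u.1) ∂(sphereUniform p) = ∫ u, g (inner ℝ w u.1) ∂(sphereUniform p) := by
  set L := (Submodule.reflection (ℝ ∙ (z - w))ᗮ)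
  have hL : L z = w := Submodule.reflection_sub h
  have := integral_sphereUniform_comp (f := fun x => g (inner ℝ w x)) (by fun_prop) L
  rw [← this]
  congr 1
  ext u
  rw [← hL, L.inner_map_map]

lemma integrable_sphereUniform (hp : 0 < p)
    {f : Metric.sphere (0 : EuclideanSpace ℝ (Fin p)) 1 → ℝ}
    (hf : Continuous f) : Integrable f (sphereUniform p) := by
  have := isProbabilityMeasure_sphereUniform hp
  exact hf.integrable_of_hasCompactSupport (HasCompactSupport.of_compactSpace f)

/-- The vector w may be replaced by each of the 2^p vectors with coordinates ±‖w‖/√p. Averaging over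
the signs turns the exponential into a product of cosh(c u_j), and cosh x ≤ exp(x²/2) together with
∑ u_j² = 1 finishes. -/
lemma integral_exp_inner_sphereUniform_le (hp : 0 < p) (w : EuclideanSpace ℝ (Fin p)) :
    ∫ u, Real.exp (inner ℝ w u.1) ∂(sphereUniform p) ≤ Real.exp (‖w‖ ^ 2 / (2 * p)) := by
  have := isProbabilityMeasure_sphereUniform hp
  have hp' : (0 : ℝ) < p := by exact_mod_cast hp
  set c : ℝ := ‖w‖ / Real.sqrt p with hc
  have hc2 : c ^ 2 = ‖w‖ ^ 2 / p := by rw [hc, div_pow, Real.sq_sqrt hp'.le]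
  set W : (Fin p → Bool) → EuclideanSpace ℝ (Fin p) :=
    fun ε => WithLp.toLp 2 (fun j => if ε j then c else -c) with hW
  have hWn : ∀ ε, ‖w‖ = ‖W ε‖ := by
    intro ε
    rw [← sq_eq_sq₀ (norm_nonneg _) (norm_nonneg _), EuclideanSpace.real_norm_sq_eq (W ε)]
    have : ∀ j, (W ε j) ^ 2 = c ^ 2 := by
      intro j
      simp only [hW]
      split_ifs <;> ring
    simp only [this, Finset.sum_const, Finset.card_univ, Fintype.card_fin, nsmul_eq_mul, hc2]
    field_simp
  have h1 : ∑ ε : Fin p → Bool, ∫ u, Real.exp (inner ℝ w u.1) ∂(sphereUniform p) =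
      ∫ u, ∑ ε : Fin p → Bool, Real.exp (inner ℝ (W ε) u.1) ∂(sphereUniform p) := by
    rw [integral_finsetSum]
    · exact Finset.sum_congr rfl fun ε _ =>
        integral_sphereUniform_inner Real.measurable_exp (hWn ε)
    · intro ε _
      exact integrable_sphereUniform hp (by fun_prop)
  have h2 : ∀ u : Metric.sphere (0 : EuclideanSpace ℝ (Fin p)) 1,
      ∑ ε : Fin p → Bool, Real.exp (inner ℝ (W ε) u.1) ≤ 2 ^ p * Real.exp (c ^ 2 / 2) := by
    intro u
    have hu : ∑ j, (u.1 j) ^ 2 = 1 := by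
      rw [← EuclideanSpace.real_norm_sq_eq]; simp
    have e1 : ∀ ε, Real.exp (inner ℝ (W ε) u.1) =
        ∏ j, (fun (j : Fin p) (b : Bool) => Real.exp ((if b then c else -c) * u.1 j)) j (ε j) := by
      intro ε
      simp only [PiLp.inner_apply, hW]
      rw [Real.exp_sum]
      simp [mul_comm]
    simp only [e1]
    rw [← Fintype.prod_sum
      (fun (j : Fin p) (b : Bool) => Real.exp ((if b then c else -c) * u.1 j))]
    calc _ = ∏ j, (2 * Real.cosh (c * u.1 j)) := by
          refine Finset.prod_congr rfl fun j _ => ?_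
          rw [Fintype.sum_bool, Real.cosh_eq]
          simp; ring
      _ ≤ ∏ j, (2 * Real.exp ((c * u.1 j) ^ 2 / 2)) := by
          refine Finset.prod_le_prod (fun j _ => ?_) fun j _ => ?_
          · have := Real.cosh_pos (c * u.1 j)
            positivity
          · gcongr
            exact Real.cosh_le_exp_half_sq _
      _ = _ := by
          rw [Finset.prod_mul_distrib, ← Real.exp_sum]
          simp only [Finset.prod_const, Finset.card_univ, Fintype.card_fin, mul_pow]
          congr 2
          rw [← Finset.sum_div, ← Finset.mul_sum, hu, mul_one]
  have h3 := integral_mono (μ := sphereUniform p)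
    (integrable_sphereUniform hp (by fun_prop)) (integrable_const _) h2
  rw [← h1] at h3
  simp only [Finset.sum_const, Finset.card_univ, Fintype.card_fun, Fintype.card_bool,
    Fintype.card_fin, nsmul_eq_mul, Nat.cast_pow, Nat.cast_ofNat, integral_const,
    probReal_univ, smul_eq_mul, one_mul] at h3
  have := le_of_mul_le_mul_left h3 (by positivity)
  rwa [hc2, div_div, mul_comm (p : ℝ)] at this

lemma integral_inner_sq_sphereUniform (hp : 0 < p) (z : EuclideanSpace ℝ (Fin p)) :
    ∫ u, (inner ℝ z u.1) ^ 2 ∂(sphereUniform p) = ‖z‖ ^ 2 / p := by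
  have := isProbabilityMeasure_sphereUniform hp
  have hp' : (0 : ℝ) < p := by exact_mod_cast hp
  have h1 : ∀ j : Fin p,
      ∫ u, (inner ℝ (‖z‖ • EuclideanSpace.single j (1 : ℝ)) u.1) ^ 2 ∂(sphereUniform p) =
      ∫ u, (inner ℝ z u.1) ^ 2 ∂(sphereUniform p) := fun j =>
    integral_sphereUniform_inner (g := fun x => x ^ 2) (by fun_prop) (by simp [norm_smul])
  have h2 : ∑ j : Fin p,
      ∫ u, (inner ℝ (‖z‖ • EuclideanSpace.single j (1 : ℝ)) u.1) ^ 2 ∂(sphereUniform p) =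
      ‖z‖ ^ 2 := by
    rw [← integral_finsetSum]
    · have : ∀ u : Metric.sphere (0 : EuclideanSpace ℝ (Fin p)) 1,
          ∑ j, (inner ℝ (‖z‖ • EuclideanSpace.single j (1 : ℝ)) u.1) ^ 2 = ‖z‖ ^ 2 := by
        intro u
        have hu : ∑ j, (u.1 j) ^ 2 = 1 := by
          rw [← EuclideanSpace.real_norm_sq_eq]; simp
        simp only [inner_smul_left, EuclideanSpace.inner_single_left, mul_pow, map_one, one_mul]
        rw [← Finset.mul_sum, hu]
        simp
      simp [this]
    · intro j _
      exact integrable_sphereUniform hp (by fun_prop)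
  simp only [h1, Finset.sum_const, Finset.card_univ, Fintype.card_fin, nsmul_eq_mul] at h2
  rw [← h2]
  field_simp

lemma integral_inner_mul_inner_sphereUniform (hp : 0 < p) (z w : EuclideanSpace ℝ (Fin p)) :
    ∫ u, inner ℝ z u.1 * inner ℝ w u.1 ∂(sphereUniform p) = inner ℝ z w / p := by
  have h : ∀ u : Metric.sphere (0 : EuclideanSpace ℝ (Fin p)) 1,
      inner ℝ z u.1 * inner ℝ w u.1 =
        (1 / 4) * ((inner ℝ (z + w) u.1) ^ 2 - (inner ℝ (z - w) u.1) ^ 2) := by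
    intro u
    rw [inner_add_left, inner_sub_left]; ring
  simp only [h]
  rw [integral_const_mul, integral_sub (integrable_sphereUniform hp (by fun_prop))
    (integrable_sphereUniform hp (by fun_prop)), integral_inner_sq_sphereUniform hp,
    integral_inner_sq_sphereUniform hp, norm_add_sq_real, norm_sub_sq_real]
  ring

/-- Polarisation: (a+b)⁴ + (a−b)⁴ = 2a⁴ + 12a²b² + 2b⁴. The vectors z ± w have norm √2, so each
contributes four times the fourth moment of a unit vector. -/
lemma integral_inner_sq_mul_inner_sq_sphereUniform_aux (hp : 0 < p)
    {z w : EuclideanSpace ℝ (Fin p)} (hz : ‖z‖ = 1) (hw : ‖w‖ = 1) (hzw : inner ℝ z w = 0) :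
    ∫ u, (inner ℝ z u.1) ^ 2 * (inner ℝ w u.1) ^ 2 ∂(sphereUniform p) =
      (∫ u, (inner ℝ z u.1) ^ 4 ∂(sphereUniform p)) / 3 := by
  have h : ∀ u : Metric.sphere (0 : EuclideanSpace ℝ (Fin p)) 1,
      (inner ℝ z u.1) ^ 2 * (inner ℝ w u.1) ^ 2 =
        (1 / 12) * ((inner ℝ (z + w) u.1) ^ 4 + (inner ℝ (z - w) u.1) ^ 4
          - 2 * (inner ℝ z u.1) ^ 4 - 2 * (inner ℝ w u.1) ^ 4) := by
    intro u
    rw [inner_add_left, inner_sub_left]; ring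
  have hwz : ∫ u, (inner ℝ w u.1) ^ 4 ∂(sphereUniform p) =
      ∫ u, (inner ℝ z u.1) ^ 4 ∂(sphereUniform p) :=
    integral_sphereUniform_inner (g := fun x => x ^ 4) (by fun_prop) (by rw [hz, hw])
  have hsum : ∀ y : EuclideanSpace ℝ (Fin p), ‖y‖ ^ 2 = 2 →
      ∫ u, (inner ℝ y u.1) ^ 4 ∂(sphereUniform p) =
        4 * ∫ u, (inner ℝ z u.1) ^ 4 ∂(sphereUniform p) := by
    intro y hy
    have : ∫ u, (inner ℝ y u.1) ^ 4 ∂(sphereUniform p) =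
        ∫ u, (inner ℝ (Real.sqrt 2 • z) u.1) ^ 4 ∂(sphereUniform p) := by
      refine integral_sphereUniform_inner (g := fun x => x ^ 4) (by fun_prop) ?_
      rw [norm_smul, hz, mul_one, Real.norm_of_nonneg (Real.sqrt_nonneg _), ← hy,
        Real.sqrt_sq (norm_nonneg _)]
    rw [this, ← integral_const_mul]
    congr 1
    ext u
    rw [inner_smul_left]
    have : (Real.sqrt 2) ^ 4 = 4 := by
      rw [show (4 : ℕ) = 2 * 2 by norm_num, pow_mul, Real.sq_sqrt (by norm_num)]; norm_num
    simp [mul_pow, this]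
  have hi : ∀ y : EuclideanSpace ℝ (Fin p), Integrable
      (fun u : Metric.sphere (0 : EuclideanSpace ℝ (Fin p)) 1 => (inner ℝ y u.1) ^ 4)
      (sphereUniform p) := fun y => integrable_sphereUniform hp (by fun_prop)
  simp only [h]
  rw [integral_const_mul, integral_sub, integral_sub, integral_add (hi _) (hi _),
    integral_const_mul, integral_const_mul, hwz,
    hsum (z + w) (by rw [norm_add_sq_real, hz, hw, hzw]; norm_num),
    hsum (z - w) (by rw [norm_sub_sq_real, hz, hw, hzw]; norm_num)]
  · ring
  · exact (hi _).add (hi _)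
  · exact (hi _).const_mul _
  · exact ((hi _).add (hi _)).sub ((hi _).const_mul _)
  · exact (hi _).const_mul _

/-- Integrating (∑ u_i²)² = 1, with mixed moments a third of the pure moment m, gives pm + p(p−1)m/3
= 1. -/
lemma integral_inner_pow_four_sphereUniform (hp : 0 < p) (z : EuclideanSpace ℝ (Fin p)) :
    ∫ u, (inner ℝ z u.1) ^ 4 ∂(sphereUniform p) = 3 / (p * (p + 2)) * ‖z‖ ^ 4 := by
  have := isProbabilityMeasure_sphereUniform hp
  have hp' : (0 : ℝ) < p := by exact_mod_cast hp
  set b := EuclideanSpace.basisFun (Fin p) ℝ with hb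
  set m := ∫ u, (inner ℝ (b ⟨0, hp⟩) u.1) ^ 4 ∂(sphereUniform p) with hm
  have hbm : ∀ j, ∫ u, (inner ℝ (b j) u.1) ^ 4 ∂(sphereUniform p) = m := fun j =>
    integral_sphereUniform_inner (g := fun x => x ^ 4) (by fun_prop) (by simp)
  have hcov : ∀ i j, ∫ u, (inner ℝ (b i) u.1) ^ 2 * (inner ℝ (b j) u.1) ^ 2 ∂(sphereUniform p) =
      m / 3 + if i = j then 2 / 3 * m else 0 := by
    intro i j
    by_cases hij : i = j
    · subst hij
      simp only [if_true]
      rw [show m / 3 + 2 / 3 * m = m by ring, ← hbm i]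
      congr 1; ext u; ring
    · rw [integral_inner_sq_mul_inner_sq_sphereUniform_aux hp (by simp) (by simp)
        (b.orthonormal.2 hij), hbm]
      simp [hij]
  have h1 : ∑ i, ∑ j, ∫ u, (inner ℝ (b i) u.1) ^ 2 * (inner ℝ (b j) u.1) ^ 2 ∂(sphereUniform p)
      = 1 := by
    have e : ∀ u : Metric.sphere (0 : EuclideanSpace ℝ (Fin p)) 1,
        ∑ i, ∑ j, (inner ℝ (b i) u.1) ^ 2 * (inner ℝ (b j) u.1) ^ 2 = 1 := by
      intro u
      rw [← Finset.sum_mul_sum, b.sum_sq_inner_right]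
      simp
    calc _ = ∫ u, ∑ i, ∑ j, (inner ℝ (b i) u.1) ^ 2 * (inner ℝ (b j) u.1) ^ 2
              ∂(sphereUniform p) := by
          rw [integral_finsetSum]
          · refine Finset.sum_congr rfl fun i _ => ?_
            rw [integral_finsetSum]
            intro j _
            exact integrable_sphereUniform hp (by fun_prop)
          · intro i _
            exact integrable_sphereUniform hp (by fun_prop)
      _ = 1 := by simp [e]
  have h2 : m = 3 / (p * (p + 2)) := by
    simp only [hcov, Finset.sum_add_distrib, Finset.sum_const, Finset.sum_ite_eq,
      Finset.mem_univ, if_true, Finset.card_univ, Fintype.card_fin, nsmul_eq_mul] at h1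
    rw [eq_div_iff (by positivity)]
    linarith
  have h3 : ∫ u, (inner ℝ z u.1) ^ 4 ∂(sphereUniform p) =
      ∫ u, (inner ℝ (‖z‖ • b ⟨0, hp⟩) u.1) ^ 4 ∂(sphereUniform p) :=
    integral_sphereUniform_inner (g := fun x => x ^ 4) (by fun_prop) (by simp [norm_smul])
  rw [h3, ← h2, hm, mul_comm, ← integral_const_mul]
  congr 1; ext u
  rw [inner_smul_left]
  simp [mul_pow]

/-- With s = ∑ λ_i the variance is (s² + 2∑λ_i²)/(p(p+2)) − s²/p². The terms in s² contribute
nothing positive, and the remaining one is at most 2pB²/p². -/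
lemma variance_quadratic_sphereUniform_le (hp : 0 < p)
    (b : OrthonormalBasis (Fin p) ℝ (EuclideanSpace ℝ (Fin p))) (lam : Fin p → ℝ) (B : ℝ)
    (hB : ∀ i, |lam i| ≤ B) :
    ∫ u, (∑ i, lam i * (inner ℝ (b i) u.1) ^ 2 - (∑ i, lam i) / p) ^ 2 ∂(sphereUniform p) ≤
      2 * B ^ 2 / p := by
  have := isProbabilityMeasure_sphereUniform hp
  have hp' : (0 : ℝ) < p := by exact_mod_cast hp
  have hcov : ∀ i j, ∫ u, (inner ℝ (b i) u.1) ^ 2 * (inner ℝ (b j) u.1) ^ 2 ∂(sphereUniform p) =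
      1 / (p * (p + 2)) + if i = j then (2 / (p * (p + 2)) : ℝ) else 0 := by
    intro i j
    by_cases hij : i = j
    · subst hij
      simp only [if_true]
      have := integral_inner_pow_four_sphereUniform hp (b i)
      simp only [b.norm_eq_one, one_pow, mul_one] at this
      rw [show (1 : ℝ) / (p * (p + 2)) + 2 / (p * (p + 2)) = 3 / (p * (p + 2)) by ring, ← this]
      congr 1; ext u; ring
    · rw [integral_inner_sq_mul_inner_sq_sphereUniform_aux hp (by simp) (by simp)
        (b.orthonormal.2 hij), integral_inner_pow_four_sphereUniform hp]
      simp only [b.norm_eq_one, hij, if_false]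
      ring
  set s := ∑ i, lam i with hs
  have e : ∀ u : Metric.sphere (0 : EuclideanSpace ℝ (Fin p)) 1,
      (∑ i, lam i * (inner ℝ (b i) u.1) ^ 2 - s / p) ^ 2 =
        ∑ i, ∑ j, lam i * lam j * ((inner ℝ (b i) u.1) ^ 2 * (inner ℝ (b j) u.1) ^ 2)
        - 2 * (s / p) * ∑ i, lam i * (inner ℝ (b i) u.1) ^ 2 + (s / p) ^ 2 := by
    intro u
    have : (∑ i, lam i * (inner ℝ (b i) u.1) ^ 2) ^ 2 =
        ∑ i, ∑ j, lam i * lam j * ((inner ℝ (b i) u.1) ^ 2 * (inner ℝ (b j) u.1) ^ 2) := by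
      rw [sq, Finset.sum_mul_sum]
      refine Finset.sum_congr rfl fun i _ => Finset.sum_congr rfl fun j _ => by ring
    rw [← this]; ring
  have i1 : ∫ u, ∑ i, ∑ j, lam i * lam j * ((inner ℝ (b i) u.1) ^ 2 * (inner ℝ (b j) u.1) ^ 2)
      ∂(sphereUniform p) = s ^ 2 / (p * (p + 2)) + 2 / (p * (p + 2)) * ∑ i, lam i ^ 2 := by
    rw [integral_finsetSum _ fun i _ => integrable_sphereUniform hp (by fun_prop)]
    have : ∀ i, ∫ u, ∑ j, lam i * lam j * ((inner ℝ (b i) u.1) ^ 2 * (inner ℝ (b j) u.1) ^ 2)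
        ∂(sphereUniform p) = lam i * s / (p * (p + 2)) + 2 / (p * (p + 2)) * lam i ^ 2 := by
      intro i
      rw [integral_finsetSum _ fun i _ => integrable_sphereUniform hp (by fun_prop)]
      simp only [integral_const_mul, hcov, mul_add, Finset.sum_add_distrib, mul_ite, mul_zero,
        Finset.sum_ite_eq, Finset.mem_univ, if_true]
      rw [← Finset.sum_mul, ← Finset.mul_sum]
      ring
    simp only [this, Finset.sum_add_distrib]
    rw [← Finset.sum_div, ← Finset.sum_mul, ← Finset.mul_sum]
    ring
  have i2 : ∫ u, ∑ i, lam i * (inner ℝ (b i) u.1) ^ 2 ∂(sphereUniform p) = s / p := by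
    rw [integral_finsetSum _ fun i _ => integrable_sphereUniform hp (by fun_prop)]
    simp only [integral_const_mul, integral_inner_sq_sphereUniform hp, b.norm_eq_one]
    rw [← Finset.sum_mul]; ring
  simp only [e]
  rw [integral_add (integrable_sphereUniform hp (by fun_prop)) (integrable_const _),
    integral_sub (integrable_sphereUniform hp (by fun_prop))
      (integrable_sphereUniform hp (by fun_prop)), integral_const_mul, i1, i2]
  have hl : ∑ i, lam i ^ 2 ≤ p * B ^ 2 := by
    calc _ ≤ ∑ _i : Fin p, B ^ 2 := Finset.sum_le_sum fun i _ => by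
          rw [← sq_abs]; exact pow_le_pow_left₀ (abs_nonneg _) (hB i) 2
      _ = _ := by simp
  have h1 : s ^ 2 / (p * (p + 2)) ≤ s ^ 2 / p ^ 2 :=
    div_le_div_of_nonneg_left (sq_nonneg _) (by positivity) (by nlinarith)
  have h2 : 2 / (p * (p + 2)) * ∑ i, lam i ^ 2 ≤ 2 / (p * p) * (p * B ^ 2) := by
    gcongr; linarith
  have h3 : 2 / (p * p) * (p * B ^ 2) = 2 * B ^ 2 / p := by field_simp
  simp only [integral_const, probReal_univ, smul_eq_mul, one_mul]
  have h4 : s ^ 2 / p ^ 2 = (s / p) ^ 2 := by rw [div_pow]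
  nlinarith

end SphereMoments

/-! ### Spatial signs of an elliptical vector: exponential moments and bias -/

section EllipticalLaw

variable {p : ℕ}

lemma inner_toEuclideanCLM_sqrt (Sig : Matrix (Fin p) (Fin p) ℝ)
    (x y : EuclideanSpace ℝ (Fin p)) :
    inner ℝ (Matrix.toEuclideanCLM (𝕜 := ℝ) (CFC.sqrt Sig) x) y =
      inner ℝ x (Matrix.toEuclideanCLM (𝕜 := ℝ) (CFC.sqrt Sig) y) := by
  have h : star (CFC.sqrt Sig) = CFC.sqrt Sig := (CFC.sqrt_nonneg Sig).star_eq
  rw [← ContinuousLinearMap.adjoint_inner_right, ← ContinuousLinearMap.star_eq_adjoint,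
    ← map_star, h]

lemma inner_sqrt_sqrt {Sig : Matrix (Fin p) (Fin p) ℝ} (hS : Sig.PosDef)
    (x y : EuclideanSpace ℝ (Fin p)) :
    inner ℝ (Matrix.toEuclideanCLM (𝕜 := ℝ) (CFC.sqrt Sig) x)
      (Matrix.toEuclideanCLM (𝕜 := ℝ) (CFC.sqrt Sig) y) =
      inner ℝ x (Matrix.toEuclideanCLM (𝕜 := ℝ) Sig y) := by
  rw [inner_toEuclideanCLM_sqrt, ← mul_apply_eq_comp, ← map_mul,
    CFC.sqrt_mul_sqrt_self Sig hS.posSemidef.nonneg]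

lemma norm_sqrt_sq_eq_sum {Sig : Matrix (Fin p) (Fin p) ℝ} (hS : Sig.PosDef)
    (h : Sig.IsHermitian) (x : EuclideanSpace ℝ (Fin p)) :
    ‖Matrix.toEuclideanCLM (𝕜 := ℝ) (CFC.sqrt Sig) x‖ ^ 2 =
      ∑ i, h.eigenvalues i * (inner ℝ (h.eigenvectorBasis i) x) ^ 2 := by
  rw [← real_inner_self_eq_norm_sq, inner_sqrt_sqrt hS]
  have hv : ∀ i, Matrix.toEuclideanCLM (𝕜 := ℝ) Sig (h.eigenvectorBasis i) =
      h.eigenvalues i • h.eigenvectorBasis i := by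
    intro i
    have := h.mulVec_eigenvectorBasis i
    ext j
    rw [Matrix.ofLp_toEuclideanCLM, this]
    rfl
  conv_lhs => rw [← h.eigenvectorBasis.sum_repr' x]
  simp only [map_sum, map_smul, hv]
  rw [h.eigenvectorBasis.sum_repr' x, inner_sum]
  refine Finset.sum_congr rfl fun i _ => ?_
  rw [inner_smul_right, inner_smul_right, real_inner_comm]
  ring

lemma norm_sqrt_sq_bounds {Sig : Matrix (Fin p) (Fin p) ℝ} (hS : Sig.PosDef) {η : ℝ}
    {h : Sig.IsHermitian} (hη : ∀ i, η < h.eigenvalues i ∧ h.eigenvalues i < 1 / η)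
    (x : EuclideanSpace ℝ (Fin p)) :
    η * ‖x‖ ^ 2 ≤ ‖Matrix.toEuclideanCLM (𝕜 := ℝ) (CFC.sqrt Sig) x‖ ^ 2 ∧
      ‖Matrix.toEuclideanCLM (𝕜 := ℝ) (CFC.sqrt Sig) x‖ ^ 2 ≤ 1 / η * ‖x‖ ^ 2 := by
  rw [norm_sqrt_sq_eq_sum hS h, ← h.eigenvectorBasis.sum_sq_inner_right x, Finset.mul_sum,
    Finset.mul_sum]
  constructor <;> refine Finset.sum_le_sum fun i _ => ?_
  · exact mul_le_mul_of_nonneg_right (hη i).1.le (sq_nonneg _)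
  · exact mul_le_mul_of_nonneg_right (hη i).2.le (sq_nonneg _)

lemma inner_sqrt_single {Sig : Matrix (Fin p) (Fin p) ℝ} (hS : Sig.PosDef) (j k : Fin p) :
    inner ℝ (Matrix.toEuclideanCLM (𝕜 := ℝ) (CFC.sqrt Sig) (EuclideanSpace.single j 1))
      (Matrix.toEuclideanCLM (𝕜 := ℝ) (CFC.sqrt Sig) (EuclideanSpace.single k 1)) = Sig j k := by
  rw [inner_sqrt_sqrt hS, Matrix.inner_toEuclideanCLM]
  simp

lemma measurable_spatialSign :
    Measurable (spatialSign : EuclideanSpace ℝ (Fin p) → EuclideanSpace ℝ (Fin p)) := by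
  unfold spatialSign
  fun_prop

lemma norm_spatialSign_le (x : EuclideanSpace ℝ (Fin p)) : ‖spatialSign x‖ ≤ 1 := by
  unfold spatialSign
  rw [norm_smul, norm_inv, norm_norm]
  exact inv_mul_le_one

lemma norm_spatialSign {x : EuclideanSpace ℝ (Fin p)} (hx : x ≠ 0) : ‖spatialSign x‖ = 1 := by
  unfold spatialSign
  rw [norm_smul, norm_inv, norm_norm]
  exact inv_mul_cancel₀ (norm_ne_zero_iff.2 hx)

lemma spatialSign_neg (x : EuclideanSpace ℝ (Fin p)) : spatialSign (-x) = -spatialSign x := by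
  simp [spatialSign]

lemma measurable_ellipticalMap (m : EuclideanSpace ℝ (Fin p)) (Sig : Matrix (Fin p) (Fin p) ℝ) :
    Measurable (fun z : ℝ × Metric.sphere (0 : EuclideanSpace ℝ (Fin p)) 1 =>
      m + z.1 • Matrix.toEuclideanCLM (𝕜 := ℝ) (CFC.sqrt Sig) z.2.1) := by
  apply Continuous.measurable
  fun_prop

lemma isProbabilityMeasure_ellipticalLaw (hp : 0 < p) (m : EuclideanSpace ℝ (Fin p))
    (Sig : Matrix (Fin p) (Fin p) ℝ) (ρ : Measure ℝ) [IsProbabilityMeasure ρ] :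
    IsProbabilityMeasure (ellipticalLaw m Sig ρ) := by
  have := isProbabilityMeasure_sphereUniform hp
  exact Measure.isProbabilityMeasure_map (measurable_ellipticalMap m Sig).aemeasurable

/-- If `f` is odd on the sphere and dominated by `|⟪w, u⟫|`, its exponential moment is controlled
by that of `⟪w, u⟫`. -/
lemma integral_exp_odd_le (hp : 0 < p) {f : EuclideanSpace ℝ (Fin p) → ℝ} (hf : Measurable f)
    (hodd : ∀ x, f (-x) = -f x) {w : EuclideanSpace ℝ (Fin p)}
    (hw : ∀ x, |f x| ≤ |inner ℝ w x|) :
    ∫ u, Real.exp (f u.1) ∂(sphereUniform p) ≤ Real.exp (‖w‖ ^ 2 / (2 * p)) := by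
  have := isProbabilityMeasure_sphereUniform hp
  have hfw : ∀ u : Metric.sphere (0 : EuclideanSpace ℝ (Fin p)) 1, |f u.1| ≤ ‖w‖ := fun u =>
    (hw u.1).trans ((abs_real_inner_le_norm _ _).trans (by simp))
  have hint : ∀ {g : EuclideanSpace ℝ (Fin p) → ℝ}, Measurable g →
      (∀ u : Metric.sphere (0 : EuclideanSpace ℝ (Fin p)) 1, |g u.1| ≤ ‖w‖) →
      Integrable (fun u : Metric.sphere (0 : EuclideanSpace ℝ (Fin p)) 1 => Real.exp (g u.1))
        (sphereUniform p) := by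
    intro g hg hgw
    refine Integrable.of_bound (C := Real.exp ‖w‖)
      (Real.measurable_exp.comp (hg.comp measurable_subtype_coe)).aestronglyMeasurable
      (Filter.Eventually.of_forall fun u => ?_)
    rw [Real.norm_of_nonneg (Real.exp_pos _).le]
    exact Real.exp_le_exp.2 ((le_abs_self _).trans (hgw u))
  have hcosh : ∀ {g : EuclideanSpace ℝ (Fin p) → ℝ}, Measurable g → (∀ x, g (-x) = -g x) →
      (∀ u : Metric.sphere (0 : EuclideanSpace ℝ (Fin p)) 1, |g u.1| ≤ ‖w‖) →
      ∫ u, Real.exp (g u.1) ∂(sphereUniform p) =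
      ∫ u, Real.cosh (g u.1) ∂(sphereUniform p) := by
    intro g hg hgo hgw
    have h1 := integral_sphereUniform_comp (f := fun x => Real.exp (g x))
      (Real.measurable_exp.comp hg) (LinearIsometryEquiv.neg ℝ)
    simp only [LinearIsometryEquiv.coe_neg, hgo] at h1
    simp only [Real.cosh_eq]
    have h2 : Integrable (fun u : Metric.sphere (0 : EuclideanSpace ℝ (Fin p)) 1 =>
        Real.exp (-g u.1)) (sphereUniform p) := hint (g := fun x => -g x) hg.neg (by simpa using hgw)
    rw [integral_div, integral_add (hint hg hgw) h2, h1]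
    ring
  have hlin : ∀ u : Metric.sphere (0 : EuclideanSpace ℝ (Fin p)) 1, |inner ℝ w u.1| ≤ ‖w‖ :=
    fun u => (abs_real_inner_le_norm _ _).trans (by simp)
  have hcint : ∀ {g : EuclideanSpace ℝ (Fin p) → ℝ}, Measurable g →
      (∀ u : Metric.sphere (0 : EuclideanSpace ℝ (Fin p)) 1, |g u.1| ≤ ‖w‖) →
      Integrable (fun u : Metric.sphere (0 : EuclideanSpace ℝ (Fin p)) 1 => Real.cosh (g u.1))
        (sphereUniform p) := by
    intro g hg hgw
    simp only [Real.cosh_eq]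
    exact ((hint hg hgw).add (hint (g := fun x => -g x) hg.neg (by simpa using hgw))).div_const _
  calc _ = ∫ u, Real.cosh (f u.1) ∂(sphereUniform p) := hcosh hf hodd hfw
    _ ≤ ∫ u, Real.cosh (inner ℝ w u.1) ∂(sphereUniform p) :=
        integral_mono (hcint hf hfw) (hcint (g := fun x => inner ℝ w x) (by fun_prop) hlin)
          fun u => Real.cosh_le_cosh.2 (hw u.1)
    _ = ∫ u, Real.exp (inner ℝ w u.1) ∂(sphereUniform p) :=
        (hcosh (g := fun x => inner ℝ w x) (by fun_prop) (by simp) hlin).symm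
    _ ≤ _ := integral_exp_inner_sphereUniform_le hp w

/-- For fixed r the variable ⟪g, U(rBu)⟫ is odd in u and, as ‖Bu‖ ≥ √η, dominated by |⟪Bg, u⟫|/√η.
This gives one factor 1/η, and ‖Bg‖² ≤ ‖g‖²/η gives the other. The bound is uniform in r, so no
moment of r enters. -/
lemma integral_exp_inner_spatialSign_le (hp : 0 < p) (m : EuclideanSpace ℝ (Fin p))
    {Sig : Matrix (Fin p) (Fin p) ℝ} (hS : Sig.PosDef) {η : ℝ} (hη0 : 0 < η)
    {h : Sig.IsHermitian} (hη : ∀ i, η < h.eigenvalues i ∧ h.eigenvalues i < 1 / η)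
    (ρ : Measure ℝ) [IsProbabilityMeasure ρ] (g : EuclideanSpace ℝ (Fin p)) :
    ∫ x, Real.exp (inner ℝ g (spatialSign (x - m))) ∂(ellipticalLaw m Sig ρ) ≤
      Real.exp (1 / η ^ 2 * ‖g‖ ^ 2 / p) := by
  have := isProbabilityMeasure_sphereUniform hp
  have hp' : (0 : ℝ) < p := by exact_mod_cast hp
  set B := Matrix.toEuclideanCLM (𝕜 := ℝ) (CFC.sqrt Sig) with hB
  have hm : Measurable fun x : EuclideanSpace ℝ (Fin p) =>
      Real.exp (inner ℝ g (spatialSign (x - m))) := by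
    have := (measurable_spatialSign (p := p))
    fun_prop
  rw [ellipticalLaw, integral_map (measurable_ellipticalMap m Sig).aemeasurable
    hm.aestronglyMeasurable]
  simp only [add_sub_cancel_left]
  have hB0 : ∀ x, √η * ‖x‖ ≤ ‖B x‖ := by
    intro x
    have := (norm_sqrt_sq_bounds hS hη x).1
    refine (sq_le_sq₀ (by positivity) (norm_nonneg _)).1 ?_
    rwa [mul_pow, Real.sq_sqrt hη0.le]
  have hdom : ∀ (r : ℝ) (x : EuclideanSpace ℝ (Fin p)),
      |inner ℝ g (spatialSign (r • B x))| * (√η * ‖x‖) ≤ |inner ℝ (B g) x| := by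
    intro r x
    rw [inner_toEuclideanCLM_sqrt, ← hB]
    refine (mul_le_mul_of_nonneg_left (hB0 x) (abs_nonneg _)).trans ?_
    rw [spatialSign, norm_smul, inner_smul_right, inner_smul_right, abs_mul, abs_mul, abs_inv,
      abs_mul, abs_norm, abs_norm, Real.norm_eq_abs]
    rcases eq_or_ne r 0 with rfl | hr
    · simp
    rcases eq_or_ne (B x) 0 with h0 | h0
    · simp [h0]
    have h1 : 0 < |r| := abs_pos.2 hr
    have h2 : 0 < ‖B x‖ := norm_pos_iff.2 h0
    apply le_of_eq
    field_simp
  have hm2 : Measurable (fun z : ℝ × Metric.sphere (0 : EuclideanSpace ℝ (Fin p)) 1 =>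
      Real.exp (inner ℝ g (spatialSign (z.1 • B z.2.1)))) := by
    have := (measurable_spatialSign (p := p))
    have h3 : Measurable (fun z : ℝ × Metric.sphere (0 : EuclideanSpace ℝ (Fin p)) 1 =>
      z.1 • B z.2.1) := by apply Continuous.measurable; fun_prop
    fun_prop
  have hint : Integrable (fun z : ℝ × Metric.sphere (0 : EuclideanSpace ℝ (Fin p)) 1 =>
      Real.exp (inner ℝ g (spatialSign (z.1 • B z.2.1)))) (ρ.prod (sphereUniform p)) := by
    refine Integrable.of_bound (C := Real.exp ‖g‖) hm2.aestronglyMeasurable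
      (Filter.Eventually.of_forall fun z => ?_)
    rw [Real.norm_of_nonneg (Real.exp_pos _).le]
    refine Real.exp_le_exp.2 ((real_inner_le_norm _ _).trans ?_)
    exact mul_le_of_le_one_right (norm_nonneg _) (norm_spatialSign_le _)
  rw [integral_prod _ hint]
  have hinner : ∀ r : ℝ, ∫ u, Real.exp (inner ℝ g (spatialSign (r • B u.1))) ∂(sphereUniform p) ≤
      Real.exp (1 / η ^ 2 * ‖g‖ ^ 2 / p) := by
    intro r
    -- The factor ‖x‖ is 1 on the sphere; it makes the domination by a linear functional hold on the
    -- whole space, as `integral_exp_odd_le` requires.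
    set f : EuclideanSpace ℝ (Fin p) → ℝ := fun x => ‖x‖ * inner ℝ g (spatialSign (r • B x))
      with hf
    have hfm : Measurable f := by
      have := (measurable_spatialSign (p := p))
      have h3 : Measurable (fun x : EuclideanSpace ℝ (Fin p) => r • B x) := by
        apply Continuous.measurable; fun_prop
      fun_prop
    have key := integral_exp_odd_le hp hfm (w := (√η)⁻¹ • B g)
      (by
        intro x
        simp only [hf, map_neg, smul_neg, spatialSign_neg, inner_neg_right, norm_neg, mul_neg])
      (by
        intro x
        have := hdom r x
        have hs : 0 < √η := Real.sqrt_pos.2 hη0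
        change |‖x‖ * inner ℝ g (spatialSign (r • B x))| ≤ _
        rw [inner_smul_left, abs_mul, abs_mul, abs_norm]
        simp only [map_inv₀, abs_inv, conj_trivial, abs_of_pos hs]
        rw [inv_mul_eq_div, le_div_iff₀ hs]
        linarith)
    simp only [hf, norm_eq_of_mem_sphere, one_mul] at key
    refine key.trans (Real.exp_le_exp.2 ?_)
    have hs : 0 < √η := Real.sqrt_pos.2 hη0
    have h4 := (norm_sqrt_sq_bounds hS hη g).2
    rw [← hB] at h4
    rw [norm_smul, mul_pow, norm_inv, Real.norm_of_nonneg hs.le, inv_pow, Real.sq_sqrt hη0.le]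
    calc η⁻¹ * ‖B g‖ ^ 2 / (2 * p) ≤ η⁻¹ * (1 / η * ‖g‖ ^ 2) / (2 * p) := by gcongr
      _ ≤ η⁻¹ * (1 / η * ‖g‖ ^ 2) / p := by
          apply div_le_div_of_nonneg_left (by positivity) hp' (by linarith)
      _ = _ := by field_simp
  calc _ ≤ ∫ _r, Real.exp (1 / η ^ 2 * ‖g‖ ^ 2 / p) ∂ρ :=
        integral_mono hint.integral_prod_left (integrable_const _) hinner
    _ = _ := by simp

/-- The radius r is almost surely nonzero, and its sign cancels in a product of two coordinates of
the spatial sign, so the radial law drops out. -/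
lemma spatialSignCov_ellipticalLaw_eq (hp : 0 < p) (m : EuclideanSpace ℝ (Fin p))
    (Sig : Matrix (Fin p) (Fin p) ℝ) (ρ : Measure ℝ) [IsProbabilityMeasure ρ]
    (hne : ∀ᵐ x ∂(ellipticalLaw m Sig ρ), x ≠ m) (j k : Fin p) :
    spatialSignCov (ellipticalLaw m Sig ρ) m j k =
      ∫ u, spatialSign (Matrix.toEuclideanCLM (𝕜 := ℝ) (CFC.sqrt Sig) u.1) j *
        spatialSign (Matrix.toEuclideanCLM (𝕜 := ℝ) (CFC.sqrt Sig) u.1) k ∂(sphereUniform p) := by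
  have := isProbabilityMeasure_sphereUniform hp
  set B := Matrix.toEuclideanCLM (𝕜 := ℝ) (CFC.sqrt Sig) with hB
  have hs := (measurable_spatialSign (p := p))
  have hsc : ∀ j, Measurable fun x : EuclideanSpace ℝ (Fin p) => spatialSign x j := fun j =>
    (by fun_prop : Measurable fun x : EuclideanSpace ℝ (Fin p) => x j).comp hs
  have hm : Measurable fun x : EuclideanSpace ℝ (Fin p) =>
      spatialSign (x - m) j * spatialSign (x - m) k :=
    ((hsc j).comp (measurable_id.sub_const m)).mul ((hsc k).comp (measurable_id.sub_const m))
  have hne' := ae_of_ae_map (measurable_ellipticalMap m Sig).aemeasurable hne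
  simp only [spatialSignCov, Matrix.of_apply]
  rw [ellipticalLaw, integral_map (measurable_ellipticalMap m Sig).aemeasurable
    hm.aestronglyMeasurable]
  simp only [add_sub_cancel_left]
  have : ∫ z : ℝ × Metric.sphere (0 : EuclideanSpace ℝ (Fin p)) 1,
      spatialSign (z.1 • B z.2.1) j * spatialSign (z.1 • B z.2.1) k ∂(ρ.prod (sphereUniform p)) =
      ∫ z : ℝ × Metric.sphere (0 : EuclideanSpace ℝ (Fin p)) 1,
        (1 : ℝ) * (spatialSign (B z.2.1) j * spatialSign (B z.2.1) k)
        ∂(ρ.prod (sphereUniform p)) := by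
    refine integral_congr_ae ?_
    filter_upwards [hne'] with z hz
    have hz1 : z.1 ≠ 0 := by
      intro h0
      apply hz
      simp [h0]
    have h2 : |z.1|⁻¹ * |z.1|⁻¹ * z.1 * z.1 = 1 := by
      rw [← mul_inv, abs_mul_abs_self]
      field_simp
    simp only [spatialSign, norm_smul, Real.norm_eq_abs, PiLp.smul_apply, smul_eq_mul, mul_inv]
    linear_combination (‖B z.2.1‖⁻¹ * (B z.2.1) j * (‖B z.2.1‖⁻¹ * (B z.2.1) k)) * h2
  rw [this, integral_prod_mul (fun _ : ℝ => (1 : ℝ))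
    (fun u : Metric.sphere (0 : EuclideanSpace ℝ (Fin p)) 1 =>
      spatialSign (B u.1) j * spatialSign (B u.1) k)]
  simp

/-- The arithmetic-geometric mean inequality, used twice. The weight will be s = √p, which balances
fourth moments of order p⁻² against a variance of order p⁻¹. -/
lemma abs_mul_mul_sub_le {s : ℝ} (hs : 0 < s) (a b x t : ℝ) :
    |a * b * (t - x)| ≤ s / 4 * (a ^ 4 + b ^ 4) + 1 / (2 * s) * (x - t) ^ 2 := by
  have e3 : 0 ≤ 1 / (2 * s) * (s * (a * b) - (t - x)) ^ 2 := by positivity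
  have e4 : 0 ≤ 1 / (2 * s) * (s * (a * b) + (t - x)) ^ 2 := by positivity
  have e5 : 0 ≤ s / 4 * (a ^ 2 - b ^ 2) ^ 2 := by positivity
  have e6 : 1 / (2 * s) * (s * (a * b) - (t - x)) ^ 2 + s / 4 * (a ^ 2 - b ^ 2) ^ 2 =
      s / 4 * (a ^ 4 + b ^ 4) - a * b * (t - x) + 1 / (2 * s) * (x - t) ^ 2 := by
    field_simp; ring
  have e7 : 1 / (2 * s) * (s * (a * b) + (t - x)) ^ 2 + s / 4 * (a ^ 2 - b ^ 2) ^ 2 =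
      s / 4 * (a ^ 4 + b ^ 4) + a * b * (t - x) + 1 / (2 * s) * (x - t) ^ 2 := by
    field_simp; ring
  rw [abs_le]
  constructor <;> linarith

/-- With the mean t of ‖Bu‖² in the denominator, the expectation would be exactly Λ₀/p. The
replacement costs the factor (t − ‖Bu‖²)/(‖Bu‖² t), whose denominator is at least ηc₀ and whose
numerator has variance at most 2/(η²p). -/
lemma abs_spatialSignCov_sub_le (hp : 0 < p) (m : EuclideanSpace ℝ (Fin p))
    {Sig : Matrix (Fin p) (Fin p) ℝ} (hS : Sig.PosDef) {η c₀ : ℝ} (hη0 : 0 < η) (hc₀ : 0 < c₀)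
    {h : Sig.IsHermitian} (hη : ∀ i, η < h.eigenvalues i ∧ h.eigenvalues i < 1 / η)
    (htr : c₀ * p ≤ Sig.trace)
    (ρ : Measure ℝ) [IsProbabilityMeasure ρ]
    (hne : ∀ᵐ x ∂(ellipticalLaw m Sig ρ), x ≠ m) (j k : Fin p) :
    |(p : ℝ) * spatialSignCov (ellipticalLaw m Sig ρ) m j k - shapeMatrix Sig j k| ≤
      5 / (2 * η ^ 3 * c₀) / √p := by
  have := isProbabilityMeasure_sphereUniform hp
  have hp' : (0 : ℝ) < p := by exact_mod_cast hp
  rw [spatialSignCov_ellipticalLaw_eq hp m Sig ρ hne]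
  set B := Matrix.toEuclideanCLM (𝕜 := ℝ) (CFC.sqrt Sig) with hB
  set t : ℝ := Sig.trace / p with ht
  have htc : c₀ ≤ t := by rw [ht, le_div_iff₀ hp']; exact htr
  have ht0 : 0 < t := hc₀.trans_le htc
  have hBj : ∀ (x : EuclideanSpace ℝ (Fin p)) (i : Fin p),
      B x i = inner ℝ (B (EuclideanSpace.single i 1)) x := by
    intro x i
    rw [inner_toEuclideanCLM_sqrt, ← hB]
    simp [EuclideanSpace.inner_single_left]
  have hq : ∀ u : Metric.sphere (0 : EuclideanSpace ℝ (Fin p)) 1, η ≤ ‖B u.1‖ ^ 2 := by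
    intro u
    have := (norm_sqrt_sq_bounds hS hη u.1).1
    simpa using this
  have hBi : ∀ i : Fin p, ‖B (EuclideanSpace.single i 1)‖ ^ 2 ≤ 1 / η := by
    intro i
    have := (norm_sqrt_sq_bounds hS hη (EuclideanSpace.single i 1)).2
    simpa using this
  have hE4 : ∀ i : Fin p, ∫ u, (B u.1 i) ^ 4 ∂(sphereUniform p) ≤ 3 / p ^ 2 * (1 / η) ^ 2 := by
    intro i
    simp only [hBj]
    rw [integral_inner_pow_four_sphereUniform hp,
      show ‖B (EuclideanSpace.single i 1)‖ ^ 4 = (‖B (EuclideanSpace.single i 1)‖ ^ 2) ^ 2 by ring]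
    gcongr
    · nlinarith
    · exact hBi i
  have hvar : ∫ u, (‖B u.1‖ ^ 2 - t) ^ 2 ∂(sphereUniform p) ≤ 2 * (1 / η) ^ 2 / p := by
    have h1 := variance_quadratic_sphereUniform_le hp h.eigenvectorBasis h.eigenvalues (1 / η)
      (fun i => by
        rw [abs_of_nonneg (hη0.trans (hη i).1).le]
        exact (hη i).2.le)
    have h2 : Sig.trace = ∑ i, h.eigenvalues i := by
      simpa using h.trace_eq_sum_eigenvalues
    simp only [← norm_sqrt_sq_eq_sum hS h, ← hB, ← h2, ← ht] at h1
    exact h1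
  have hBne : ∀ u : Metric.sphere (0 : EuclideanSpace ℝ (Fin p)) 1, ‖B u.1‖ ≠ 0 := by
    intro u h0
    have := hq u
    rw [h0] at this
    norm_num at this
    linarith
  have hcV : ∀ i, Continuous fun u : Metric.sphere (0 : EuclideanSpace ℝ (Fin p)) 1 =>
      spatialSign (B u.1) i := by
    intro i
    simp only [spatialSign, PiLp.smul_apply, smul_eq_mul]
    exact (Continuous.inv₀ (by fun_prop) hBne).mul (by fun_prop)
  have hprod : ∫ u, B u.1 j * B u.1 k ∂(sphereUniform p) = Sig j k / p := by
    simp only [hBj]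
    rw [integral_inner_mul_inner_sphereUniform hp, inner_sqrt_single hS]
  have heq : (p : ℝ) * (∫ u, spatialSign (B u.1) j * spatialSign (B u.1) k ∂(sphereUniform p))
      - shapeMatrix Sig j k =
      p * ∫ u, (spatialSign (B u.1) j * spatialSign (B u.1) k - t⁻¹ * (B u.1 j * B u.1 k))
        ∂(sphereUniform p) := by
    have i1 : Integrable (fun u : Metric.sphere (0 : EuclideanSpace ℝ (Fin p)) 1 =>
        spatialSign (B u.1) j * spatialSign (B u.1) k) (sphereUniform p) :=
      integrable_sphereUniform hp ((hcV j).mul (hcV k))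
    have i2 : Integrable (fun u : Metric.sphere (0 : EuclideanSpace ℝ (Fin p)) 1 =>
        t⁻¹ * (B u.1 j * B u.1 k)) (sphereUniform p) :=
      integrable_sphereUniform hp (by fun_prop)
    rw [integral_sub i1 i2, integral_const_mul, hprod, mul_sub]
    congr 1
    simp only [shapeMatrix, Matrix.smul_apply, smul_eq_mul, ht]
    field_simp
  rw [heq, abs_mul, abs_of_pos hp']
  set s := √(p : ℝ) with hs
  have hs0 : 0 < s := Real.sqrt_pos.2 hp'
  have hs2 : s ^ 2 = p := Real.sq_sqrt hp'.le
  have hpt : ∀ u : Metric.sphere (0 : EuclideanSpace ℝ (Fin p)) 1,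
      |spatialSign (B u.1) j * spatialSign (B u.1) k - t⁻¹ * (B u.1 j * B u.1 k)| ≤
      1 / (η * c₀) * (s / 4 * ((B u.1 j) ^ 4 + (B u.1 k) ^ 4) +
        1 / (2 * s) * (‖B u.1‖ ^ 2 - t) ^ 2) := by
    intro u
    have hn := hBne u
    have hqp : 0 < ‖B u.1‖ ^ 2 := by positivity
    have e1 : spatialSign (B u.1) j * spatialSign (B u.1) k - t⁻¹ * (B u.1 j * B u.1 k) =
        (1 / (‖B u.1‖ ^ 2 * t)) * ((B u.1 j * B u.1 k) * (t - ‖B u.1‖ ^ 2)) := by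
      simp only [spatialSign, PiLp.smul_apply, smul_eq_mul]
      field_simp
    rw [e1, abs_mul, abs_of_pos (by positivity)]
    have e2 : 1 / (‖B u.1‖ ^ 2 * t) ≤ 1 / (η * c₀) := by
      gcongr
      exact hq u
    refine mul_le_mul e2 ?_ (abs_nonneg _) (by positivity)
    exact abs_mul_mul_sub_le hs0 _ _ _ _
  have hi4 : ∀ i, Integrable (fun u : Metric.sphere (0 : EuclideanSpace ℝ (Fin p)) 1 =>
      (B u.1 i) ^ 4) (sphereUniform p) := fun i => integrable_sphereUniform hp (by fun_prop)
  have hi44 : Integrable (fun u : Metric.sphere (0 : EuclideanSpace ℝ (Fin p)) 1 =>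
      s / 4 * ((B u.1 j) ^ 4 + (B u.1 k) ^ 4)) (sphereUniform p) :=
    ((hi4 j).add (hi4 k)).const_mul _
  have hiv : Integrable (fun u : Metric.sphere (0 : EuclideanSpace ℝ (Fin p)) 1 =>
      (‖B u.1‖ ^ 2 - t) ^ 2) (sphereUniform p) := integrable_sphereUniform hp (by fun_prop)
  have hbound : |∫ u, (spatialSign (B u.1) j * spatialSign (B u.1) k - t⁻¹ * (B u.1 j * B u.1 k))
        ∂(sphereUniform p)| ≤ 1 / (η * c₀) * (s / 4 * (3 / p ^ 2 * (1 / η) ^ 2 +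
          3 / p ^ 2 * (1 / η) ^ 2) + 1 / (2 * s) * (2 * (1 / η) ^ 2 / p)) := by
    calc _ ≤ ∫ u, 1 / (η * c₀) * (s / 4 * ((B u.1 j) ^ 4 + (B u.1 k) ^ 4) +
        1 / (2 * s) * (‖B u.1‖ ^ 2 - t) ^ 2) ∂(sphereUniform p) := by
          refine (abs_integral_le_integral_abs).trans (integral_mono ?_ ?_ hpt)
          · refine (integrable_sphereUniform hp ?_).abs
            have h2 : Continuous fun u : Metric.sphere (0 : EuclideanSpace ℝ (Fin p)) 1 =>
              t⁻¹ * (B u.1 j * B u.1 k) := by fun_prop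
            exact ((hcV j).mul (hcV k)).sub h2
          · exact (hi44.add (hiv.const_mul _)).const_mul _
      _ = 1 / (η * c₀) * (s / 4 * (∫ u, (B u.1 j) ^ 4 ∂(sphereUniform p) +
            ∫ u, (B u.1 k) ^ 4 ∂(sphereUniform p)) +
            1 / (2 * s) * ∫ u, (‖B u.1‖ ^ 2 - t) ^ 2 ∂(sphereUniform p)) := by
          rw [integral_const_mul, integral_add hi44 (hiv.const_mul _), integral_const_mul, integral_const_mul,
            integral_add (hi4 j) (hi4 k)]
      _ ≤ _ := by
          gcongr
          · exact hE4 j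
          · exact hE4 k
  refine (mul_le_mul_of_nonneg_left hbound hp'.le).trans (le_of_eq ?_)
  rw [← hs2]
  field_simp
  ring

end EllipticalLaw

/-! ### Exponential moments and Chernoff bounds for i.i.d. sums -/

section Chernoff

variable {E : Type*} [MeasurableSpace E] {μ : Measure E} [IsProbabilityMeasure μ]

lemma integral_exp_sum_pi (n : ℕ) (f : E → ℝ) :
    ∫ x : Fin n → E, Real.exp (∑ i, f (x i)) ∂(Measure.pi fun _ => μ) =
      (∫ x, Real.exp (f x) ∂μ) ^ n := by
  simp only [Real.exp_sum]
  rw [integral_fintype_prod_eq_pow (fun x => Real.exp (f x)), Fintype.card_fin]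

lemma integrable_exp_sum_pi (n : ℕ) {f : E → ℝ} (hf : Integrable (fun x => Real.exp (f x)) μ) :
    Integrable (fun x : Fin n → E => Real.exp (∑ i, f (x i))) (Measure.pi fun _ => μ) := by
  simp only [Real.exp_sum]
  exact Integrable.fintype_prod (f := fun _ x => Real.exp (f x)) fun _ => hf

lemma measureReal_pi_sum_ge_le (n : ℕ) {f : E → ℝ} (hf : Integrable (fun x => Real.exp (f x)) μ)
    {b : ℝ} (hb : ∫ x, Real.exp (f x) ∂μ ≤ Real.exp b) (t : ℝ) :
    (Measure.pi fun _ : Fin n => μ).real {x | t ≤ ∑ i, f (x i)} ≤ Real.exp (n * b - t) := by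
  have h := mul_meas_ge_le_integral_of_nonneg
    (Filter.Eventually.of_forall fun x : Fin n → E => (Real.exp_pos (∑ i, f (x i))).le)
    (integrable_exp_sum_pi n hf) (Real.exp t)
  simp only [Real.exp_le_exp] at h
  rw [integral_exp_sum_pi] at h
  have h2 : (∫ x, Real.exp (f x) ∂μ) ^ n ≤ Real.exp (n * b) := by
    rw [Real.exp_nat_mul]
    exact pow_le_pow_left₀ (integral_nonneg fun x => (Real.exp_pos _).le) hb n
  rw [Real.exp_sub, le_div_iff₀ (Real.exp_pos t), mul_comm]
  exact h.trans h2

lemma measureReal_pi_eval (n : ℕ) (i : Fin n) {s : Set E} (hs : MeasurableSet s) :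
    (Measure.pi fun _ : Fin n => μ).real {x | x i ∈ s} = μ.real s := by
  rw [Measure.real, Measure.real, ← (measurePreserving_eval (fun _ : Fin n => μ) i).measure_preimage
    hs.nullMeasurableSet]
  rfl

end Chernoff

/-! ### Square-exponential moments by Gaussian linearisation -/

section GaussianTrick

lemma integral_exp_sq_div_four_gaussianReal_le :
    ∫⁻ x, ENNReal.ofReal (Real.exp (x ^ 2 / 4)) ∂(gaussianReal 0 1) ≤ 2 := by
  have h1 : ∀ x : ℝ, gaussianPDF 0 1 x * ENNReal.ofReal (Real.exp (x ^ 2 / 4)) =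
      ENNReal.ofReal ((√(2 * Real.pi))⁻¹ * Real.exp (-(1 / 4) * x ^ 2)) := by
    intro x
    rw [gaussianPDF, ← ENNReal.ofReal_mul (gaussianPDFReal_nonneg _ _ _), gaussianPDFReal]
    congr 1
    simp only [NNReal.coe_one, mul_one, sub_zero, mul_assoc]
    rw [← Real.exp_add]
    congr 2
    ring
  rw [gaussianReal_of_var_ne_zero _ one_ne_zero,
    lintegral_withDensity_eq_lintegral_mul _ (measurable_gaussianPDF _ _) (by fun_prop)]
  simp only [Pi.mul_apply, h1]
  rw [← ofReal_integral_eq_lintegral_ofReal]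
  · rw [integral_const_mul, integral_gaussian]
    rw [show (2 : ℝ≥0∞) = ENNReal.ofReal 2 by simp]
    apply ENNReal.ofReal_le_ofReal
    rw [show Real.pi / (1 / 4) = 2 * (2 * Real.pi) by ring,
      Real.sqrt_mul (by norm_num) (2 * Real.pi)]
    have : 0 < √(2 * Real.pi) := Real.sqrt_pos.2 (by positivity)
    have h2 : √2 ≤ 2 := by
      rw [Real.sqrt_le_left (by norm_num)]; norm_num
    rw [mul_comm (√2), inv_mul_cancel_left₀ this.ne']
    exact h2
  · exact (integrable_exp_neg_mul_sq (by norm_num)).const_mul _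
  · exact Filter.Eventually.of_forall fun x => by positivity

lemma lintegral_pi_prod {ι : Type*} [Fintype ι] (γ : Measure ℝ) [IsProbabilityMeasure γ]
    {f : ι → ℝ → ℝ} (hf0 : ∀ i x, 0 ≤ f i x) (hf : ∀ i, Integrable (f i) γ) :
    ∫⁻ g : ι → ℝ, ENNReal.ofReal (∏ i, f i (g i)) ∂(Measure.pi fun _ => γ) =
      ENNReal.ofReal (∏ i, ∫ x, f i x ∂γ) := by
  rw [← integral_fintype_prod_eq_prod (f := f), ofReal_integral_eq_lintegral_ofReal]
  · exact Integrable.fintype_prod_dep hf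
  · exact Filter.Eventually.of_forall fun g => Finset.prod_nonneg fun i _ => hf0 i (g i)

lemma integrable_exp_sq_div_four_gaussianReal :
    Integrable (fun x => Real.exp (x ^ 2 / 4)) (gaussianReal 0 1) := by
  refine ⟨by fun_prop, ?_⟩
  rw [hasFiniteIntegral_iff_ofReal (Filter.Eventually.of_forall fun x => (Real.exp_pos _).le)]
  exact integral_exp_sq_div_four_gaussianReal_le.trans_lt (by simp)

/-- A vector with sub-Gaussian exponential moments in every direction has a square-exponential
moment of its norm. -/
lemma lintegral_exp_sum_sq_le {Ω ι : Type*} [Fintype ι] [MeasurableSpace Ω] {μ : Measure Ω}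
    [SFinite μ] {Y : ι → Ω → ℝ} (hY : ∀ j, Measurable (Y j)) {b : ℝ} (hb : 0 < b)
    (h : ∀ g : ι → ℝ, ∫⁻ ω, ENNReal.ofReal (Real.exp (∑ j, g j * Y j ω)) ∂μ ≤
      ENNReal.ofReal (Real.exp (b * ∑ j, g j ^ 2))) :
    ∫⁻ ω, ENNReal.ofReal (Real.exp (∑ j, Y j ω ^ 2 / (8 * b))) ∂μ ≤
      2 ^ Fintype.card ι := by
  set γ := gaussianReal 0 1
  -- Since s²/2 = 1/(8b), exp(Y²/(8b)) is the Gaussian average of exp(sgY). After the integrals are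
  -- swapped, the hypothesis bounds the inner one by exp(∑ g_j²/4), whose Gaussian integral is √2
  -- per coordinate, rounded up to 2.
  set s : ℝ := (2 * √b)⁻¹ with hs
  have hs2 : s ^ 2 = 1 / (4 * b) := by
    rw [hs, inv_pow, mul_pow, Real.sq_sqrt hb.le]; norm_num
  have hint : ∀ t : ℝ, Integrable (fun x => Real.exp (t * x)) γ :=
    fun t => integrable_exp_mul_gaussianReal t
  have hmgf : ∀ t : ℝ, ∫ x, Real.exp (t * x) ∂γ = Real.exp (t ^ 2 / 2) := by
    intro t
    have := congrFun (mgf_id_gaussianReal (μ := 0) (v := 1)) t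
    simpa [mgf] using this
  have key : ∀ ω, ENNReal.ofReal (Real.exp (∑ j, Y j ω ^ 2 / (8 * b))) =
      ∫⁻ g : ι → ℝ, ENNReal.ofReal (Real.exp (∑ j, (s * g j) * Y j ω))
        ∂(Measure.pi fun _ => γ) := by
    intro ω
    have e : ∀ g : ι → ℝ, Real.exp (∑ j, (s * g j) * Y j ω) =
        ∏ j, (fun j x => Real.exp ((s * Y j ω) * x)) j (g j) := by
      intro g
      rw [Real.exp_sum]
      exact Finset.prod_congr rfl fun j _ => by ring_nf
    simp only [e]
    rw [lintegral_pi_prod γ (f := fun j x => Real.exp ((s * Y j ω) * x))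
      (fun _ _ => (Real.exp_pos _).le) (fun j => hint _)]
    simp only [hmgf]
    rw [Real.exp_sum]
    congr 1
    refine Finset.prod_congr rfl fun j _ => ?_
    rw [mul_pow, hs2]
    congr 1
    field_simp
    ring
  simp only [key]
  rw [lintegral_lintegral_swap]
  · calc _ ≤ ∫⁻ g : ι → ℝ, ENNReal.ofReal (∏ j, (fun _ x => Real.exp (x ^ 2 / 4)) j (g j))
          ∂(Measure.pi fun _ => γ) := by
          refine lintegral_mono fun g => ?_
          refine (h fun j => s * g j).trans (le_of_eq ?_)
          rw [← Real.exp_sum]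
          congr 2
          rw [Finset.mul_sum]
          refine Finset.sum_congr rfl fun j _ => ?_
          rw [mul_pow, hs2]
          field_simp
      _ = ENNReal.ofReal (∏ _j : ι, ∫ x, Real.exp (x ^ 2 / 4) ∂γ) :=
          lintegral_pi_prod γ (f := fun _ x => Real.exp (x ^ 2 / 4))
            (fun _ _ => (Real.exp_pos _).le) fun _ => integrable_exp_sq_div_four_gaussianReal
      _ ≤ _ := by
          rw [Finset.prod_const, Finset.card_univ, ENNReal.ofReal_pow
            (integral_nonneg fun x => (Real.exp_pos _).le), ofReal_integral_eq_lintegral_ofReal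
            integrable_exp_sq_div_four_gaussianReal
            (Filter.Eventually.of_forall fun x => (Real.exp_pos _).le)]
          gcongr
          exact integral_exp_sq_div_four_gaussianReal_le
  · apply Measurable.aemeasurable
    have : ∀ j, Measurable fun z : Ω × (ι → ℝ) => Y j z.1 := fun j => (hY j).comp measurable_fst
    change Measurable fun z : Ω × (ι → ℝ) =>
      ENNReal.ofReal (Real.exp (∑ j, (s * z.2 j) * Y j z.1))
    fun_prop

end GaussianTrick

/-! ### Sub-Gaussian directions -/

section SubGaussian

variable {E : Type*} [MeasurableSpace E] {μ : Measure E}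

/-- A random vector bounded in norm by `1`, with `E exp⟪g, U⟫ ≤ exp (D ‖g‖² / p)` for all `g`. -/
structure SubGaussianDirection {p : ℕ} (μ : Measure E) (U : E → EuclideanSpace ℝ (Fin p)) (D : ℝ) :
    Prop where
  measurable : Measurable U
  norm_le : ∀ x, ‖U x‖ ≤ 1
  mgf_le : ∀ g : EuclideanSpace ℝ (Fin p),
    ∫ x, Real.exp (inner ℝ g (U x)) ∂μ ≤ Real.exp (D * ‖g‖ ^ 2 / p)

variable {p : ℕ} {U : E → EuclideanSpace ℝ (Fin p)} {D : ℝ}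

variable [IsProbabilityMeasure μ]

lemma SubGaussianDirection.integrable_exp (hU : SubGaussianDirection μ U D)
    (g : EuclideanSpace ℝ (Fin p)) : Integrable (fun x => Real.exp (inner ℝ g (U x))) μ := by
  have := hU.measurable
  refine Integrable.of_bound (C := Real.exp ‖g‖) (by fun_prop)
    (Filter.Eventually.of_forall fun x => ?_)
  rw [Real.norm_of_nonneg (Real.exp_pos _).le]
  exact Real.exp_le_exp.2 ((real_inner_le_norm _ _).trans
    (mul_le_of_le_one_right (norm_nonneg _) (hU.norm_le x)))

lemma SubGaussianDirection.measureReal_sum_inner_ge_le (hU : SubGaussianDirection μ U D) (n : ℕ)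
    (g : EuclideanSpace ℝ (Fin p)) {s : ℝ} (hs : 0 < s) (t : ℝ) :
    (Measure.pi fun _ : Fin n => μ).real {x | t ≤ ∑ i, inner ℝ g (U (x i))} ≤
      Real.exp (n * (D * s ^ 2 * ‖g‖ ^ 2 / p) - s * t) := by
  have h1 := measureReal_pi_sum_ge_le n (μ := μ) (hU.integrable_exp (s • g)) (hU.mgf_le (s • g))
    (s * t)
  rw [norm_smul, Real.norm_of_nonneg hs.le, mul_pow, ← mul_assoc] at h1
  refine le_trans (measureReal_mono ?_) h1
  intro x hx
  simp only [Set.mem_ofPred_eq, inner_smul_left, conj_trivial, ← Finset.mul_sum] at hx ⊢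
  exact mul_le_mul_of_nonneg_left hx hs.le

/-- The Gaussian linearisation applies to the coordinates of ∑ U_i with b = nD/p. On the event the
exponent ‖∑ U_i‖²/(8b) is at least 2p, against a moment of at most 2^p; Markov gives 2^p e^{−2p} ≤
e^{−p}. -/
lemma SubGaussianDirection.measureReal_norm_sum_sq_ge_le (hU : SubGaussianDirection μ U D)
    {n : ℕ} (hn : 0 < n) (hp : 0 < p) (hD : 0 < D) :
    (Measure.pi fun _ : Fin n => μ).real {x | 16 * D * n ≤ ‖∑ i, U (x i)‖ ^ 2} ≤
      Real.exp (-p) := by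
  have hp' : (0 : ℝ) < p := by exact_mod_cast hp
  have hn' : (0 : ℝ) < n := by exact_mod_cast hn
  set b : ℝ := n * D / p with hb
  have hb0 : 0 < b := by positivity
  have hm : ∀ i : Fin n, Measurable fun x : Fin n → E => U (x i) := fun i =>
    hU.measurable.comp (measurable_pi_apply i)
  have hmj : ∀ (j : Fin p), Measurable fun x : Fin n → E => (∑ i, U (x i)) j := by
    intro j
    have : Measurable fun x : Fin n → E => ∑ i, U (x i) :=
      Finset.measurable_fun_sum _ fun i _ => hm i
    exact (by fun_prop : Measurable fun x : EuclideanSpace ℝ (Fin p) => x j).comp this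
  have h1 := lintegral_exp_sum_sq_le (μ := Measure.pi fun _ : Fin n => μ)
    (Y := fun j x => (∑ i, U (x i)) j) hmj hb0 (by
    intro g
    set G : EuclideanSpace ℝ (Fin p) := WithLp.toLp 2 g with hG
    have e : ∀ x : Fin n → E, ∑ j, g j * (∑ i, U (x i)) j = ∑ i, inner ℝ G (U (x i)) := by
      intro x
      rw [← inner_sum, PiLp.inner_apply]
      simp [hG, mul_comm]
    simp only [e]
    rw [← ofReal_integral_eq_lintegral_ofReal (integrable_exp_sum_pi n (hU.integrable_exp G))
      (Filter.Eventually.of_forall fun x => (Real.exp_pos _).le),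
      integral_exp_sum_pi n (fun x => inner ℝ G (U x))]
    apply ENNReal.ofReal_le_ofReal
    calc _ ≤ (Real.exp (D * ‖G‖ ^ 2 / p)) ^ n :=
          pow_le_pow_left₀ (integral_nonneg fun x => (Real.exp_pos _).le) (hU.mgf_le G) n
      _ = _ := by
          rw [← Real.exp_nat_mul, EuclideanSpace.real_norm_sq_eq, hb]
          congr 1
          simp only [hG]
          ring)
  have hsub : {x : Fin n → E | 16 * D * n ≤ ‖∑ i, U (x i)‖ ^ 2} ⊆
      {x | ENNReal.ofReal (Real.exp (2 * p)) ≤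
        ENNReal.ofReal (Real.exp (∑ j, (∑ i, U (x i)) j ^ 2 / (8 * b)))} := by
    intro x hx
    rw [Set.mem_ofPred_eq] at hx ⊢
    apply ENNReal.ofReal_le_ofReal
    apply Real.exp_le_exp.2
    rw [← Finset.sum_div, ← EuclideanSpace.real_norm_sq_eq, le_div_iff₀ (by positivity), hb]
    refine le_trans (le_of_eq ?_) hx
    field_simp
    norm_num
  have hmeas : Measurable fun x : Fin n → E =>
      ENNReal.ofReal (Real.exp (∑ j, (∑ i, U (x i)) j ^ 2 / (8 * b))) := by
    refine (Real.measurable_exp.comp (Finset.measurable_fun_sum _ fun j _ => ?_)).ennreal_ofReal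
    exact ((hmj j).pow_const 2).div_const _
  have h2 : ENNReal.ofReal (Real.exp (2 * p)) *
      (Measure.pi fun _ : Fin n => μ) {x | 16 * D * n ≤ ‖∑ i, U (x i)‖ ^ 2} ≤ 2 ^ p := by
    rw [Fintype.card_fin] at h1
    calc _ ≤ _ := mul_le_mul_right (measure_mono hsub) _
      _ ≤ _ := mul_meas_ge_le_lintegral hmeas _
      _ ≤ _ := h1
  have h3 : (Measure.pi fun _ : Fin n => μ).real {x | 16 * D * n ≤ ‖∑ i, U (x i)‖ ^ 2} *
      Real.exp (2 * p) ≤ 2 ^ p := by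
    have := ENNReal.toReal_mono (by simp) h2
    rwa [ENNReal.toReal_mul, ENNReal.toReal_ofReal (Real.exp_pos _).le, ENNReal.toReal_pow,
      mul_comm] at this
  rw [← le_div_iff₀ (Real.exp_pos _)] at h3
  refine h3.trans ?_
  rw [div_le_iff₀ (Real.exp_pos _), ← Real.exp_add]
  calc (2 : ℝ) ^ p ≤ (Real.exp 1) ^ p := by
        gcongr
        linarith [Real.add_one_le_exp (1 : ℝ)]
    _ = _ := by rw [← Real.exp_nat_mul]; congr 1; ring

/-- The linearisation for a single coordinate, with b = D/p. -/
lemma SubGaussianDirection.integral_exp_sq_le (hU : SubGaussianDirection μ U D)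
    (hp : 0 < p) (hD : 0 < D) {e : EuclideanSpace ℝ (Fin p)} (he : ‖e‖ = 1) :
    ∫ x, Real.exp (p * (inner ℝ e (U x)) ^ 2 / (8 * D)) ∂μ ≤ 2 := by
  have hp' : (0 : ℝ) < p := by exact_mod_cast hp
  have hm := hU.measurable
  have h1 := lintegral_exp_sum_sq_le (μ := μ) (ι := Unit) (Y := fun _ x => inner ℝ e (U x))
    (b := D / p) (fun _ => by fun_prop) (by positivity) (by
      intro g
      have h2 := hU.mgf_le (g () • e)
      simp only [inner_smul_left, conj_trivial, norm_smul, he, mul_one, Real.norm_eq_abs,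
        sq_abs] at h2
      have h3 := hU.integrable_exp (g () • e)
      simp only [inner_smul_left, conj_trivial] at h3
      simp only [Finset.univ_unique, Finset.sum_singleton, PUnit.default_eq_unit]
      rw [← ofReal_integral_eq_lintegral_ofReal h3
        (Filter.Eventually.of_forall fun x => (Real.exp_pos _).le)]
      apply ENNReal.ofReal_le_ofReal
      refine h2.trans (le_of_eq ?_)
      congr 1; ring)
  rw [integral_eq_lintegral_of_nonneg_ae
    (Filter.Eventually.of_forall fun x => (Real.exp_pos _).le) (by fun_prop)]
  simp only [Finset.univ_unique, Finset.sum_singleton, Fintype.card_unit, pow_one] at h1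
  have h4 := ENNReal.toReal_mono (by simp) h1
  have e2 : ∀ x, (inner ℝ e (U x)) ^ 2 / (8 * (D / p)) = p * (inner ℝ e (U x)) ^ 2 / (8 * D) := by
    intro x; field_simp
  simpa only [e2, ENNReal.toReal_ofNat] using h4

lemma SubGaussianDirection.integrable_of_abs_le (hU : SubGaussianDirection μ U D)
    {f : EuclideanSpace ℝ (Fin p) → ℝ} (hf : Measurable f) {B : ℝ}
    (hB : ∀ x, ‖x‖ ≤ 1 → |f x| ≤ B) : Integrable (fun x => f (U x)) μ :=
  Integrable.of_bound (C := B) (hf.comp hU.measurable).aestronglyMeasurable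
    (Filter.Eventually.of_forall fun x => hB _ (hU.norm_le x))

lemma SubGaussianDirection.integrable_exp_sq (hU : SubGaussianDirection μ U D) (hD : 0 < D)
    {e : EuclideanSpace ℝ (Fin p)} (he : ‖e‖ = 1) :
    Integrable (fun x => Real.exp (p * (inner ℝ e (U x)) ^ 2 / (8 * D))) μ := by
  refine hU.integrable_of_abs_le (f := fun y => Real.exp (p * (inner ℝ e y) ^ 2 / (8 * D)))
    (by fun_prop) (B := Real.exp (p * 1 / (8 * D))) fun x hx => ?_
  rw [Real.abs_exp]
  have : (inner ℝ e x) ^ 2 ≤ 1 := by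
    rw [sq_le_one_iff_abs_le_one]
    refine (abs_real_inner_le_norm _ _).trans ?_
    rw [he, one_mul]; exact hx
  gcongr

lemma SubGaussianDirection.integral_sq_le (hU : SubGaussianDirection μ U D)
    (hp : 0 < p) (hD : 0 < D) {e : EuclideanSpace ℝ (Fin p)} (he : ‖e‖ = 1) :
    ∫ x, (inner ℝ e (U x)) ^ 2 ∂μ ≤ 16 * D / p := by
  have hp' : (0 : ℝ) < p := by exact_mod_cast hp
  have h1 := hU.integral_exp_sq_le hp hD he
  have h2 : ∫ x, (inner ℝ e (U x)) ^ 2 ∂μ ≤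
      ∫ x, 8 * D / p * Real.exp (p * (inner ℝ e (U x)) ^ 2 / (8 * D)) ∂μ := by
    refine integral_mono ?_ ((hU.integrable_exp_sq hD he).const_mul _) fun x => ?_
    · refine hU.integrable_of_abs_le (f := fun y => (inner ℝ e y) ^ 2) (by fun_prop) (B := 1)
        fun x hx => ?_
      rw [abs_of_nonneg (sq_nonneg _), sq_le_one_iff_abs_le_one]
      refine (abs_real_inner_le_norm _ _).trans ?_
      rw [he, one_mul]; exact hx
    · have := Real.add_one_le_exp (p * (inner ℝ e (U x)) ^ 2 / (8 * D))
      calc (inner ℝ e (U x)) ^ 2 = 8 * D / p * (p * (inner ℝ e (U x)) ^ 2 / (8 * D)) := by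
            field_simp
        _ ≤ _ := by gcongr; linarith
  rw [integral_const_mul] at h2
  refine h2.trans ?_
  calc _ ≤ 8 * D / p * 2 := by gcongr
    _ = _ := by ring

/-- A second-order expansion valid for all x; the exponential weight in the remainder is what a
sub-exponential moment can absorb. -/
lemma exp_le_one_add_add_sq_mul_exp_abs (x : ℝ) :
    Real.exp x ≤ 1 + x + x ^ 2 * Real.exp |x| := by
  have h1 : 1 ≤ Real.exp |x| := Real.one_le_exp (abs_nonneg x)
  rcases le_or_gt |x| 1 with hx | hx
  · have := (abs_le.1 (Real.abs_exp_sub_one_sub_id_le hx)).2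
    nlinarith [sq_nonneg x]
  · rcases le_total 0 x with h0 | h0
    · rw [abs_of_nonneg h0] at *
      have := le_mul_of_one_le_left (Real.exp_pos x).le (by nlinarith : 1 ≤ x ^ 2)
      linarith
    · rw [abs_of_nonpos h0] at hx
      have : Real.exp x ≤ 1 := Real.exp_le_one_iff.2 h0
      nlinarith [sq_nonneg x]

end SubGaussian

/-! ### Bernstein bounds for products of two coordinates -/

section CovarianceConcentration

variable {E : Type*} [MeasurableSpace E] {μ : Measure E} [IsProbabilityMeasure μ]
  {p : ℕ} {U : E → EuclideanSpace ℝ (Fin p)} {D : ℝ}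

lemma SubGaussianDirection.integrable_exp_inner_mul_inner (hU : SubGaussianDirection μ U D)
    {e f : EuclideanSpace ℝ (Fin p)} (he : ‖e‖ = 1) (hf : ‖f‖ = 1) (s : ℝ) :
    Integrable (fun x => Real.exp (s * (p * (inner ℝ e (U x) * inner ℝ f (U x))))) μ := by
  refine hU.integrable_of_abs_le
    (f := fun y => Real.exp (s * (p * (inner ℝ e y * inner ℝ f y)))) (by fun_prop)
    (B := Real.exp (|s| * p)) fun x hx => ?_
  rw [Real.abs_exp]
  apply Real.exp_le_exp.2
  refine (le_abs_self _).trans ?_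
  rw [abs_mul, abs_mul, abs_mul, Nat.abs_cast]
  have h1 : |inner ℝ e x| ≤ 1 := (abs_real_inner_le_norm _ _).trans (by rw [he, one_mul]; exact hx)
  have h2 : |inner ℝ f x| ≤ 1 := (abs_real_inner_le_norm _ _).trans (by rw [hf, one_mul]; exact hx)
  have h3 : |inner ℝ e x| * |inner ℝ f x| ≤ 1 := mul_le_one₀ h1 (abs_nonneg _) h2
  have h4 : (0 : ℝ) ≤ p := Nat.cast_nonneg p
  exact mul_le_mul_of_nonneg_left (mul_le_of_le_one_right h4 h3) (abs_nonneg _)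

/-- A product Y of sub-Gaussian coordinates is sub-exponential: |Y| ≤ p(a² + b²)/2, so exp(|Y|/(8D))
has mean at most 2. In the remainder (sY)² exp|sY| half of the exponent |Y|/(8D) pays for Y² and the
other half for exp|sY|; this is why |s| ≤ 1/(16D). -/
lemma SubGaussianDirection.integral_exp_inner_mul_inner_le (hU : SubGaussianDirection μ U D)
    (hp : 0 < p) (hD : 0 < D) {e f : EuclideanSpace ℝ (Fin p)} (he : ‖e‖ = 1) (hf : ‖f‖ = 1)
    {s : ℝ} (hs : |s| ≤ 1 / (16 * D)) :
    ∫ x, Real.exp (s * (p * (inner ℝ e (U x) * inner ℝ f (U x)))) ∂μ ≤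
      Real.exp (s * (p * ∫ x, inner ℝ e (U x) * inner ℝ f (U x) ∂μ) + 1024 * D ^ 2 * s ^ 2) := by
  have hp' : (0 : ℝ) < p := by exact_mod_cast hp
  have hi1 : Integrable (fun x => inner ℝ e (U x) * inner ℝ f (U x)) μ := by
    refine hU.integrable_of_abs_le (f := fun y => inner ℝ e y * inner ℝ f y) (by fun_prop) (B := 1)
      fun x hx => ?_
    rw [abs_mul]
    have h1 : |inner ℝ e x| ≤ 1 :=
      (abs_real_inner_le_norm _ _).trans (by rw [he, one_mul]; exact hx)
    have h2 : |inner ℝ f x| ≤ 1 :=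
      (abs_real_inner_le_norm _ _).trans (by rw [hf, one_mul]; exact hx)
    exact mul_le_one₀ h1 (abs_nonneg _) h2
  have hpt : ∀ x, Real.exp (s * (p * (inner ℝ e (U x) * inner ℝ f (U x)))) ≤
      1 + s * (p * (inner ℝ e (U x) * inner ℝ f (U x))) + 256 * D ^ 2 * s ^ 2 *
        (Real.exp (p * (inner ℝ e (U x)) ^ 2 / (8 * D)) +
          Real.exp (p * (inner ℝ f (U x)) ^ 2 / (8 * D))) := by
    intro x
    set a := inner ℝ e (U x)
    set b := inner ℝ f (U x)
    set Y := (p : ℝ) * (a * b) with hY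
    refine (exp_le_one_add_add_sq_mul_exp_abs (s * Y)).trans ?_
    gcongr 1 + _ + ?_
    have hW : Real.exp (|Y| / (8 * D)) ≤
        (Real.exp (p * a ^ 2 / (8 * D)) + Real.exp (p * b ^ 2 / (8 * D))) / 2 := by
      have h1 : |Y| ≤ p * (a ^ 2 + b ^ 2) / 2 := by
        rw [hY, abs_mul, abs_mul, Nat.abs_cast]
        have := two_mul_le_add_sq |a| |b|
        rw [sq_abs, sq_abs] at this
        nlinarith
      have h2 : |Y| / (8 * D) ≤ p * a ^ 2 / (8 * D) / 2 + p * b ^ 2 / (8 * D) / 2 := by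
        rw [div_le_iff₀ (by positivity)]
        refine h1.trans (le_of_eq ?_)
        field_simp
      refine (Real.exp_le_exp.2 h2).trans ?_
      rw [Real.exp_add]
      have e1 : Real.exp (p * a ^ 2 / (8 * D)) = Real.exp (p * a ^ 2 / (8 * D) / 2) ^ 2 := by
        rw [← Real.exp_nat_mul]; congr 1; push_cast; ring
      have e2 : Real.exp (p * b ^ 2 / (8 * D)) = Real.exp (p * b ^ 2 / (8 * D) / 2) ^ 2 := by
        rw [← Real.exp_nat_mul]; congr 1; push_cast; ring
      rw [e1, e2]
      nlinarith [sq_nonneg (Real.exp (p * a ^ 2 / (8 * D) / 2) - Real.exp (p * b ^ 2 / (8 * D) / 2))]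
    have hsY : |s * Y| ≤ |Y| / (16 * D) := by
      rw [abs_mul]
      calc |s| * |Y| ≤ 1 / (16 * D) * |Y| := by gcongr
        _ = _ := by ring
    have hYsq : Y ^ 2 ≤ 512 * D ^ 2 * Real.exp (|Y| / (16 * D)) := by
      have h0 : 0 ≤ |Y| / (16 * D) := by positivity
      have := Real.quadratic_le_exp_of_nonneg h0
      have h1 : (|Y| / (16 * D)) ^ 2 ≤ 2 * Real.exp (|Y| / (16 * D)) := by nlinarith
      rw [div_pow, sq_abs, div_le_iff₀ (by positivity)] at h1
      nlinarith
    have hexp : Real.exp (|Y| / (16 * D)) * Real.exp (|Y| / (16 * D)) =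
        Real.exp (|Y| / (8 * D)) := by
      rw [← Real.exp_add]; congr 1; field_simp; ring
    calc (s * Y) ^ 2 * Real.exp |s * Y| = s ^ 2 * (Y ^ 2 * Real.exp |s * Y|) := by ring
      _ ≤ s ^ 2 * ((512 * D ^ 2 * Real.exp (|Y| / (16 * D))) * Real.exp (|Y| / (16 * D))) := by
          gcongr
      _ = 512 * D ^ 2 * s ^ 2 * Real.exp (|Y| / (8 * D)) := by rw [← hexp]; ring
      _ ≤ 512 * D ^ 2 * s ^ 2 *
          ((Real.exp (p * a ^ 2 / (8 * D)) + Real.exp (p * b ^ 2 / (8 * D))) / 2) := by gcongr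
      _ = _ := by ring
  have hi2 : Integrable (fun x => 256 * D ^ 2 * s ^ 2 *
        (Real.exp (p * (inner ℝ e (U x)) ^ 2 / (8 * D)) +
          Real.exp (p * (inner ℝ f (U x)) ^ 2 / (8 * D)))) μ :=
    ((hU.integrable_exp_sq hD he).add (hU.integrable_exp_sq hD hf)).const_mul _
  have hi3 : Integrable (fun x => 1 + s * (p * (inner ℝ e (U x) * inner ℝ f (U x)))) μ :=
    (integrable_const _).add ((hi1.const_mul _).const_mul _)
  have h1 := integral_mono (hU.integrable_exp_inner_mul_inner he hf s) (hi3.add hi2) hpt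
  have h2 : ∫ x, (1 + s * (p * (inner ℝ e (U x) * inner ℝ f (U x)))) + 256 * D ^ 2 * s ^ 2 *
        (Real.exp (p * (inner ℝ e (U x)) ^ 2 / (8 * D)) +
          Real.exp (p * (inner ℝ f (U x)) ^ 2 / (8 * D))) ∂μ =
      1 + s * (p * ∫ x, inner ℝ e (U x) * inner ℝ f (U x) ∂μ) + 256 * D ^ 2 * s ^ 2 *
        (∫ x, Real.exp (p * (inner ℝ e (U x)) ^ 2 / (8 * D)) ∂μ +
          ∫ x, Real.exp (p * (inner ℝ f (U x)) ^ 2 / (8 * D)) ∂μ) := by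
    rw [integral_add hi3 hi2, integral_add (integrable_const _) ((hi1.const_mul _).const_mul _),
      integral_const_mul, integral_const_mul, integral_const_mul,
      integral_add (hU.integrable_exp_sq hD he) (hU.integrable_exp_sq hD hf)]
    simp
  refine (h1.trans (le_of_eq h2)).trans ?_
  have h3 := hU.integral_exp_sq_le hp hD he
  have h4 := hU.integral_exp_sq_le hp hD hf
  have h5 : 256 * D ^ 2 * s ^ 2 *
        (∫ x, Real.exp (p * (inner ℝ e (U x)) ^ 2 / (8 * D)) ∂μ +
          ∫ x, Real.exp (p * (inner ℝ f (U x)) ^ 2 / (8 * D)) ∂μ) ≤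
      256 * D ^ 2 * s ^ 2 * (2 + 2) := by gcongr
  have h6 := Real.add_one_le_exp
    (s * (p * ∫ x, inner ℝ e (U x) * inner ℝ f (U x) ∂μ) + 1024 * D ^ 2 * s ^ 2)
  linarith

lemma SubGaussianDirection.measureReal_abs_cov_ge_le (hU : SubGaussianDirection μ U D)
    (hp : 0 < p) (hD : 0 < D) {e f : EuclideanSpace ℝ (Fin p)} (he : ‖e‖ = 1) (hf : ‖f‖ = 1)
    (n : ℕ) {s : ℝ} (hs0 : 0 < s) (hs : s ≤ 1 / (16 * D)) (t : ℝ) :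
    (Measure.pi fun _ : Fin n => μ).real
      {x | t ≤ |p * ∑ i, inner ℝ e (U (x i)) * inner ℝ f (U (x i)) -
        n * (p * ∫ x, inner ℝ e (U x) * inner ℝ f (U x) ∂μ)|} ≤
      2 * Real.exp (n * (1024 * D ^ 2 * s ^ 2) - s * t) := by
  set r := p * ∫ x, inner ℝ e (U x) * inner ℝ f (U x) ∂μ with hr
  have h : ∀ σ : ℝ, |σ| = s → (Measure.pi fun _ : Fin n => μ).real
      {x | σ * (n * r) + s * t ≤ ∑ i, σ * (p * (inner ℝ e (U (x i)) * inner ℝ f (U (x i))))} ≤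
      Real.exp (n * (1024 * D ^ 2 * s ^ 2) - s * t) := by
    intro σ hσ
    refine (measureReal_pi_sum_ge_le n (hU.integrable_exp_inner_mul_inner he hf σ)
      (hU.integral_exp_inner_mul_inner_le hp hD he hf (by rw [hσ]; exact hs)) _).trans ?_
    apply Real.exp_le_exp.2
    rw [← hr, ← sq_abs σ, hσ]
    linarith
  have h1 := h s (abs_of_pos hs0)
  have h2 := h (-s) (by rw [abs_neg, abs_of_pos hs0])
  rw [two_mul]
  refine le_trans (measureReal_mono ?_) ((measureReal_union_le _ _).trans (add_le_add h1 h2))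
  intro x hx
  simp only [Set.mem_ofPred_eq, Set.mem_union, ← Finset.mul_sum] at hx ⊢
  rcases le_abs.1 hx with hx | hx
  · left
    nlinarith
  · right
    nlinarith

end CovarianceConcentration

/-! ### Tails of the scaled inverse radius -/

section RadialRatio

variable {E : Type*} [MeasurableSpace E]

/-- A nonnegative variable with mean `1` and sub-Gaussian even moments. -/
structure SubGaussianRatio (μ : Measure E) (ν : E → ℝ) (K : ℝ) : Prop where
  measurable : Measurable ν
  nonneg : ∀ x, 0 ≤ ν x
  integrable : Integrable ν μ
  mean : ∫ x, ν x ∂μ = 1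
  moments : ∀ k : ℕ, 1 ≤ k →
    ∫⁻ x, ENNReal.ofReal (ν x ^ (2 * k)) ∂μ ≤ ENNReal.ofReal ((2 * K ^ 2 * k) ^ k)

variable {μ : Measure E} {ν : E → ℝ} {K : ℝ}

lemma SubGaussianRatio.integrable_sq (h : SubGaussianRatio μ ν K) :
    Integrable (fun x => ν x ^ 2) μ := by
  have hm := h.measurable
  refine ⟨by fun_prop, ?_⟩
  rw [hasFiniteIntegral_iff_ofReal (Filter.Eventually.of_forall fun x => sq_nonneg _)]
  have := h.moments 1 le_rfl
  rw [mul_one] at this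
  exact this.trans_lt ENNReal.ofReal_lt_top

lemma SubGaussianRatio.integral_sq_le (h : SubGaussianRatio μ ν K) :
    ∫ x, ν x ^ 2 ∂μ ≤ 2 * K ^ 2 := by
  have hm := h.measurable
  rw [integral_eq_lintegral_of_nonneg_ae
    (Filter.Eventually.of_forall fun x => sq_nonneg _) (by fun_prop)]
  have := h.moments 1 le_rfl
  rw [mul_one, Nat.cast_one, mul_one, pow_one] at this
  have h2 := ENNReal.toReal_mono ENNReal.ofReal_ne_top this
  rwa [ENNReal.toReal_ofReal (by positivity)] at h2

variable [IsProbabilityMeasure μ]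

/-- The moment bound turns the k-th term of the exponential series into at most 6⁻ᵏ kᵏ/k!, and kᵏ/k!
≤ eᵏ ≤ 3ᵏ. The constant 12 is chosen to leave a geometric series of ratio 1/2. -/
lemma SubGaussianRatio.lintegral_exp_sq_le (h : SubGaussianRatio μ ν K) (hK : 0 < K) :
    ∫⁻ x, ENNReal.ofReal (Real.exp (ν x ^ 2 / (12 * K ^ 2))) ∂μ ≤ 2 := by
  have hm := h.measurable
  have e : ∀ x, ENNReal.ofReal (Real.exp (ν x ^ 2 / (12 * K ^ 2))) =
      ∑' k : ℕ, ENNReal.ofReal ((ν x ^ 2 / (12 * K ^ 2)) ^ k / k.factorial) := by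
    intro x
    rw [Real.exp_eq_exp_ℝ, NormedSpace.exp_eq_tsum_div]
    exact ENNReal.ofReal_tsum_of_nonneg (fun k => by positivity)
      (Real.summable_pow_div_factorial _)
  simp only [e]
  rw [lintegral_tsum fun k => by fun_prop]
  have hk : ∀ k : ℕ, ∫⁻ x, ENNReal.ofReal ((ν x ^ 2 / (12 * K ^ 2)) ^ k / k.factorial) ∂μ ≤
      (2⁻¹ : ℝ≥0∞) ^ k := by
    intro k
    rcases Nat.eq_zero_or_pos k with rfl | hk
    · simp
    have e1 : ∀ x, ENNReal.ofReal ((ν x ^ 2 / (12 * K ^ 2)) ^ k / k.factorial) =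
        ENNReal.ofReal (1 / ((12 * K ^ 2) ^ k * k.factorial)) * ENNReal.ofReal (ν x ^ (2 * k)) := by
      intro x
      rw [← ENNReal.ofReal_mul (by positivity), div_pow, ← pow_mul]
      congr 1
      field_simp
    simp only [e1]
    rw [lintegral_const_mul _ (by fun_prop)]
    calc _ ≤ ENNReal.ofReal (1 / ((12 * K ^ 2) ^ k * k.factorial)) *
          ENNReal.ofReal ((2 * K ^ 2 * k) ^ k) := by gcongr; exact h.moments k hk
      _ = ENNReal.ofReal ((1 / 6) ^ k * ((k : ℝ) ^ k / k.factorial)) := by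
          rw [← ENNReal.ofReal_mul (by positivity)]
          congr 1
          rw [show (12 * K ^ 2) ^ k = (6 : ℝ) ^ k * (2 * K ^ 2) ^ k by rw [← mul_pow]; ring,
            mul_pow (2 * K ^ 2), div_pow, one_pow]
          field_simp
      _ ≤ ENNReal.ofReal ((1 / 2) ^ k) := by
          apply ENNReal.ofReal_le_ofReal
          have h1 : (k : ℝ) ^ k / k.factorial ≤ 3 ^ k := by
            refine (Real.pow_div_factorial_le_exp _ (Nat.cast_nonneg k) k).trans ?_
            rw [← mul_one (k : ℝ), Real.exp_nat_mul]
            exact pow_le_pow_left₀ (Real.exp_pos _).le Real.exp_one_lt_three.le k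
          calc _ ≤ (1 / 6 : ℝ) ^ k * 3 ^ k := by gcongr
            _ = _ := by rw [← mul_pow]; norm_num
      _ = _ := by
          rw [ENNReal.ofReal_pow (by norm_num)]
          congr 1
          rw [one_div, ENNReal.ofReal_inv_of_pos (by norm_num)]
          simp
  calc _ ≤ ∑' k : ℕ, (2⁻¹ : ℝ≥0∞) ^ k := ENNReal.tsum_le_tsum hk
    _ = 2 := by rw [ENNReal.tsum_geometric, ENNReal.one_sub_inv_two, inv_inv]

lemma SubGaussianRatio.integrable_exp_sq (h : SubGaussianRatio μ ν K) (hK : 0 < K) :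
    Integrable (fun x => Real.exp (ν x ^ 2 / (12 * K ^ 2))) μ := by
  have hm := h.measurable
  refine ⟨by fun_prop, ?_⟩
  rw [hasFiniteIntegral_iff_ofReal (Filter.Eventually.of_forall fun x => (Real.exp_pos _).le)]
  exact (h.lintegral_exp_sq_le hK).trans_lt (by simp)

lemma SubGaussianRatio.integral_exp_sq_le (h : SubGaussianRatio μ ν K) (hK : 0 < K) :
    ∫ x, Real.exp (ν x ^ 2 / (12 * K ^ 2)) ∂μ ≤ 2 := by
  have hm := h.measurable
  rw [integral_eq_lintegral_of_nonneg_ae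
    (Filter.Eventually.of_forall fun x => (Real.exp_pos _).le) (by fun_prop)]
  simpa using ENNReal.toReal_mono (by simp) (h.lintegral_exp_sq_le hK)

lemma SubGaussianRatio.measureReal_ge_le (h : SubGaussianRatio μ ν K) (hK : 0 < K) {a : ℝ}
    (ha : 0 ≤ a) : μ.real {x | a ≤ ν x} ≤ 2 * Real.exp (-(a ^ 2 / (12 * K ^ 2))) := by
  have h1 := mul_meas_ge_le_integral_of_nonneg
    (Filter.Eventually.of_forall fun x => (Real.exp_pos (ν x ^ 2 / (12 * K ^ 2))).le)
    (h.integrable_exp_sq hK) (Real.exp (a ^ 2 / (12 * K ^ 2)))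
  have h2 := h1.trans (h.integral_exp_sq_le hK)
  rw [Real.exp_neg, ← div_eq_mul_inv, le_div_iff₀ (Real.exp_pos _), mul_comm]
  refine le_trans (mul_le_mul_of_nonneg_left (measureReal_mono ?_) (Real.exp_pos _).le) h2
  intro x hx
  simp only [Set.mem_ofPred_eq] at hx ⊢
  gcongr

/-- The lower tail of a nonnegative variable needs only a second moment, because e^{−y} ≤ 1 − y +
y²/2 for y ≥ 0. The exponent per summand is −s/2 + s²K², minimal at s = 1/(4K²) with value
−1/(16K²). -/
lemma SubGaussianRatio.measureReal_sum_le (h : SubGaussianRatio μ ν K) (hK : 0 < K) (n : ℕ) :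
    (Measure.pi fun _ : Fin n => μ).real {x | ∑ i, ν (x i) ≤ n / 2} ≤
      Real.exp (-(n / (16 * K ^ 2))) := by
  have hm := h.measurable
  set s : ℝ := 1 / (4 * K ^ 2) with hs
  have hs0 : 0 < s := by positivity
  have hi : Integrable (fun x => Real.exp (-s * ν x)) μ := by
    refine Integrable.of_bound (C := 1) (by fun_prop) (Filter.Eventually.of_forall fun x => ?_)
    rw [Real.norm_of_nonneg (Real.exp_pos _).le]
    apply Real.exp_le_one_iff.2
    have := h.nonneg x
    nlinarith
  have hpt : ∀ x, Real.exp (-s * ν x) ≤ 1 - s * ν x + s ^ 2 / 2 * ν x ^ 2 := by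
    intro x
    have h0 : 0 ≤ s * ν x := mul_nonneg hs0.le (h.nonneg x)
    have h1 := Real.quadratic_le_exp_of_nonneg h0
    have h2 : Real.exp (-s * ν x) * Real.exp (s * ν x) = 1 := by
      rw [← Real.exp_add]; simp
    set y := s * ν x with hy
    have h3 : 1 - s * ν x + s ^ 2 / 2 * ν x ^ 2 = 1 - y + y ^ 2 / 2 := by rw [hy]; ring
    rw [h3]
    have h4 : 0 < 1 - y + y ^ 2 / 2 := by nlinarith [sq_nonneg (y - 1)]
    -- The product equals 1 + y⁴/4.
    have h5 : 1 ≤ (1 - y + y ^ 2 / 2) * (1 + y + y ^ 2 / 2) := by nlinarith [sq_nonneg (y ^ 2)]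
    have h6 : 1 ≤ (1 - y + y ^ 2 / 2) * Real.exp y := h5.trans (by gcongr)
    have h7 := Real.exp_pos y
    by_contra hc
    push Not at hc
    have := mul_lt_mul_of_pos_right hc h7
    linarith
  have hi2 : Integrable (fun x => 1 - s * ν x) μ :=
    (integrable_const (1 : ℝ)).sub (h.integrable.const_mul s)
  have h1 := integral_mono hi (hi2.add (h.integrable_sq.const_mul (s ^ 2 / 2))) hpt
  have h2 : ∫ x, (1 - s * ν x) + s ^ 2 / 2 * ν x ^ 2 ∂μ =
      1 - s * ∫ x, ν x ∂μ + s ^ 2 / 2 * ∫ x, ν x ^ 2 ∂μ := by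
    rw [integral_add hi2
      (h.integrable_sq.const_mul (s ^ 2 / 2)),
      integral_sub (integrable_const (1 : ℝ)) (h.integrable.const_mul s),
      integral_const_mul, integral_const_mul]
    simp
  have h3 : ∫ x, Real.exp (-s * ν x) ∂μ ≤ Real.exp (-s + s ^ 2 * K ^ 2) := by
    refine (h1.trans (le_of_eq h2)).trans ?_
    rw [h.mean]
    have := h.integral_sq_le
    have h4 : s ^ 2 / 2 * ∫ x, ν x ^ 2 ∂μ ≤ s ^ 2 / 2 * (2 * K ^ 2) := by gcongr
    linarith [Real.add_one_le_exp (-s + s ^ 2 * K ^ 2)]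
  have h4 := measureReal_pi_sum_ge_le n hi h3 (-s * (n / 2))
  refine le_trans (measureReal_mono ?_) (h4.trans (le_of_eq ?_))
  · intro x hx
    simp only [Set.mem_ofPred_eq, ← Finset.mul_sum] at hx ⊢
    nlinarith
  · congr 1
    rw [hs]
    field_simp
    ring

lemma SubGaussianRatio.measureReal_sum_sq_ge_le (h : SubGaussianRatio μ ν K) (hK : 0 < K)
    (n : ℕ) :
    (Measure.pi fun _ : Fin n => μ).real {x | 24 * K ^ 2 * n ≤ ∑ i, ν (x i) ^ 2} ≤
      Real.exp (-n) := by
  have h1 := measureReal_pi_sum_ge_le n (h.integrable_exp_sq hK) (b := 1)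
    ((h.integral_exp_sq_le hK).trans (by linarith [Real.add_one_le_exp (1 : ℝ)])) (2 * n)
  refine le_trans (measureReal_mono ?_) (h1.trans (le_of_eq ?_))
  · intro x hx
    simp only [Set.mem_ofPred_eq, ← Finset.sum_div] at hx ⊢
    rw [le_div_iff₀ (by positivity)]
    linarith
  · congr 1; ring

/-- Half of the exponent ν²/(12K²) dominates the factor ν; the other half yields the decay in a,
since ν > a where the integrand is nonzero. -/
lemma SubGaussianRatio.integral_tail_le (h : SubGaussianRatio μ ν K) (hK : 0 < K) {a : ℝ}
    (ha : 0 ≤ a) :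
    Integrable (fun x => if a < ν x then ν x else 0) μ ∧
    ∫ x, (if a < ν x then ν x else 0) ∂μ ≤ 7 * K * Real.exp (-(a ^ 2 / (24 * K ^ 2))) := by
  have hm := h.measurable
  have hmeas : Measurable fun x => if a < ν x then ν x else 0 :=
    Measurable.ite (measurableSet_lt measurable_const hm) hm measurable_const
  have hint : Integrable (fun x => if a < ν x then ν x else 0) μ := by
    refine h.integrable.mono hmeas.aestronglyMeasurable (Filter.Eventually.of_forall fun x => ?_)
    split_ifs
    · exact le_rfl
    · simp
  refine ⟨hint, ?_⟩
  have hpt : ∀ x, (if a < ν x then ν x else 0) ≤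
      7 / 2 * K * Real.exp (-(a ^ 2 / (24 * K ^ 2))) * Real.exp (ν x ^ 2 / (12 * K ^ 2)) := by
    intro x
    split_ifs with hx
    · have h0 := h.nonneg x
      have h1 : ν x ≤ 7 / 2 * K * Real.exp (ν x ^ 2 / (24 * K ^ 2)) := by
        have h2 := Real.add_one_le_exp (ν x ^ 2 / (24 * K ^ 2))
        have h3 : ν x ≤ 7 / 2 * K * (ν x ^ 2 / (24 * K ^ 2) + 1) := by
          have e : 7 / 2 * K * (ν x ^ 2 / (24 * K ^ 2) + 1) =
            (7 / 48 * ν x ^ 2 + 7 / 2 * K ^ 2) / K := by field_simp; ring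
          rw [e, le_div_iff₀ hK]
          nlinarith [sq_nonneg (ν x * (7 / 24) - K), sq_nonneg (ν x - 2 * K)]
        exact h3.trans (by gcongr)
      have h4 : Real.exp (ν x ^ 2 / (24 * K ^ 2)) ≤
          Real.exp (-(a ^ 2 / (24 * K ^ 2))) * Real.exp (ν x ^ 2 / (12 * K ^ 2)) := by
        rw [← Real.exp_add]
        apply Real.exp_le_exp.2
        have h5 : a ^ 2 / (24 * K ^ 2) ≤ ν x ^ 2 / (24 * K ^ 2) := by gcongr
        have h6 : ν x ^ 2 / (12 * K ^ 2) = ν x ^ 2 / (24 * K ^ 2) + ν x ^ 2 / (24 * K ^ 2) := by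
          field_simp; ring
        linarith
      calc ν x ≤ _ := h1
        _ ≤ 7 / 2 * K * (Real.exp (-(a ^ 2 / (24 * K ^ 2))) *
            Real.exp (ν x ^ 2 / (12 * K ^ 2))) := by gcongr
        _ = _ := by ring
    · positivity
  calc _ ≤ ∫ x, 7 / 2 * K * Real.exp (-(a ^ 2 / (24 * K ^ 2))) *
          Real.exp (ν x ^ 2 / (12 * K ^ 2)) ∂μ :=
        integral_mono hint ((h.integrable_exp_sq hK).const_mul _) hpt
    _ ≤ 7 / 2 * K * Real.exp (-(a ^ 2 / (24 * K ^ 2))) * 2 := by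
        rw [integral_const_mul]
        gcongr
        exact h.integral_exp_sq_le hK
    _ = _ := by ring

/-- Markov's inequality is enough: at the level a of order √(log p) used later, the truncated mean
is already a high negative power of p. -/
lemma SubGaussianRatio.measureReal_sum_tail_ge_le (h : SubGaussianRatio μ ν K) (hK : 0 < K)
    {a : ℝ} (ha : 0 ≤ a) {n : ℕ} (hn : 0 < n) {t : ℝ} (ht : 0 < t) :
    (Measure.pi fun _ : Fin n => μ).real
      {x | n / t ≤ ∑ i, if a < ν (x i) then ν (x i) else 0} ≤
      t * (7 * K * Real.exp (-(a ^ 2 / (24 * K ^ 2)))) := by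
  have hn' : (0 : ℝ) < n := by exact_mod_cast hn
  obtain ⟨hint, hle⟩ := h.integral_tail_le hK ha
  have hi : ∀ i : Fin n, Integrable (fun x : Fin n → E => if a < ν (x i) then ν (x i) else 0)
      (Measure.pi fun _ => μ) := fun i =>
    integrable_comp_eval (μ := fun _ : Fin n => μ) (i := i) hint
  have h1 := mul_meas_ge_le_integral_of_nonneg (μ := Measure.pi fun _ : Fin n => μ)
    (f := fun x => ∑ i, if a < ν (x i) then ν (x i) else 0)
    (Filter.Eventually.of_forall fun x => Finset.sum_nonneg fun i _ => by
      split_ifs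
      · exact h.nonneg _
      · exact le_rfl)
    (integrable_finsetSum _ fun i _ => hi i) (n / t)
  rw [integral_finsetSum _ fun i _ => hi i] at h1
  have h2 : ∀ i : Fin n, ∫ x : Fin n → E, (if a < ν (x i) then ν (x i) else 0)
      ∂(Measure.pi fun _ => μ) = ∫ x, (if a < ν x then ν x else 0) ∂μ := fun i =>
    integral_comp_eval (μ := fun _ : Fin n => μ) (i := i)
      (f := fun y => if a < ν y then ν y else 0) hint.aestronglyMeasurable
  simp only [h2, Finset.sum_const, Finset.card_univ, Fintype.card_fin, nsmul_eq_mul] at h1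
  have h3 : n / t * (Measure.pi fun _ : Fin n => μ).real
      {x | n / t ≤ ∑ i, if a < ν (x i) then ν (x i) else 0} ≤
      n * (7 * K * Real.exp (-(a ^ 2 / (24 * K ^ 2)))) := h1.trans (by gcongr)
  rw [div_mul_eq_mul_div, mul_div_assoc] at h3
  have h4 := le_of_mul_le_mul_left h3 hn'
  rwa [div_le_iff₀ ht, mul_comm _ t] at h4

end RadialRatio

/-! ### The good event and its probability -/

section GoodSample

/-- The regularity properties of a sample of directions `U i` and inverse radii `ν i` on which the
analysis of the estimator is deterministic. `R` is `p` times the population covariance. -/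
structure GoodSample {n p : ℕ} (D K : ℝ) (R : Fin p → Fin p → ℝ)
    (U : Fin n → EuclideanSpace ℝ (Fin p)) (ν : Fin n → ℝ) : Prop where
  coord_sum : ∀ j, |∑ i, U i j| ≤ 6 * D * √(n * Real.log p / p)
  norm_sum : ‖∑ i, U i‖ ^ 2 ≤ 16 * D * n
  cov : ∀ j k, |p * ∑ i, U i j * U i k - n * R j k| ≤ 1030 * D ^ 2 * √(n * Real.log p)
  -- Twice the localisation constant 65D of the median, so that ν_i‖h‖ ≤ 1/2 for every i.
  ratio_le : ∀ i, ν i * (130 * D) ≤ √n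
  ratio_sum : n / 2 ≤ ∑ i, ν i
  ratio_sq : ∑ i, ν i ^ 2 ≤ 24 * K ^ 2 * n
  ratio_tail : (∑ i, if 14 * K * √(Real.log p) < ν i then ν i else 0) ≤ n / p

variable {E : Type*} [MeasurableSpace E] {μ : Measure E} [IsProbabilityMeasure μ]
  {p : ℕ} {U : E → EuclideanSpace ℝ (Fin p)} {D : ℝ} {ν : E → ℝ} {K : ℝ}

/-- Chernoff with s = √(p log p/n) has exponent (D − 6D) log p ≤ −5 log p; a union bound over 2p
signed coordinates leaves p⁻³. -/
lemma measureReal_coord_sum_gt_le (hU : SubGaussianDirection μ U D) (hD : 1 ≤ D) {n : ℕ}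
    (hn : 0 < n) (hp : 3 ≤ p) :
    (Measure.pi fun _ : Fin n => μ).real
      {x | ∃ j, 6 * D * √(n * Real.log p / p) < |∑ i, U (x i) j|} ≤
      Real.exp (-3 * Real.log p) := by
  have hp' : (0 : ℝ) < p := by exact_mod_cast (by omega : 0 < p)
  have hn' : (0 : ℝ) < n := by exact_mod_cast hn
  have hL : 1 ≤ Real.log p := by
    rw [Real.le_log_iff_exp_le hp']
    have : (3 : ℝ) ≤ p := by exact_mod_cast hp
    linarith [Real.exp_one_lt_three]
  set L := Real.log p with hLdef
  set s := √(p * L / n) with hs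
  have hs0 : 0 < s := Real.sqrt_pos.2 (by positivity)
  have hst : s * √(n * L / p) = L := by
    rw [hs, ← Real.sqrt_mul (by positivity)]
    rw [show p * L / n * (n * L / p) = L ^ 2 by field_simp]
    exact Real.sqrt_sq (by linarith)
  have hs2 : s ^ 2 = p * L / n := Real.sq_sqrt (by positivity)
  have hg : ∀ g : EuclideanSpace ℝ (Fin p), ‖g‖ = 1 → (Measure.pi fun _ : Fin n => μ).real
      {x | 6 * D * √(n * L / p) ≤ ∑ i, inner ℝ g (U (x i))} ≤ Real.exp (-5 * L) := by
    intro g hg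
    refine (hU.measureReal_sum_inner_ge_le n g hs0 _).trans (Real.exp_le_exp.2 ?_)
    have : s * (6 * D * √(n * L / p)) = 6 * D * L := by
      linear_combination 6 * D * hst
    rw [this, hs2, hg]
    have : n * (D * (p * L / n) * 1 ^ 2 / p) = D * L := by field_simp
    rw [this]
    nlinarith
  have hj : ∀ j : Fin p, (Measure.pi fun _ : Fin n => μ).real
      {x | 6 * D * √(n * L / p) < |∑ i, U (x i) j|} ≤ 2 * Real.exp (-5 * L) := by
    intro j
    have h1 := hg (EuclideanSpace.single j 1) (by simp)
    have h2 := hg (-EuclideanSpace.single j 1) (by simp)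
    rw [two_mul]
    refine le_trans (measureReal_mono ?_) ((measureReal_union_le _ _).trans (add_le_add h1 h2))
    intro x hx
    simp only [Set.mem_ofPred_eq, Set.mem_union, EuclideanSpace.inner_single_left, inner_neg_left,
      map_one, one_mul, Finset.sum_neg_distrib] at hx ⊢
    rcases lt_abs.1 hx with hx | hx
    · exact Or.inl hx.le
    · exact Or.inr hx.le
  have hset : {x : Fin n → E | ∃ j, 6 * D * √(n * L / p) < |∑ i, U (x i) j|} =
      ⋃ j, {x | 6 * D * √(n * L / p) < |∑ i, U (x i) j|} := by ext; simp
  rw [hset]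
  refine (measureReal_iUnion_fintype_le _).trans ((Finset.sum_le_sum fun j _ => hj j).trans ?_)
  simp only [Finset.sum_const, Finset.card_univ, Fintype.card_fin, nsmul_eq_mul]
  have hpe : (p : ℝ) = Real.exp L := (Real.exp_log hp').symm
  have h2 : (2 : ℝ) ≤ Real.exp L := by linarith [Real.add_one_le_exp L]
  calc (p : ℝ) * (2 * Real.exp (-5 * L)) = 2 * (Real.exp L * Real.exp (-5 * L)) := by
        rw [hpe]; ring
    _ ≤ Real.exp L * (Real.exp L * Real.exp (-5 * L)) := by gcongr
    _ = Real.exp (-3 * L) := by rw [← Real.exp_add, ← Real.exp_add]; congr 1; ring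

/-- Chernoff with s = √(log p/n), which `hs` places in the Bernstein range. The gap between 1030 and
1024 gives 2p⁻⁶ per entry, to be summed over p² entries. -/
lemma measureReal_cov_gt_le (hU : SubGaussianDirection μ U D) (hD : 1 ≤ D) {n : ℕ}
    (hn : 0 < n) (hp : 3 ≤ p) (hs : √(Real.log p / n) ≤ 1 / (16 * D)) :
    (Measure.pi fun _ : Fin n => μ).real
      {x | ∃ j k, 1030 * D ^ 2 * √(n * Real.log p) <
        |p * ∑ i, U (x i) j * U (x i) k - n * (p * ∫ x, U x j * U x k ∂μ)|} ≤
      Real.exp (-3 * Real.log p) := by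
  have hp' : (0 : ℝ) < p := by exact_mod_cast (by omega : 0 < p)
  have hn' : (0 : ℝ) < n := by exact_mod_cast hn
  have hL : 1 ≤ Real.log p := by
    rw [Real.le_log_iff_exp_le hp']
    have : (3 : ℝ) ≤ p := by exact_mod_cast hp
    linarith [Real.exp_one_lt_three]
  set L := Real.log p with hLdef
  set s := √(L / n) with hsdef
  have hs0 : 0 < s := Real.sqrt_pos.2 (by positivity)
  have hs2 : s ^ 2 = L / n := Real.sq_sqrt (by positivity)
  have hst : s * √(n * L) = L := by
    rw [hsdef, ← Real.sqrt_mul (by positivity)]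
    rw [show L / n * (n * L) = L ^ 2 by field_simp]
    exact Real.sqrt_sq (by linarith)
  have hjk : ∀ jk : Fin p × Fin p, (Measure.pi fun _ : Fin n => μ).real
      {x | 1030 * D ^ 2 * √(n * L) <
        |p * ∑ i, U (x i) jk.1 * U (x i) jk.2 - n * (p * ∫ x, U x jk.1 * U x jk.2 ∂μ)|} ≤
      2 * Real.exp (-6 * L) := by
    rintro ⟨j, k⟩
    have h1 := hU.measureReal_abs_cov_ge_le (by omega) (by linarith)
      (e := EuclideanSpace.single j 1) (f := EuclideanSpace.single k 1) (by simp) (by simp) n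
      hs0 hs (1030 * D ^ 2 * √(n * L))
    simp only [EuclideanSpace.inner_single_left, map_one, one_mul] at h1
    refine le_trans (measureReal_mono ?_) (h1.trans ?_)
    · intro x hx
      rw [Set.mem_ofPred_eq] at hx ⊢
      exact hx.le
    · have e1 : s * (1030 * D ^ 2 * √(n * L)) = 1030 * D ^ 2 * L := by
        linear_combination 1030 * D ^ 2 * hst
      have e2 : n * (1024 * D ^ 2 * s ^ 2) = 1024 * D ^ 2 * L := by rw [hs2]; field_simp
      rw [e1, e2]
      gcongr 2 * Real.exp ?_
      nlinarith [mul_le_mul_of_nonneg_right (one_le_pow₀ hD : 1 ≤ D ^ 2) (by linarith : 0 ≤ L)]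
  have hset : {x : Fin n → E | ∃ j k, 1030 * D ^ 2 * √(n * L) <
        |p * ∑ i, U (x i) j * U (x i) k - n * (p * ∫ x, U x j * U x k ∂μ)|} =
      ⋃ jk : Fin p × Fin p, {x | 1030 * D ^ 2 * √(n * L) <
        |p * ∑ i, U (x i) jk.1 * U (x i) jk.2 - n * (p * ∫ x, U x jk.1 * U x jk.2 ∂μ)|} := by
    ext; simp
  rw [hset]
  refine (measureReal_iUnion_fintype_le _).trans ((Finset.sum_le_sum fun j _ => hjk j).trans ?_)
  simp only [Finset.sum_const, Finset.card_univ, Fintype.card_prod, Fintype.card_fin,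
    nsmul_eq_mul, Nat.cast_mul]
  have hpe : (p : ℝ) = Real.exp L := (Real.exp_log hp').symm
  have h2 : (2 : ℝ) ≤ Real.exp L := by linarith [Real.add_one_le_exp L]
  calc (p : ℝ) * p * (2 * Real.exp (-6 * L)) =
        2 * (Real.exp L * Real.exp L * Real.exp (-6 * L)) := by rw [hpe]; ring
    _ ≤ Real.exp L * (Real.exp L * Real.exp L * Real.exp (-6 * L)) := by gcongr
    _ = Real.exp (-3 * L) := by simp only [← Real.exp_add]; congr 1; ring

/-- A union bound over the n points; 202800 = 12 · 130², and log(2n) in `hsmall` pays for the number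
of points. -/
lemma measureReal_ratio_gt_le (hν : SubGaussianRatio μ ν K) (hD : 0 < D) (hK : 0 < K) {n : ℕ}
    (hn : 0 < n) {L : ℝ}
    (hsmall : Real.log (2 * n) + 3 * L ≤ n / (202800 * K ^ 2 * D ^ 2)) :
    (Measure.pi fun _ : Fin n => μ).real {x | ∃ i, √n < ν (x i) * (130 * D)} ≤
      Real.exp (-3 * L) := by
  have hn' : (0 : ℝ) < n := by exact_mod_cast hn
  have hm := hν.measurable
  have hset : {x : Fin n → E | ∃ i, √n < ν (x i) * (130 * D)} ⊆
      ⋃ i, {x | x i ∈ {y | √n / (130 * D) ≤ ν y}} := by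
    rintro x ⟨i, hi⟩
    refine Set.mem_iUnion.2 ⟨i, ?_⟩
    rw [Set.mem_ofPred_eq, Set.mem_ofPred_eq, div_le_iff₀ (by positivity)]
    exact hi.le
  refine (measureReal_mono hset).trans ((measureReal_iUnion_fintype_le _).trans ?_)
  have hi : ∀ i : Fin n, (Measure.pi fun _ : Fin n => μ).real
      {x | x i ∈ {y | √n / (130 * D) ≤ ν y}} ≤
      2 * Real.exp (-(n / (202800 * K ^ 2 * D ^ 2))) := by
    intro i
    rw [measureReal_pi_eval n i (measurableSet_le measurable_const hm)]
    refine (hν.measureReal_ge_le hK (by positivity)).trans (le_of_eq ?_)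
    rw [div_pow, Real.sq_sqrt hn'.le]
    congr 3
    field_simp
    norm_num
  refine (Finset.sum_le_sum fun i _ => hi i).trans ?_
  simp only [Finset.sum_const, Finset.card_univ, Fintype.card_fin, nsmul_eq_mul]
  rw [← mul_assoc, mul_comm (n : ℝ) 2, ← Real.exp_log (by positivity : 0 < 2 * (n : ℝ)),
    ← Real.exp_add]
  apply Real.exp_le_exp.2
  linarith

theorem measureReal_not_goodSample_le (hU : SubGaussianDirection μ U D)
    (hν : SubGaussianRatio μ ν K) (hD : 1 ≤ D) (hK : 1 ≤ K) {n : ℕ} (hn : 0 < n) (hp : 3 ≤ p)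
    (hsmall : Real.log (2 * n) + 3 * Real.log p ≤ n / (202800 * K ^ 2 * D ^ 2))
    (hlog : 3 * Real.log p ≤ p) (hKp : 7 * K ≤ p) :
    (Measure.pi fun _ : Fin n => μ).real
      {x | ¬ GoodSample D K (fun j k => p * ∫ y, U y j * U y k ∂μ)
        (fun i => U (x i)) (fun i => ν (x i))} ≤ 7 * Real.exp (-3 * Real.log p) := by
  have hp' : (0 : ℝ) < p := by exact_mod_cast (by omega : 0 < p)
  have hn' : (0 : ℝ) < n := by exact_mod_cast hn
  have hn1 : (1 : ℝ) ≤ n := by exact_mod_cast hn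
  have hL : 1 ≤ Real.log p := by
    rw [Real.le_log_iff_exp_le hp']
    have : (3 : ℝ) ≤ p := by exact_mod_cast hp
    linarith [Real.exp_one_lt_three]
  have hpe : (p : ℝ) = Real.exp (Real.log p) := (Real.exp_log hp').symm
  have hD0 : 0 < D := by linarith
  have hK0 : 0 < K := by linarith
  have hlog2 : 0 ≤ Real.log (2 * n) := Real.log_nonneg (by linarith)
  have hLn : 3 * Real.log p ≤ n / (202800 * K ^ 2 * D ^ 2) := by linarith
  have hKsq : 1 ≤ K ^ 2 := one_le_pow₀ hK
  have hDsq : 1 ≤ D ^ 2 := one_le_pow₀ hD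
  have hs : √(Real.log p / n) ≤ 1 / (16 * D) := by
    rw [Real.sqrt_le_left (by positivity), div_le_iff₀ hn', div_pow, one_pow, mul_pow]
    rw [le_div_iff₀ (by positivity)] at hLn
    rw [div_mul_eq_mul_div, one_mul, le_div_iff₀ (by positivity)]
    nlinarith [mul_le_mul_of_nonneg_right hKsq (by positivity : 0 ≤ Real.log p * D ^ 2)]
  have e1 := measureReal_coord_sum_gt_le hU hD hn hp
  have e2 : (Measure.pi fun _ : Fin n => μ).real {x | 16 * D * n ≤ ‖∑ i, U (x i)‖ ^ 2} ≤
      Real.exp (-3 * Real.log p) :=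
    (hU.measureReal_norm_sum_sq_ge_le hn (by omega) hD0).trans (Real.exp_le_exp.2 (by linarith))
  have e3 := measureReal_cov_gt_le hU hD hn hp hs
  have e4 := measureReal_ratio_gt_le hν hD0 hK0 hn hsmall
  have e5 : (Measure.pi fun _ : Fin n => μ).real {x | ∑ i, ν (x i) ≤ n / 2} ≤
      Real.exp (-3 * Real.log p) := by
    refine (hν.measureReal_sum_le hK0 n).trans (Real.exp_le_exp.2 ?_)
    have : (n : ℝ) / (202800 * K ^ 2 * D ^ 2) ≤ n / (16 * K ^ 2) := by
      apply div_le_div_of_nonneg_left hn'.le (by positivity)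
      nlinarith
    linarith
  have e6 : (Measure.pi fun _ : Fin n => μ).real {x | 24 * K ^ 2 * n ≤ ∑ i, ν (x i) ^ 2} ≤
      Real.exp (-3 * Real.log p) := by
    refine (hν.measureReal_sum_sq_ge_le hK0 n).trans (Real.exp_le_exp.2 ?_)
    have : (n : ℝ) / (202800 * K ^ 2 * D ^ 2) ≤ n / 1 := by
      apply div_le_div_of_nonneg_left hn'.le (by positivity)
      nlinarith
    rw [div_one] at this
    linarith
  have e7 : (Measure.pi fun _ : Fin n => μ).real
      {x | (n : ℝ) / p ≤ ∑ i, if 14 * K * √(Real.log p) < ν (x i) then ν (x i) else 0} ≤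
      Real.exp (-3 * Real.log p) := by
    refine (hν.measureReal_sum_tail_ge_le hK0 (by positivity) hn hp').trans ?_
    -- The exponent 196/24 exceeds 5: one power of p pays for the factor t = p in Markov's
    -- inequality, one for 7K ≤ p, and three remain.
    have h1 : (14 * K * √(Real.log p)) ^ 2 / (24 * K ^ 2) = 196 / 24 * Real.log p := by
      rw [mul_pow, mul_pow, Real.sq_sqrt (by linarith)]
      field_simp
      norm_num
    rw [h1]
    calc (p : ℝ) * (7 * K * Real.exp (-(196 / 24 * Real.log p))) ≤
          p * (p * Real.exp (-(196 / 24 * Real.log p))) := by gcongr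
      _ = Real.exp (Real.log p + (Real.log p + -(196 / 24 * Real.log p))) := by
          rw [Real.exp_add, Real.exp_add, ← hpe]
      _ ≤ _ := Real.exp_le_exp.2 (by linarith)
  have hsub : {x : Fin n → E | ¬ GoodSample D K (fun j k => p * ∫ y, U y j * U y k ∂μ)
        (fun i => U (x i)) (fun i => ν (x i))} ⊆
      {x | ∃ j, 6 * D * √(n * Real.log p / p) < |∑ i, U (x i) j|} ∪
      ({x | 16 * D * n ≤ ‖∑ i, U (x i)‖ ^ 2} ∪
      ({x | ∃ j k, 1030 * D ^ 2 * √(n * Real.log p) <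
        |p * ∑ i, U (x i) j * U (x i) k - n * (p * ∫ x, U x j * U x k ∂μ)|} ∪
      ({x | ∃ i, √n < ν (x i) * (130 * D)} ∪
      ({x | ∑ i, ν (x i) ≤ n / 2} ∪
      ({x | 24 * K ^ 2 * n ≤ ∑ i, ν (x i) ^ 2} ∪
      {x | (n : ℝ) / p ≤ ∑ i, if 14 * K * √(Real.log p) < ν (x i) then ν (x i) else 0}))))) := by
    intro x hx
    by_contra hc
    simp only [Set.mem_union, Set.mem_ofPred_eq, not_or, not_exists, not_lt, not_le] at hc
    obtain ⟨h1, h2, h3, h4, h5, h6, h7⟩ := hc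
    exact hx ⟨h1, h2.le, h3, h4, h5.le, h6.le, h7.le⟩
  refine (measureReal_mono hsub).trans ?_
  refine (measureReal_union_le _ _).trans ?_
  refine (add_le_add e1 (measureReal_union_le _ _)).trans ?_
  have f7 := (measureReal_union_le _ _).trans (add_le_add e6 e7)
  have f6 := (measureReal_union_le _ _).trans (add_le_add e5 f7)
  have f5 := (measureReal_union_le _ _).trans (add_le_add e4 f6)
  have f4 := (measureReal_union_le _ _).trans (add_le_add e3 f5)
  linarith

end GoodSample

/-! ### The sample spatial median: existence, expansion, first-order condition -/

section Median

variable {n p : ℕ}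

lemma norm_smul_spatialSign {x : EuclideanSpace ℝ (Fin p)} (hx : x ≠ 0) :
    ‖x‖ • spatialSign x = x := by
  rw [spatialSign, smul_smul, mul_inv_cancel₀ (norm_ne_zero_iff.2 hx), one_smul]

lemma sub_eq_norm_smul {x : EuclideanSpace ℝ (Fin p)} (hx : x ≠ 0) {z : ℝ} (hz : 0 < z)
    (θ : EuclideanSpace ℝ (Fin p)) :
    x - θ = ‖x‖ • (spatialSign x - (z⁻¹ * ‖x‖⁻¹) • (z • θ)) := by
  rw [smul_sub, norm_smul_spatialSign hx, smul_smul, smul_smul]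
  have h1 : ‖x‖ ≠ 0 := norm_ne_zero_iff.2 hx
  have : ‖x‖ * (z⁻¹ * ‖x‖⁻¹ * z) = 1 := by field_simp
  rw [← mul_assoc] at this
  rw [show ‖x‖ * (z⁻¹ * ‖x‖⁻¹) * z = 1 from this, one_smul]

lemma spatialSign_smul_of_pos {r : ℝ} (hr : 0 < r) (x : EuclideanSpace ℝ (Fin p)) :
    spatialSign (r • x) = spatialSign x := by
  rw [spatialSign, spatialSign, norm_smul, Real.norm_of_nonneg hr.le, smul_smul, mul_inv]
  congr 1
  field_simp

/-- Quadratic lower bound for the increment of the norm at a unit vector. -/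
lemma norm_sub_smul_ge {U h : EuclideanSpace ℝ (Fin p)} (hU : ‖U‖ = 1) {ν : ℝ} (hν : 0 ≤ ν)
    (hh : ν * ‖h‖ ≤ 1 / 2) :
    1 + ν * (-inner ℝ U h + ν * ‖h‖ ^ 2 / 4 - 4 * (ν * (inner ℝ U h) ^ 2)) ≤ ‖U - ν • h‖ := by
  set s := inner ℝ U h with hs
  have hsq : ‖U - ν • h‖ ^ 2 = 1 + (-2 * ν * s + ν ^ 2 * ‖h‖ ^ 2) := by
    rw [norm_sub_sq_real, hU, inner_smul_right, norm_smul, Real.norm_of_nonneg hν, ← hs]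
    ring
  set y := -2 * ν * s + ν ^ 2 * ‖h‖ ^ 2 with hy
  -- This is √(1 + y) ≥ 1 + y/2 − y²/2, proved as a polynomial inequality in N = √(1 + y).
  have h1 : 1 + y / 2 - y ^ 2 / 2 ≤ ‖U - ν • h‖ := by
    set N := ‖U - ν • h‖
    have hN : 0 ≤ N := norm_nonneg _
    have : y = N ^ 2 - 1 := by linarith
    rw [this]
    nlinarith [mul_nonneg hN (sq_nonneg (N - 1)), mul_nonneg (mul_nonneg hN hN) (sq_nonneg (N - 1))]
  refine le_trans ?_ h1
  have h2 : y ^ 2 ≤ 8 * ν ^ 2 * s ^ 2 + 2 * (ν * ‖h‖) ^ 4 := by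
    rw [hy]
    nlinarith [sq_nonneg (2 * ν * s + ν ^ 2 * ‖h‖ ^ 2)]
  have h0 : 0 ≤ ν * ‖h‖ := by positivity
  have h3 : (ν * ‖h‖) ^ 4 ≤ (ν * ‖h‖) ^ 2 / 4 := by
    have : (ν * ‖h‖) ^ 2 ≤ 1 / 4 := by nlinarith
    nlinarith [sq_nonneg (ν * ‖h‖)]
  have h4 : ν * (-s + ν * ‖h‖ ^ 2 / 4 - 4 * (ν * s ^ 2)) =
      -(ν * s) + (ν * ‖h‖) ^ 2 / 4 - 4 * ν ^ 2 * s ^ 2 := by ring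
  have h5 : y / 2 = -(ν * s) + (ν * ‖h‖) ^ 2 / 2 := by rw [hy]; ring
  rw [h4, h5]
  linarith

/-- From 2‖x‖N ≤ ‖x‖² + N² with N = ‖x − td‖. The linear coefficient is the exact derivative at t =
0, so at a minimizer small t gives the first-order condition. -/
lemma norm_sub_le_of_smul {x d : EuclideanSpace ℝ (Fin p)} (hx : x ≠ 0) (t : ℝ) :
    ‖x - t • d‖ ≤ ‖x‖ - t * inner ℝ (spatialSign x) d + t ^ 2 * (‖d‖ ^ 2 / (2 * ‖x‖)) := by
  have hx0 : 0 < ‖x‖ := norm_pos_iff.2 hx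
  have h1 : ‖x - t • d‖ ^ 2 = ‖x‖ ^ 2 - 2 * t * inner ℝ x d + t ^ 2 * ‖d‖ ^ 2 := by
    rw [norm_sub_sq_real, inner_smul_right, norm_smul, mul_pow, Real.norm_eq_abs, sq_abs]
    ring
  have h2 : ‖x - t • d‖ ≤ (‖x‖ ^ 2 + ‖x - t • d‖ ^ 2) / (2 * ‖x‖) := by
    rw [le_div_iff₀ (by positivity)]
    nlinarith [sq_nonneg (‖x‖ - ‖x - t • d‖)]
  refine h2.trans (le_of_eq ?_)
  rw [h1, spatialSign, inner_smul_left]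
  simp only [conj_trivial]
  field_simp
  ring

/-- The first order condition at a spatial median that is not a data point. -/
lemma sum_spatialSign_eq_zero {x : Fin n → EuclideanSpace ℝ (Fin p)}
    {θ : EuclideanSpace ℝ (Fin p)} (hθ : IsSpatialMedian x θ) (hne : ∀ i, x i - θ ≠ 0) :
    ∑ i, spatialSign (x i - θ) = 0 := by
  set d := ∑ i, spatialSign (x i - θ) with hd
  set c := ∑ i, ‖d‖ ^ 2 / (2 * ‖x i - θ‖) with hc
  have hc0 : 0 ≤ c := Finset.sum_nonneg fun i _ => by positivity
  have key : ∀ t : ℝ, 0 < t → ‖d‖ ^ 2 ≤ t * c := by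
    intro t ht
    have h1 := hθ (θ + t • d)
    have h2 : ∑ i, ‖x i - (θ + t • d)‖ ≤ ∑ i, (‖x i - θ‖ - t * inner ℝ (spatialSign (x i - θ)) d +
        t ^ 2 * (‖d‖ ^ 2 / (2 * ‖x i - θ‖))) := by
      refine Finset.sum_le_sum fun i _ => ?_
      rw [← sub_sub]
      exact norm_sub_le_of_smul (hne i) t
    rw [Finset.sum_add_distrib, Finset.sum_sub_distrib, ← Finset.mul_sum, ← Finset.mul_sum,
      ← sum_inner, ← hd, ← hc, real_inner_self_eq_norm_sq] at h2
    have h3 : t * ‖d‖ ^ 2 ≤ t * (t * c) := by nlinarith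
    exact le_of_mul_le_mul_left h3 ht
  by_contra hne0
  have hd0 : 0 < ‖d‖ ^ 2 := by
    have : 0 < ‖d‖ := norm_pos_iff.2 hne0
    positivity
  have := key (‖d‖ ^ 2 / (2 * (c + 1))) (by positivity)
  rw [div_mul_eq_mul_div, le_div_iff₀ (by positivity)] at this
  nlinarith

lemma exists_isSpatialMedian (hn : 0 < n) (x : Fin n → EuclideanSpace ℝ (Fin p)) :
    ∃ θ, IsSpatialMedian x θ := by
  have hc : Continuous fun y : EuclideanSpace ℝ (Fin p) => ∑ i, ‖x i - y‖ := by fun_prop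
  have hco : Filter.Tendsto (fun y : EuclideanSpace ℝ (Fin p) => ∑ i, ‖x i - y‖)
      (Filter.cocompact _) Filter.atTop := by
    have h1 : Filter.Tendsto (fun y : EuclideanSpace ℝ (Fin p) => ‖y‖ - ‖x ⟨0, hn⟩‖)
        (Filter.cocompact _) Filter.atTop :=
      Filter.tendsto_atTop_add_const_right _ _ (tendsto_norm_cocompact_atTop)
    refine Filter.tendsto_atTop_mono (fun y => ?_) h1
    have h2 : ‖x ⟨0, hn⟩ - y‖ ≤ ∑ i, ‖x i - y‖ :=
      Finset.single_le_sum (f := fun i => ‖x i - y‖) (fun i _ => norm_nonneg _)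
        (Finset.mem_univ _)
    have h3 := norm_sub_norm_le y (x ⟨0, hn⟩)
    rw [norm_sub_rev] at h3
    linarith
  exact hc.exists_forall_le hco

end Median

/-! ### Localisation of the median on a good sample -/

section Deterministic

variable {n p : ℕ} {D K : ℝ} {R : Fin p → Fin p → ℝ} {U : Fin n → EuclideanSpace ℝ (Fin p)}
  {ν : Fin n → ℝ}

/-- An entrywise error in the covariance costs (∑|h_j|)² ≤ p‖h‖², and this p cancels the
normalisation. The bound is crude for an operator norm, but all that is needed is that it is small
against n‖h‖². -/
lemma GoodSample.sum_inner_sq_le (hG : GoodSample D K R U ν) (hp : 0 < p)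
    (hR : ∀ e : EuclideanSpace ℝ (Fin p), ∑ j, ∑ k, e j * e k * R j k ≤ 16 * D * ‖e‖ ^ 2)
    (h : EuclideanSpace ℝ (Fin p)) :
    ∑ i, (inner ℝ (U i) h) ^ 2 ≤
      (n * (16 * D) / p + 1030 * D ^ 2 * √(n * Real.log p)) * ‖h‖ ^ 2 := by
  have hp' : (0 : ℝ) < p := by exact_mod_cast hp
  set c := 1030 * D ^ 2 * √(n * Real.log p) with hc
  have hc0 : 0 ≤ c := by positivity
  have e1 : p * ∑ i, (inner ℝ (U i) h) ^ 2 =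
      ∑ j, ∑ k, h j * h k * (p * ∑ i, U i j * U i k) := by
    have : ∀ i, (inner ℝ (U i) h) ^ 2 = ∑ j, ∑ k, h j * h k * (U i j * U i k) := by
      intro i
      rw [sq, PiLp.inner_apply, Finset.sum_mul_sum]
      refine Finset.sum_congr rfl fun j _ => Finset.sum_congr rfl fun k _ => ?_
      simp; ring
    simp only [this, Finset.mul_sum]
    rw [Finset.sum_comm]
    refine Finset.sum_congr rfl fun j _ => ?_
    rw [Finset.sum_comm]
    refine Finset.sum_congr rfl fun k _ => Finset.sum_congr rfl fun i _ => by ring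
  have e2 : ∑ j, ∑ k, h j * h k * (p * ∑ i, U i j * U i k) ≤
      ∑ j, ∑ k, (n * (h j * h k * R j k) + c * (|h j| * |h k|)) := by
    refine Finset.sum_le_sum fun j _ => Finset.sum_le_sum fun k _ => ?_
    have h1 := hG.cov j k
    have h2 : h j * h k * (p * ∑ i, U i j * U i k - n * R j k) ≤ |h j| * |h k| * c := by
      refine (le_abs_self _).trans ?_
      rw [abs_mul, abs_mul]
      gcongr
    linarith
  have e3 : ∑ j, ∑ k, (n * (h j * h k * R j k) + c * (|h j| * |h k|)) =
      n * ∑ j, ∑ k, h j * h k * R j k + c * (∑ j, |h j|) ^ 2 := by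
    simp only [Finset.sum_add_distrib, ← Finset.mul_sum]
    rw [sq, Finset.sum_mul]
  have e4 : (∑ j, |h j|) ^ 2 ≤ p * ‖h‖ ^ 2 := by
    have := sq_sum_le_card_mul_sum_sq (s := Finset.univ) (f := fun j => |h j|)
    simpa [EuclideanSpace.real_norm_sq_eq] using this
  have e5 : p * ∑ i, (inner ℝ (U i) h) ^ 2 ≤ n * (16 * D * ‖h‖ ^ 2) + c * (p * ‖h‖ ^ 2) := by
    rw [e1]
    refine e2.trans (e3.le.trans ?_)
    gcongr
    exact hR h
  rw [mul_comm, ← le_div_iff₀ hp'] at e5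
  refine e5.trans (le_of_eq ?_)
  field_simp

lemma GoodSample.sum_coord_sq_le (hG : GoodSample D K R U ν) (hp : 0 < p) (hD : 1 ≤ D)
    (hK : 1 ≤ K)
    (hR : ∀ e : EuclideanSpace ℝ (Fin p), ∑ j, ∑ k, e j * e k * R j k ≤ 16 * D * ‖e‖ ^ 2)
    (hsmall : 10 ^ 9 * K ^ 2 * D ^ 2 * √(n * Real.log p) ≤ n) (j : Fin p) :
    ∑ i, U i j ^ 2 ≤ 17 * D * n / p := by
  have hp' : (0 : ℝ) < p := by exact_mod_cast hp
  have h1 := (abs_le.1 (hG.cov j j)).2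
  have h2 : R j j ≤ 16 * D := by
    have := hR (EuclideanSpace.single j 1)
    simpa [Pi.single_apply] using this
  have h3 : (0 : ℝ) ≤ n := Nat.cast_nonneg n
  have h4 : 1030 * D ^ 2 * √(n * Real.log p) ≤ D * n := by
    have : 1 ≤ K ^ 2 := one_le_pow₀ hK
    have h5 : 1030 * D ^ 2 * √(n * Real.log p) ≤ 10 ^ 9 * K ^ 2 * D ^ 2 * √(n * Real.log p) := by
      gcongr
      nlinarith
    nlinarith
  simp only [← sq] at h1
  rw [le_div_iff₀ hp']
  nlinarith [mul_le_mul_of_nonneg_left h2 h3]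

/-- Cauchy–Schwarz splits off ∑ν_i², and ⟪U_i, h⟫⁴ ≤ ‖h‖²⟪U_i, h⟫² reduces the rest to
`sum_inner_sq_le`. So the negative term in the expansion of the objective takes only part of the
curvature. -/
lemma GoodSample.sum_ratio_mul_inner_sq_le (hG : GoodSample D K R U ν) (hp : 0 < p) (hD : 1 ≤ D)
    (hK : 1 ≤ K) (hU : ∀ i, ‖U i‖ ≤ 1) (hν : ∀ i, 0 ≤ ν i)
    (hR : ∀ e : EuclideanSpace ℝ (Fin p), ∑ j, ∑ k, e j * e k * R j k ≤ 16 * D * ‖e‖ ^ 2)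
    (hsmall : 10 ^ 9 * K ^ 2 * D ^ 2 * √(n * Real.log p) ≤ n)
    (hpl : 10 ^ 7 * K ^ 2 * D ≤ p) (h : EuclideanSpace ℝ (Fin p)) :
    ∑ i, ν i * (inner ℝ (U i) h) ^ 2 ≤ n * ‖h‖ ^ 2 / 64 := by
  have hp' : (0 : ℝ) < p := by exact_mod_cast hp
  have hn' : (0 : ℝ) ≤ n := Nat.cast_nonneg n
  refine (sq_le_sq₀ (Finset.sum_nonneg fun i _ => mul_nonneg (hν i) (sq_nonneg _))
    (by positivity)).1 ?_
  refine (Finset.sum_mul_sq_le_sq_mul_sq _ _ _).trans ?_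
  have h4 : ∑ i, ((inner ℝ (U i) h) ^ 2) ^ 2 ≤ ‖h‖ ^ 2 * ∑ i, (inner ℝ (U i) h) ^ 2 := by
    rw [Finset.mul_sum]
    refine Finset.sum_le_sum fun i _ => ?_
    rw [sq ((inner ℝ (U i) h) ^ 2)]
    have hab : |inner ℝ (U i) h| ≤ ‖h‖ :=
      (abs_real_inner_le_norm _ _).trans (mul_le_of_le_one_left (norm_nonneg _) (hU i))
    refine mul_le_mul_of_nonneg_right ?_ (sq_nonneg _)
    rw [← sq_abs]
    exact pow_le_pow_left₀ (abs_nonneg _) hab 2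
  have h5 := hG.sum_inner_sq_le hp hR h
  have h6 : 24 * K ^ 2 * (n * (16 * D) / p + 1030 * D ^ 2 * √(n * Real.log p)) ≤ n / 4096 := by
    have i1 : 24 * K ^ 2 * (n * (16 * D) / p) ≤ n / 8192 := by
      rw [mul_div_assoc', div_le_iff₀ hp']
      nlinarith
    have i2 : 24 * K ^ 2 * (1030 * D ^ 2 * √(n * Real.log p)) ≤ n / 8192 := by
      have : 0 ≤ K ^ 2 * D ^ 2 * √(n * Real.log p) := by positivity
      linarith
    linarith
  set c := n * (16 * D) / p + 1030 * D ^ 2 * √(n * Real.log p)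
  calc _ ≤ (24 * K ^ 2 * n) * (‖h‖ ^ 2 * (c * ‖h‖ ^ 2)) := by
        refine mul_le_mul hG.ratio_sq (h4.trans ?_)
          (Finset.sum_nonneg fun i _ => sq_nonneg _) (by positivity)
        exact mul_le_mul_of_nonneg_left h5 (sq_nonneg _)
    _ = n * ‖h‖ ^ 4 * (24 * K ^ 2 * c) := by ring
    _ ≤ n * ‖h‖ ^ 4 * (n / 4096) := by gcongr
    _ = _ := by ring

/-- A minimizer of `∑ ‖x i - ·‖` lies within `65 D / √n` of the origin, in the scale of the
mean inverse radius. -/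
lemma GoodSample.norm_median_le (hn : 0 < n) (hp : 0 < p) (hD : 1 ≤ D) (hK : 1 ≤ K)
    {x : Fin n → EuclideanSpace ℝ (Fin p)} (hx : ∀ i, x i ≠ 0) {z : ℝ} (hz : 0 < z)
    (hG : GoodSample D K R (fun i => spatialSign (x i)) (fun i => z⁻¹ * ‖x i‖⁻¹))
    (hR : ∀ e : EuclideanSpace ℝ (Fin p), ∑ j, ∑ k, e j * e k * R j k ≤ 16 * D * ‖e‖ ^ 2)
    (hsmall : 10 ^ 9 * K ^ 2 * D ^ 2 * √(n * Real.log p) ≤ n)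
    (hpl : 10 ^ 7 * K ^ 2 * D ≤ p)
    {θ : EuclideanSpace ℝ (Fin p)} (hθ : IsSpatialMedian x θ) :
    √n * ‖z • θ‖ ≤ 65 * D := by
  have hp' : (0 : ℝ) < p := by exact_mod_cast hp
  have hn' : (0 : ℝ) < n := by exact_mod_cast hn
  have hD0 : 0 < D := by linarith
  have hK0 : 0 < K := by linarith
  by_contra hcon
  push Not at hcon
  set a := √(n : ℝ) with ha
  have ha0 : 0 < a := Real.sqrt_pos.2 hn'
  have ha2 : a ^ 2 = n := Real.sq_sqrt hn'.le
  -- At distance ρ the linear term is at most 4Daρ, while the quadratic one is at least nρ²(1/8 −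
  -- 4/64) = nρ²/16 = 65Daρ/16; hence any constant above 64 would do.
  set ρ := 65 * D / a with hρ
  have hρ0 : 0 < ρ := by positivity
  have hρa : ρ * a = 65 * D := by rw [hρ]; field_simp
  have hθ0 : 0 < ‖z • θ‖ := by
    by_contra h0
    have : ‖z • θ‖ = 0 := le_antisymm (not_lt.1 h0) (norm_nonneg _)
    rw [this, mul_zero] at hcon
    linarith
  -- The minimizer is pulled back along its ray to scaled radius ρ; by convexity the objective there
  -- still does not exceed its value at the origin.
  set t := ρ / ‖z • θ‖ with ht
  have ht0 : 0 ≤ t := by positivity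
  have ht1 : t ≤ 1 := by
    rw [ht, div_le_one hθ0]
    rw [hρ, div_le_iff₀ ha0]
    linarith
  set U := fun i => spatialSign (x i) with hU
  set ν := fun i => z⁻¹ * ‖x i‖⁻¹ with hν
  set h := z • (t • θ) with hh
  have hhn : ‖h‖ = ρ := by
    rw [hh, smul_comm, norm_smul, Real.norm_of_nonneg ht0, ht, div_mul_cancel₀ _ hθ0.ne']
  have hν0 : ∀ i, 0 < ν i := fun i => by
    have := norm_pos_iff.2 (hx i)
    simp only [hν]; positivity
  have hνρ : ∀ i, ν i * ‖h‖ ≤ 1 / 2 := by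
    intro i
    have h1 := hG.ratio_le i
    change ν i * (130 * D) ≤ a at h1
    rw [hhn, hρ, mul_div_assoc', div_le_iff₀ ha0]
    linarith
  have hconv : ∑ i, ‖x i - t • θ‖ ≤ ∑ i, ‖x i‖ := by
    have h1 := hθ 0
    simp only [sub_zero] at h1
    have h2 : ∀ i, ‖x i - t • θ‖ ≤ (1 - t) * ‖x i‖ + t * ‖x i - θ‖ := by
      intro i
      have e : x i - t • θ = (1 - t) • x i + t • (x i - θ) := by module
      rw [e]
      refine (norm_add_le _ _).trans ?_
      rw [norm_smul, norm_smul, Real.norm_of_nonneg ht0, Real.norm_of_nonneg (by linarith)]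
    calc _ ≤ ∑ i, ((1 - t) * ‖x i‖ + t * ‖x i - θ‖) := Finset.sum_le_sum fun i _ => h2 i
      _ = (1 - t) * ∑ i, ‖x i‖ + t * ∑ i, ‖x i - θ‖ := by
          rw [Finset.sum_add_distrib, Finset.mul_sum, Finset.mul_sum]
      _ ≤ (1 - t) * ∑ i, ‖x i‖ + t * ∑ i, ‖x i‖ := by gcongr
      _ = _ := by ring
  have hlow : ∀ i, z⁻¹ * (-inner ℝ (U i) h + ν i * ‖h‖ ^ 2 / 4 - 4 * (ν i * (inner ℝ (U i) h) ^ 2))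
      ≤ ‖x i - t • θ‖ - ‖x i‖ := by
    intro i
    have hxi := norm_pos_iff.2 (hx i)
    have h1 := norm_sub_smul_ge (norm_spatialSign (hx i)) (hν0 i).le (hνρ i)
    have e : ‖x i - t • θ‖ = ‖x i‖ * ‖U i - ν i • h‖ := by
      rw [sub_eq_norm_smul (hx i) hz (t • θ), norm_smul, norm_norm]
    rw [e]
    have h2 := mul_le_mul_of_nonneg_left h1 hxi.le
    have e2 : ‖x i‖ * ν i = z⁻¹ := by
      simp only [hν]; field_simp
    rw [← e2]
    linarith
  have hsum := (Finset.sum_le_sum fun i (_ : i ∈ Finset.univ) => hlow i)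
  rw [Finset.sum_sub_distrib, ← Finset.mul_sum] at hsum
  have hneg : ∑ i, (-inner ℝ (U i) h + ν i * ‖h‖ ^ 2 / 4 - 4 * (ν i * (inner ℝ (U i) h) ^ 2)) ≤ 0 := by
    by_contra hc
    push Not at hc
    have := mul_pos (inv_pos.2 hz) hc
    linarith
  rw [Finset.sum_sub_distrib, Finset.sum_add_distrib, Finset.sum_neg_distrib, ← sum_inner,
    ← Finset.mul_sum, ← Finset.sum_div, ← Finset.sum_mul, hhn] at hneg
  have h1 : inner ℝ (∑ i, U i) h ≤ 4 * D * a * ρ := by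
    refine (real_inner_le_norm _ _).trans ?_
    rw [hhn]
    gcongr
    refine (sq_le_sq₀ (norm_nonneg _) (by positivity)).1 ?_
    refine hG.norm_sum.trans ?_
    rw [mul_pow, ha2]
    have : D ≤ D ^ 2 := by nlinarith
    nlinarith
  have h2 : n / 2 * ρ ^ 2 / 4 ≤ (∑ i, ν i) * ρ ^ 2 / 4 := by
    have := hG.ratio_sum
    gcongr
  have h3 := hG.sum_ratio_mul_inner_sq_le hp hD hK (fun i => norm_spatialSign_le _)
    (fun i => (hν0 i).le) hR hsmall hpl h
  rw [hhn] at h3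
  have h7 : n * ρ ^ 2 = 65 * D * a * ρ := by
    rw [← ha2]
    linear_combination (a * ρ) * hρa
  have h8 : 0 < D * a * ρ := by positivity
  have h9 : n / 2 * ρ ^ 2 / 4 = n * ρ ^ 2 / 8 := by ring
  nlinarith

end Deterministic

/-! ### Effect of recentring at the median on the sign covariance -/

section Perturbation

variable {n p : ℕ} {D K : ℝ} {R : Fin p → Fin p → ℝ} {U : Fin n → EuclideanSpace ℝ (Fin p)}
  {ν : Fin n → ℝ}

lemma inv_norm_sub_smul_bounds {V h : EuclideanSpace ℝ (Fin p)} (hV : ‖V‖ = 1) {r : ℝ}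
    (hr : 0 ≤ r) (hh : r * ‖h‖ ≤ 1 / 2) :
    2 / 3 ≤ ‖V - r • h‖⁻¹ ∧ ‖V - r • h‖⁻¹ ≤ 2 ∧ |‖V - r • h‖⁻¹ - 1| ≤ 2 * (r * ‖h‖) ∧
      |(‖V - r • h‖⁻¹) ^ 2 - 1| ≤ 6 * (r * ‖h‖) := by
  set N := ‖V - r • h‖ with hN
  have h1 : |N - 1| ≤ r * ‖h‖ := by
    have := abs_norm_sub_norm_le (V - r • h) V
    rw [hV, sub_sub_cancel_left, norm_neg, norm_smul, Real.norm_of_nonneg hr] at this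
    exact this
  obtain ⟨h2, h3⟩ := abs_le.1 h1
  have hN1 : 1 / 2 ≤ N := by linarith
  have hN0 : 0 < N := by linarith
  have i1 : 2 / 3 ≤ N⁻¹ := by
    rw [← one_div, le_div_iff₀ hN0]; linarith
  have i2 : N⁻¹ ≤ 2 := by
    rw [← one_div, div_le_iff₀ hN0]; linarith
  have i3 : |N⁻¹ - 1| ≤ 2 * (r * ‖h‖) := by
    have : N⁻¹ - 1 = -(N⁻¹ * (N - 1)) := by field_simp; ring
    rw [this, abs_neg, abs_mul, abs_of_pos (inv_pos.2 hN0)]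
    exact mul_le_mul i2 h1 (abs_nonneg _) (by norm_num)
  refine ⟨i1, i2, i3, ?_⟩
  have : (N⁻¹) ^ 2 - 1 = (N⁻¹ + 1) * (N⁻¹ - 1) := by ring
  rw [this, abs_mul, abs_of_pos (by linarith)]
  calc (N⁻¹ + 1) * |N⁻¹ - 1| ≤ 3 * (2 * (r * ‖h‖)) :=
        mul_le_mul (by linarith) i3 (abs_nonneg _) (by norm_num)
    _ = _ := by ring

lemma sum_ratio_mul_abs_coord_le (hG : GoodSample D K R U ν) (hp : 0 < p) (hD : 1 ≤ D)
    (hK : 1 ≤ K) (hν : ∀ i, 0 ≤ ν i) {j : Fin p} (hj : ∑ i, U i j ^ 2 ≤ 17 * D * n / p) :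
    ∑ i, ν i * |U i j| ≤ 21 * K * D * n / √p := by
  have hp' : (0 : ℝ) < p := by exact_mod_cast hp
  have hq : 0 < √(p : ℝ) := Real.sqrt_pos.2 hp'
  have hn' : (0 : ℝ) ≤ n := Nat.cast_nonneg n
  refine (sq_le_sq₀ (Finset.sum_nonneg fun i _ => mul_nonneg (hν i) (abs_nonneg _))
    (by positivity)).1 ?_
  refine (Finset.sum_mul_sq_le_sq_mul_sq _ _ _).trans ?_
  simp only [sq_abs]
  rw [div_pow, Real.sq_sqrt hp'.le]
  calc (∑ i, ν i ^ 2) * ∑ i, U i j ^ 2 ≤ (24 * K ^ 2 * n) * (17 * D * n / p) :=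
        mul_le_mul hG.ratio_sq hj (Finset.sum_nonneg fun i _ => sq_nonneg _) (by positivity)
    _ = 408 * D * (K ^ 2 * n ^ 2) / p := by ring
    _ ≤ 441 * D ^ 2 * (K ^ 2 * n ^ 2) / p := by
        gcongr ?_ * _ / _
        nlinarith
    _ = _ := by ring

/-- With w_i the inverse norms, the j-th coordinate of the score equation reads h_j ∑ w_iν_i = ∑
U_ij + ∑ (w_i − 1)U_ij. The weight on the left is at least n/3; on the right the first sum
concentrates, and |w_i − 1| ≤ 2ν_i‖h‖ controls the second. Compared with |h_j| ≤ ‖h‖ this gains a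
factor of order √(log p/p). -/
lemma abs_coord_median_le (hG : GoodSample D K R U ν) (hn : 0 < n) (hp : 0 < p) (hD : 1 ≤ D)
    (hK : 1 ≤ K) (hL : 1 ≤ Real.log p) (hU : ∀ i, ‖U i‖ = 1) (hν : ∀ i, 0 ≤ ν i)
    {h : EuclideanSpace ℝ (Fin p)} (hh : √n * ‖h‖ ≤ 65 * D)
    (hhalf : ∀ i, ν i * ‖h‖ ≤ 1 / 2)
    (hscore : ∑ i, ‖U i - ν i • h‖⁻¹ • (U i - ν i • h) = 0)
    {j : Fin p} (hj : ∑ i, U i j ^ 2 ≤ 17 * D * n / p) :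
    |h j| * n ≤ 8208 * K * D ^ 2 * √(n * Real.log p / p) := by
  have hp' : (0 : ℝ) < p := by exact_mod_cast hp
  have hn' : (0 : ℝ) < n := by exact_mod_cast hn
  set S := √(n * Real.log p / p) with hS
  set w := fun i => ‖U i - ν i • h‖⁻¹ with hw
  have hb := fun i => inv_norm_sub_smul_bounds (hU i) (hν i) (hhalf i)
  have e1 : h j * ∑ i, w i * ν i = ∑ i, U i j + ∑ i, (w i - 1) * U i j := by
    have h1 : (∑ i, w i • (U i - ν i • h)) j = 0 := by
      simp only [hw, hscore]; rfl
    rw [WithLp.ofLp_sum, Finset.sum_apply] at h1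
    simp only [PiLp.smul_apply, PiLp.sub_apply, smul_eq_mul] at h1
    rw [← Finset.sum_add_distrib, Finset.mul_sum, ← sub_eq_zero, ← Finset.sum_sub_distrib,
      ← neg_eq_zero, ← Finset.sum_neg_distrib, ← h1]
    refine Finset.sum_congr rfl fun i _ => by ring
  have e2 : n / 3 ≤ ∑ i, w i * ν i := by
    calc (n : ℝ) / 3 = 2 / 3 * (n / 2) := by ring
      _ ≤ 2 / 3 * ∑ i, ν i := by have := hG.ratio_sum; gcongr
      _ = ∑ i, 2 / 3 * ν i := Finset.mul_sum _ _ _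
      _ ≤ _ := Finset.sum_le_sum fun i _ => mul_le_mul_of_nonneg_right (hb i).1 (hν i)
  have e3 : |∑ i, (w i - 1) * U i j| ≤ 2730 * K * D ^ 2 * S := by
    have hq : 0 < √(p : ℝ) := Real.sqrt_pos.2 hp'
    have ha : 0 < √(n : ℝ) := Real.sqrt_pos.2 hn'
    have hS' : √n / √p ≤ S := by
      rw [← Real.sqrt_div hn'.le]
      apply Real.sqrt_le_sqrt
      gcongr
      exact le_mul_of_one_le_right hn'.le hL
    calc _ ≤ ∑ i, |(w i - 1) * U i j| := Finset.abs_sum_le_sum_abs _ _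
      _ ≤ ∑ i, 2 * ‖h‖ * (ν i * |U i j|) := Finset.sum_le_sum fun i _ => by
          rw [abs_mul]
          calc _ ≤ 2 * (ν i * ‖h‖) * |U i j| :=
                mul_le_mul_of_nonneg_right (hb i).2.2.1 (abs_nonneg _)
            _ = _ := by ring
      _ = 2 * ‖h‖ * ∑ i, ν i * |U i j| := (Finset.mul_sum _ _ _).symm
      _ ≤ 2 * ‖h‖ * (21 * K * D * n / √p) := by
          have := sum_ratio_mul_abs_coord_le hG hp hD hK hν hj
          gcongr
      _ = 42 * K * D * (√n * ‖h‖) * (√n / √p) := by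
          have : (n : ℝ) = √n * √n := (Real.mul_self_sqrt hn'.le).symm
          rw [show 21 * K * D * (n : ℝ) = 21 * K * D * (√n * √n) by rw [← this]]
          ring
      _ ≤ 42 * K * D * (65 * D) * S := by gcongr
      _ = _ := by ring
  have hS0 : 0 ≤ S := Real.sqrt_nonneg _
  have e4 : |h j| * (n / 3) ≤ 6 * D * S + 2730 * K * D ^ 2 * S := by
    calc |h j| * (n / 3) ≤ |h j| * ∑ i, w i * ν i := by gcongr
      _ = |h j * ∑ i, w i * ν i| := by
          rw [abs_mul, abs_of_nonneg (a := ∑ i, w i * ν i)]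
          exact le_trans (by positivity) e2
      _ ≤ |∑ i, U i j| + |∑ i, (w i - 1) * U i j| := by rw [e1]; exact abs_add_le _ _
      _ ≤ _ := add_le_add (hG.coord_sum j) e3
  have e5 : 6 * D * S ≤ 6 * K * D ^ 2 * S := by
    have : D ≤ K * D ^ 2 := by nlinarith [mul_le_mul hK hD (by norm_num) (by linarith)]
    nlinarith
  linarith

/-- Cauchy–Schwarz would need fourth moments of the coordinates, so ν_i is truncated at 14K√(log p):
below that level it factors out, and above it |U_ij U_ik| ≤ 1 leaves the tail sum, at most n/p. The
√(log p) lost here is within the final rate. -/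
lemma sum_ratio_mul_abs_mul_abs_le (hG : GoodSample D K R U ν) (hp : 0 < p) (hD : 1 ≤ D)
    (hK : 1 ≤ K) (hL : 1 ≤ Real.log p) (hU : ∀ i, ‖U i‖ = 1) (hν : ∀ i, 0 ≤ ν i) {j k : Fin p}
    (hj : ∑ i, U i j ^ 2 ≤ 17 * D * n / p) (hk : ∑ i, U i k ^ 2 ≤ 17 * D * n / p) :
    p * ∑ i, ν i * (|U i j| * |U i k|) ≤ 239 * K * D * √(Real.log p) * n := by
  have hp' : (0 : ℝ) < p := by exact_mod_cast hp
  have hn' : (0 : ℝ) ≤ n := Nat.cast_nonneg n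
  set l := √(Real.log p) with hl
  have hl1 : 1 ≤ l := Real.one_le_sqrt.2 hL
  have h1 : ∀ i, ν i * (|U i j| * |U i k|) ≤ 7 * K * l * (U i j ^ 2 + U i k ^ 2) +
      if 14 * K * l < ν i then ν i else 0 := by
    intro i
    have a1 : |U i j| ≤ 1 := (PiLp.norm_apply_le (U i) j).trans (hU i).le
    have a2 : |U i k| ≤ 1 := (PiLp.norm_apply_le (U i) k).trans (hU i).le
    have a3 : |U i j| * |U i k| ≤ 1 := mul_le_one₀ a1 (abs_nonneg _) a2
    have a4 : 0 ≤ |U i j| * |U i k| := by positivity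
    have a5 := two_mul_le_add_sq |U i j| |U i k|
    rw [sq_abs, sq_abs] at a5
    split_ifs with hc
    · have : 0 ≤ 7 * K * l * (U i j ^ 2 + U i k ^ 2) := by positivity
      nlinarith [hν i]
    · push Not at hc
      calc _ ≤ 14 * K * l * (|U i j| * |U i k|) := by gcongr
        _ = 7 * K * l * (2 * |U i j| * |U i k|) := by ring
        _ ≤ 7 * K * l * (U i j ^ 2 + U i k ^ 2) := by gcongr
        _ = _ := by ring
  have h2 : ∑ i, ν i * (|U i j| * |U i k|) ≤
      7 * K * l * (17 * D * n / p + 17 * D * n / p) + n / p := by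
    refine (Finset.sum_le_sum fun i _ => h1 i).trans ?_
    rw [Finset.sum_add_distrib, ← Finset.mul_sum, Finset.sum_add_distrib]
    have := hG.ratio_tail
    gcongr
  calc _ ≤ p * (7 * K * l * (17 * D * n / p + 17 * D * n / p) + n / p) := by gcongr
    _ = 238 * K * D * l * n + n := by field_simp; ring
    _ ≤ 238 * K * D * l * n + K * D * l * n := by
        gcongr
        exact le_mul_of_one_le_left hn'
          (one_le_mul_of_one_le_of_one_le (one_le_mul_of_one_le_of_one_le hK hD) hl1)
    _ = _ := by ring

/-- Expanding w_i²(U_ij − ν_i h_j)(U_ik − ν_i h_k) − U_ij U_ik leaves a normalisation term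
controlled by ‖h‖, two cross terms controlled by H = max|h_j| up to constants, and a quadratic term
controlled by H²∑ν_i². Multiplied by p each is O(√(n log p)); for the quadratic one, of order log p,
this uses log p ≤ n. That term also accounts for the power K⁴. -/
lemma abs_sum_recentred_sub_le (hG : GoodSample D K R U ν) (hn : 0 < n) (hp : 0 < p) (hD : 1 ≤ D)
    (hK : 1 ≤ K) (hL : 1 ≤ Real.log p) (hU : ∀ i, ‖U i‖ = 1) (hν : ∀ i, 0 ≤ ν i)
    (hLn : Real.log p ≤ n)
    {h : EuclideanSpace ℝ (Fin p)} (hh : √n * ‖h‖ ≤ 65 * D)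
    (hhalf : ∀ i, ν i * ‖h‖ ≤ 1 / 2)
    (hscore : ∑ i, ‖U i - ν i • h‖⁻¹ • (U i - ν i • h) = 0)
    (hc : ∀ j, ∑ i, U i j ^ 2 ≤ 17 * D * n / p) (j k : Fin p) :
    p * |∑ i, (‖U i - ν i • h‖⁻¹ • (U i - ν i • h)) j * (‖U i - ν i • h‖⁻¹ • (U i - ν i • h)) k -
      ∑ i, U i j * U i k| ≤ 7 * 10 ^ 9 * K ^ 4 * D ^ 4 * √(n * Real.log p) := by
  have hp' : (0 : ℝ) < p := by exact_mod_cast hp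
  have hn' : (0 : ℝ) < n := by exact_mod_cast hn
  set a := √(n : ℝ) with ha
  set l := √(Real.log p) with hl
  set q := √(p : ℝ) with hq
  have ha0 : 0 < a := Real.sqrt_pos.2 hn'
  have hq0 : 0 < q := Real.sqrt_pos.2 hp'
  have hl1 : 1 ≤ l := Real.one_le_sqrt.2 hL
  have hl0 : 0 < l := by linarith
  have ha2 : (n : ℝ) = a ^ 2 := (Real.sq_sqrt hn'.le).symm
  have hq2 : (p : ℝ) = q ^ 2 := (Real.sq_sqrt hp'.le).symm
  have hla : l ≤ a := Real.sqrt_le_sqrt hLn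
  have hS : √(n * Real.log p / p) = a * l / q := by
    rw [Real.sqrt_div (by positivity), Real.sqrt_mul hn'.le]
  have hW : √(n * Real.log p) = a * l := Real.sqrt_mul hn'.le _
  set w := fun i => ‖U i - ν i • h‖⁻¹ with hw
  have hb := fun i => inv_norm_sub_smul_bounds (hU i) (hν i) (hhalf i)
  set H := 8208 * K * D ^ 2 * l / (q * a) with hH
  have hH0 : 0 ≤ H := by positivity
  have hhj : ∀ j, |h j| ≤ H := by
    intro j
    have := abs_coord_median_le hG hn hp hD hK hL hU hν hh hhalf hscore (hc j)
    rw [hS, ← le_div_iff₀ hn'] at this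
    refine this.trans (le_of_eq ?_)
    rw [hH, ha2]
    field_simp
  have hterm : ∀ i, |(w i • (U i - ν i • h)) j * (w i • (U i - ν i • h)) k - U i j * U i k| ≤
      6 * ‖h‖ * (ν i * (|U i j| * |U i k|)) + 4 * H * (ν i * |U i j|) + 4 * H * (ν i * |U i k|) +
        4 * H ^ 2 * ν i ^ 2 := by
    intro i
    simp only [PiLp.smul_apply, PiLp.sub_apply, smul_eq_mul]
    have e : w i * (U i j - ν i * h j) * (w i * (U i k - ν i * h k)) - U i j * U i k =
        (w i ^ 2 - 1) * (U i j * U i k) - w i ^ 2 * (ν i * (h k * U i j))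
          - w i ^ 2 * (ν i * (h j * U i k)) + w i ^ 2 * (ν i ^ 2 * (h j * h k)) := by ring
    rw [e]
    have hw2 : |w i ^ 2| ≤ 4 := by
      rw [abs_of_nonneg (sq_nonneg _)]
      nlinarith [(hb i).1, (hb i).2.1]
    have hνi := hν i
    have t1 : |(w i ^ 2 - 1) * (U i j * U i k)| ≤ 6 * ‖h‖ * (ν i * (|U i j| * |U i k|)) := by
      rw [abs_mul, abs_mul]
      calc _ ≤ 6 * (ν i * ‖h‖) * (|U i j| * |U i k|) :=
            mul_le_mul_of_nonneg_right (hb i).2.2.2 (by positivity)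
        _ = _ := by ring
    have t2 : ∀ j k, |w i ^ 2 * (ν i * (h k * U i j))| ≤ 4 * H * (ν i * |U i j|) := by
      intro j k
      rw [abs_mul, abs_mul, abs_mul, abs_of_nonneg hνi]
      calc _ ≤ 4 * (ν i * (H * |U i j|)) := by
            have := hhj k
            gcongr
        _ = _ := by ring
    have t3 : |w i ^ 2 * (ν i ^ 2 * (h j * h k))| ≤ 4 * H ^ 2 * ν i ^ 2 := by
      rw [abs_mul, abs_mul, abs_mul, abs_of_nonneg (sq_nonneg (ν i))]
      calc _ ≤ 4 * (ν i ^ 2 * (H * H)) := by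
            have h1 := hhj j
            have h2 := hhj k
            gcongr
        _ = _ := by ring
    have t2j := t2 j k
    have t2k := t2 k j
    rw [abs_le] at *
    constructor <;> linarith [t1.1, t1.2, t2j.1, t2j.2, t2k.1, t2k.2, t3.1, t3.2]
  have hsum : |∑ i, (w i • (U i - ν i • h)) j * (w i • (U i - ν i • h)) k - ∑ i, U i j * U i k| ≤
      6 * ‖h‖ * (∑ i, ν i * (|U i j| * |U i k|)) + 4 * H * (∑ i, ν i * |U i j|) +
        4 * H * (∑ i, ν i * |U i k|) + 4 * H ^ 2 * ∑ i, ν i ^ 2 := by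
    rw [← Finset.sum_sub_distrib]
    refine (Finset.abs_sum_le_sum_abs _ _).trans ((Finset.sum_le_sum fun i _ => hterm i).trans ?_)
    simp only [Finset.sum_add_distrib, ← Finset.mul_sum]
    exact le_rfl
  have s1 : p * (6 * ‖h‖ * (∑ i, ν i * (|U i j| * |U i k|))) ≤ 93210 * K * D ^ 2 * (a * l) := by
    have := sum_ratio_mul_abs_mul_abs_le hG hp hD hK hL hU hν (hc j) (hc k)
    calc _ = 6 * ‖h‖ * (p * ∑ i, ν i * (|U i j| * |U i k|)) := by ring
      _ ≤ 6 * ‖h‖ * (239 * K * D * l * n) := by gcongr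
      _ = 1434 * K * D * l * a * (a * ‖h‖) := by rw [ha2]; ring
      _ ≤ 1434 * K * D * l * a * (65 * D) := by gcongr
      _ = _ := by ring
  have s2 : ∀ j, p * (4 * H * (∑ i, ν i * |U i j|)) ≤ 689472 * K ^ 2 * D ^ 3 * (a * l) := by
    intro j
    have := sum_ratio_mul_abs_coord_le hG hp hD hK hν (hc j)
    calc _ ≤ p * (4 * H * (21 * K * D * n / q)) := by gcongr
      _ = _ := by
          rw [hH, ha2, hq2]
          field_simp
          ring
  have s3 : p * (4 * H ^ 2 * ∑ i, ν i ^ 2) ≤ 6467641344 * K ^ 4 * D ^ 4 * (a * l) := by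
    have := hG.ratio_sq
    calc _ ≤ p * (4 * H ^ 2 * (24 * K ^ 2 * n)) := by gcongr
      _ = 6467641344 * K ^ 4 * D ^ 4 * (l * l) := by
          rw [hH, ha2, hq2]
          field_simp
          ring
      _ ≤ _ := by gcongr
  have hal : 0 ≤ a * l := by positivity
  have k1 : 93210 * K * D ^ 2 * (a * l) ≤ 93210 * K ^ 4 * D ^ 4 * (a * l) := by
    have h1 : K ≤ K ^ 4 := le_self_pow₀ hK (by norm_num)
    have h2 : D ^ 2 ≤ D ^ 4 := pow_le_pow_right₀ hD (by norm_num)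
    gcongr
  have k2 : 689472 * K ^ 2 * D ^ 3 * (a * l) ≤ 689472 * K ^ 4 * D ^ 4 * (a * l) := by
    have h1 : K ^ 2 ≤ K ^ 4 := pow_le_pow_right₀ hK (by norm_num)
    have h2 : D ^ 3 ≤ D ^ 4 := pow_le_pow_right₀ hD (by norm_num)
    gcongr
  have hfin := mul_le_mul_of_nonneg_left hsum hp'.le
  rw [mul_add, mul_add, mul_add] at hfin
  rw [hW]
  have s2j := s2 j
  have s2k := s2 k
  have hKD : 0 ≤ K ^ 4 * D ^ 4 * (a * l) := by positivity
  refine hfin.trans ?_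
  linarith

/-- On a good sample, `p` times the sample spatial-sign covariance centred at any spatial median is
uniformly close to its population version. -/
theorem abs_sampleSpatialSignCov_sub_le (hn : 0 < n) (hp : 0 < p) (hD : 1 ≤ D) (hK : 1 ≤ K)
    (hL : 1 ≤ Real.log p) (m : EuclideanSpace ℝ (Fin p))
    {x : Fin n → EuclideanSpace ℝ (Fin p)} (hx : ∀ i, x i ≠ m) {z : ℝ} (hz : 0 < z)
    (hG : GoodSample D K R (fun i => spatialSign (x i - m)) (fun i => z⁻¹ * ‖x i - m‖⁻¹))
    (hR : ∀ e : EuclideanSpace ℝ (Fin p), ∑ j, ∑ k, e j * e k * R j k ≤ 16 * D * ‖e‖ ^ 2)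
    (hsmall : 10 ^ 9 * K ^ 2 * D ^ 2 * √(n * Real.log p) ≤ n)
    (hpl : 10 ^ 7 * K ^ 2 * D ≤ p)
    {mhat : EuclideanSpace ℝ (Fin p)} (hm : IsSpatialMedian x mhat) (j k : Fin p) :
    |p * sampleSpatialSignCov x mhat j k - R j k| ≤
      10 ^ 10 * K ^ 4 * D ^ 4 * √(Real.log p / n) := by
  have hp' : (0 : ℝ) < p := by exact_mod_cast hp
  have hn' : (0 : ℝ) < n := by exact_mod_cast hn
  have ha0 : 0 < √(n : ℝ) := Real.sqrt_pos.2 hn'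
  set y := fun i => x i - m with hy
  have hy0 : ∀ i, y i ≠ 0 := fun i => sub_ne_zero.2 (hx i)
  set θ := mhat - m with hθdef
  have hyθ : ∀ i, x i - mhat = y i - θ := fun i => by simp [hy, hθdef]
  have hθ : IsSpatialMedian y θ := by
    intro v
    have := hm (v + m)
    simpa only [hyθ, hy, sub_sub, add_comm m] using this
  set U := fun i => spatialSign (y i) with hU
  set ν := fun i => z⁻¹ * ‖y i‖⁻¹ with hν
  -- In the application z = ζ₁; the factors cancel in ν_i h = θ/‖y_i‖, the displacement relative to
  -- the radius of the i-th point.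
  set h := z • θ with hh
  have hU1 : ∀ i, ‖U i‖ = 1 := fun i => norm_spatialSign (hy0 i)
  have hν0 : ∀ i, 0 ≤ ν i := fun i => by simp only [hν]; positivity
  have hloc : √n * ‖h‖ ≤ 65 * D := GoodSample.norm_median_le hn hp hD hK hy0 hz hG hR hsmall hpl hθ
  have hhalf : ∀ i, ν i * ‖h‖ ≤ 1 / 2 := by
    intro i
    have h1 := hG.ratio_le i
    change ν i * (130 * D) ≤ √n at h1
    have h2 : ν i * (√n * ‖h‖) ≤ ν i * (65 * D) := mul_le_mul_of_nonneg_left hloc (hν0 i)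
    have h3 : √n * (ν i * ‖h‖) ≤ √n * (1 / 2) := by linarith
    exact le_of_mul_le_mul_left h3 ha0
  have hform : ∀ i, y i - θ = ‖y i‖ • (U i - ν i • h) := fun i => sub_eq_norm_smul (hy0 i) hz θ
  -- The median is not a data point, so the first-order condition is an equation. A zero vector
  -- would have inverse norm 0⁻¹ = 0, contradicting the lower bound 2/3.
  have hN : ∀ i, U i - ν i • h ≠ 0 := by
    intro i h0
    have := (inv_norm_sub_smul_bounds (hU1 i) (hν0 i) (hhalf i)).1
    rw [h0, norm_zero, inv_zero] at this
    norm_num at this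
  have hsign : ∀ i, spatialSign (x i - mhat) = ‖U i - ν i • h‖⁻¹ • (U i - ν i • h) := by
    intro i
    rw [hyθ, hform, spatialSign_smul_of_pos (norm_pos_iff.2 (hy0 i))]
    rfl
  have hscore : ∑ i, ‖U i - ν i • h‖⁻¹ • (U i - ν i • h) = 0 := by
    simp only [← hsign]
    refine sum_spatialSign_eq_zero hm fun i => ?_
    rw [hyθ, hform]
    exact smul_ne_zero (norm_ne_zero_iff.2 (hy0 i)) (hN i)
  have hW : √(n * Real.log p) = n * √(Real.log p / n) := by
    rw [Real.sqrt_mul hn'.le, Real.sqrt_div (by linarith)]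
    have : (n : ℝ) = √n * √n := (Real.mul_self_sqrt hn'.le).symm
    rw [eq_comm, mul_div_assoc', div_eq_iff ha0.ne']
    rw [mul_right_comm, ← this]
  have hLn : Real.log p ≤ n := by
    have h0 : 0 ≤ √(n * Real.log p) := Real.sqrt_nonneg _
    have h1 : √(n * Real.log p) ≤ n := by
      have hKD : 1 ≤ K ^ 2 * D ^ 2 :=
        one_le_mul_of_one_le_of_one_le (one_le_pow₀ hK) (one_le_pow₀ hD)
      nlinarith
    rw [Real.sqrt_le_left hn'.le, sq] at h1
    exact le_of_mul_le_mul_left h1 hn'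
  have key := abs_sum_recentred_sub_le hG hn hp hD hK hL hU1 hν0 hLn hloc hhalf hscore
    (fun j => hG.sum_coord_sq_le hp hD hK hR hsmall j) j k
  simp only [← hsign] at key
  have hcov := hG.cov j k
  rw [← abs_of_pos hp', ← abs_mul, abs_of_pos hp'] at key
  have hS : (p : ℝ) * sampleSpatialSignCov x mhat j k - R j k = (1 / n) *
      (p * (∑ i, spatialSign (x i - mhat) j * spatialSign (x i - mhat) k - ∑ i, U i j * U i k) +
        (p * ∑ i, U i j * U i k - n * R j k)) := by
    simp only [sampleSpatialSignCov, Matrix.of_apply]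
    field_simp
    ring
  rw [hS, abs_mul, abs_of_pos (by positivity), one_div, inv_mul_le_iff₀ hn']
  refine (abs_add_le _ _).trans ((add_le_add key hcov).trans ?_)
  rw [hW]
  set r := n * √(Real.log p / n) with hr
  have hr0 : 0 ≤ r := by positivity
  have h1 : D ^ 2 ≤ K ^ 4 * D ^ 4 := by
    calc D ^ 2 ≤ D ^ 4 := pow_le_pow_right₀ hD (by norm_num)
      _ ≤ K ^ 4 * D ^ 4 := le_mul_of_one_le_left (by positivity) (one_le_pow₀ hK)
  have h2 : 1030 * D ^ 2 * r ≤ 1030 * (K ^ 4 * D ^ 4) * r := by gcongr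
  have h3 : 0 ≤ K ^ 4 * D ^ 4 * r := by positivity
  have h4 : n * (10 ^ 10 * K ^ 4 * D ^ 4 * √(Real.log p / n)) = 10 ^ 10 * (K ^ 4 * D ^ 4 * r) := by
    rw [hr]; ring
  rw [h4]
  linarith

end Perturbation

/-! ### The ℓ₁ program and thresholding -/

section Clime

variable {p : ℕ}

lemma abs_mul_apply_le_of_colSum {A B : Matrix (Fin p) (Fin p) ℝ} {T ε : ℝ} (hε : 0 ≤ ε)
    (hA : ∀ i j, |A i j| ≤ ε) (hB : ∀ j, ∑ i, |B i j| ≤ T) (i j : Fin p) :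
    |(A * B) i j| ≤ T * ε := by
  rw [Matrix.mul_apply]
  calc _ ≤ ∑ k, |A i k * B k j| := Finset.abs_sum_le_sum_abs _ _
    _ ≤ ∑ k, ε * |B k j| := Finset.sum_le_sum fun k _ => by
        rw [abs_mul]; exact mul_le_mul_of_nonneg_right (hA i k) (abs_nonneg _)
    _ = ε * ∑ k, |B k j| := (Finset.mul_sum _ _ _).symm
    _ ≤ ε * T := mul_le_mul_of_nonneg_left (hB j) hε
    _ = _ := mul_comm _ _

lemma abs_mul_apply_le_of_rowSum {A B : Matrix (Fin p) (Fin p) ℝ} {T ε : ℝ} (hε : 0 ≤ ε)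
    (hA : ∀ i, ∑ j, |A i j| ≤ T) (hB : ∀ i j, |B i j| ≤ ε) (i j : Fin p) :
    |(A * B) i j| ≤ T * ε := by
  rw [Matrix.mul_apply]
  calc _ ≤ ∑ k, |A i k * B k j| := Finset.abs_sum_le_sum_abs _ _
    _ ≤ ∑ k, |A i k| * ε := Finset.sum_le_sum fun k _ => by
        rw [abs_mul]; exact mul_le_mul_of_nonneg_left (hB k j) (abs_nonneg _)
    _ = (∑ k, |A i k|) * ε := (Finset.sum_mul _ _ _).symm
    _ ≤ T * ε := mul_le_mul_of_nonneg_right (hA i) hε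

lemma isFeasible_of_close {S Lam V : Matrix (Fin p) (Fin p) ℝ} {T δ : ℝ} (hδ : 0 ≤ δ)
    (hS : ∀ i j, |(p : ℝ) * S i j - Lam i j| ≤ δ) (hV : ∀ j, ∑ i, |V i j| ≤ T)
    (hLV : Lam * V = 1) : IsFeasible S (T * δ) V := by
  intro i j
  rw [← hLV, ← sub_mul]
  exact abs_mul_apply_le_of_colSum hδ (fun i j => by simpa using hS i j) hV i j

/-- The feasible set may be unbounded; its part where the ℓ₁ norm is at most that of a given
feasible matrix is compact. -/
lemma exists_isSclimeSolution {S V : Matrix (Fin p) (Fin p) ℝ} {lam : ℝ}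
    (hV : IsFeasible S lam V) : ∃ V₁, IsSclimeSolution S lam V₁ := by
  have hcont : Continuous (elementwiseL1 : Matrix (Fin p) (Fin p) ℝ → ℝ) := by
    unfold elementwiseL1
    fun_prop
  set B := {W : Matrix (Fin p) (Fin p) ℝ | IsFeasible S lam W ∧ elementwiseL1 W ≤ elementwiseL1 V}
    with hB
  have hclosed : IsClosed B := by
    have h1 : IsClosed {W : Matrix (Fin p) (Fin p) ℝ | IsFeasible S lam W} := by
      have : {W : Matrix (Fin p) (Fin p) ℝ | IsFeasible S lam W} =
          ⋂ i, ⋂ j, {W | |(((p : ℝ) • S) * W - 1) i j| ≤ lam} := by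
        ext W; simp [IsFeasible]
      rw [this]
      refine isClosed_iInter fun i => isClosed_iInter fun j => ?_
      refine isClosed_le ?_ continuous_const
      have : Continuous fun W : Matrix (Fin p) (Fin p) ℝ => ((p : ℝ) • S) * W - 1 := by fun_prop
      exact (this.matrix_elem i j).abs
    exact h1.inter (isClosed_le hcont continuous_const)
  have hsub : B ⊆ Set.univ.pi fun _ : Fin p => Set.univ.pi fun _ : Fin p =>
      Set.Icc (-elementwiseL1 V) (elementwiseL1 V) := by
    rintro W ⟨-, hW⟩ i - j -
    rw [Set.mem_Icc, ← abs_le]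
    refine le_trans ?_ hW
    calc |W i j| ≤ ∑ j, |W i j| :=
          Finset.single_le_sum (f := fun j => |W i j|) (fun _ _ => abs_nonneg _) (Finset.mem_univ j)
      _ ≤ _ := Finset.single_le_sum (f := fun i => ∑ j, |W i j|)
          (fun _ _ => Finset.sum_nonneg fun _ _ => abs_nonneg _) (Finset.mem_univ i)
  have hcomp : IsCompact B :=
    (isCompact_univ_pi fun _ => isCompact_univ_pi fun _ => isCompact_Icc).of_isClosed_subset
      hclosed hsub
  obtain ⟨V₁, hV₁, hmin⟩ := hcomp.exists_isMinOn ⟨V, hV, le_rfl⟩ hcont.continuousOn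
  refine ⟨V₁, hV₁.1, fun W hW => ?_⟩
  rcases le_total (elementwiseL1 W) (elementwiseL1 V) with h | h
  · exact hmin ⟨hW, h⟩
  · exact hV₁.2.trans h

lemma exists_isSymmetrization (V₁ : Matrix (Fin p) (Fin p) ℝ) : ∃ V, IsSymmetrization V₁ V := by
  -- Ties are broken by `max` because the rule must be symmetric in its arguments for the resulting
  -- matrix to be symmetric.
  set f : ℝ → ℝ → ℝ := fun a b => if |a| < |b| then a else if |b| < |a| then b else max a b with hf
  refine ⟨Matrix.of fun i j => f (V₁ i j) (V₁ j i), fun i j => ?_⟩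
  simp only [Matrix.of_apply]
  generalize V₁ i j = a
  generalize V₁ j i = b
  simp only [hf]
  rcases lt_trichotomy |a| |b| with h | h | h
  · simp [h, h.le, h.not_gt]
  · have h1 : ¬ |a| < |b| := by rw [h]; exact lt_irrefl _
    have h2 : ¬ |b| < |a| := by rw [h]; exact lt_irrefl _
    simp only [h1, h2, if_false]
    refine ⟨max_comm _ _, max_choice a b, ?_⟩
    rcases max_choice a b with hm | hm <;> rw [hm] <;> simp [h]
  · simp [h, h.le, h.not_gt]

/-- The columns of a solution have smaller `ℓ₁` norm than those of any feasible matrix, since the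
minimization decouples over columns. -/
lemma IsSclimeSolution.colSum_le {S V V₁ : Matrix (Fin p) (Fin p) ℝ} {lam : ℝ}
    (h : IsSclimeSolution S lam V₁) (hV : IsFeasible S lam V) (k : Fin p) :
    ∑ i, |V₁ i k| ≤ ∑ i, |V i k| := by
  set W : Matrix (Fin p) (Fin p) ℝ := Matrix.of fun i j => if j = k then V i j else V₁ i j with hW
  have hWf : IsFeasible S lam W := by
    intro i j
    by_cases hj : j = k
    · have : (((p : ℝ) • S) * W - 1) i j = (((p : ℝ) • S) * V - 1) i j := by
        simp [Matrix.mul_apply, hW, hj]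
      rw [this]; exact hV i j
    · have : (((p : ℝ) • S) * W - 1) i j = (((p : ℝ) • S) * V₁ - 1) i j := by
        simp [Matrix.mul_apply, hW, hj]
      rw [this]; exact h.1 i j
  have h1 := h.2 W hWf
  unfold elementwiseL1 at h1
  rw [Finset.sum_comm, Finset.sum_comm (f := fun i j => |W i j|),
    ← Finset.add_sum_erase _ _ (Finset.mem_univ k),
    ← Finset.add_sum_erase _ (fun j => ∑ i, |W i j|) (Finset.mem_univ k)] at h1
  have h2 : ∑ j ∈ Finset.univ.erase k, ∑ i, |W i j| = ∑ j ∈ Finset.univ.erase k, ∑ i, |V₁ i j| := by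
    refine Finset.sum_congr rfl fun j hj => Finset.sum_congr rfl fun i _ => ?_
    simp [hW, (Finset.mem_erase.1 hj).1]
  have h3 : ∑ i, |W i k| = ∑ i, |V i k| := by simp [hW]
  rw [h2, h3] at h1
  linarith

/-- In V₁ − V = V((Lam − pS)V₁ + (pSV₁ − 1)) both summands are entrywise at most Tδ, the first by
the column bound on V₁ and the second by feasibility. Symmetry turns the column bound on V into the
row bound that left multiplication requires. -/
lemma IsSclimeSolution.abs_sub_le {S Lam V V₁ : Matrix (Fin p) (Fin p) ℝ} {T δ : ℝ} (hT : 0 ≤ T)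
    (hδ : 0 ≤ δ)
    (hS : ∀ i j, |(p : ℝ) * S i j - Lam i j| ≤ δ) (hV : ∀ j, ∑ i, |V i j| ≤ T)
    (hsymm : ∀ i j, V i j = V j i) (hLV : Lam * V = 1) (hVL : V * Lam = 1)
    (h : IsSclimeSolution S (T * δ) V₁) (i j : Fin p) :
    |V₁ i j - V i j| ≤ 2 * T * (T * δ) := by
  have hcol := fun k => (h.colSum_le (isFeasible_of_close hδ hS hV hLV) k).trans (hV k)
  have hrow : ∀ i, ∑ j, |V i j| ≤ T := fun i => by simpa only [hsymm i] using hV i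
  have e : V₁ - V = V * ((Lam - (p : ℝ) • S) * V₁ + (((p : ℝ) • S) * V₁ - 1)) := by
    rw [sub_mul, sub_add_sub_cancel, mul_sub, mul_one, ← mul_assoc, hVL, one_mul]
  rw [← Matrix.sub_apply, e]
  refine (abs_mul_apply_le_of_rowSum (by positivity : 0 ≤ T * δ + T * δ) hrow
    (fun k l => ?_) i j).trans (le_of_eq (by ring))
  rw [Matrix.add_apply]
  refine (abs_add_le _ _).trans (add_le_add ?_ (h.1 k l))
  refine abs_mul_apply_le_of_colSum hδ (fun i j => ?_) hcol k l
  have := hS i j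
  rw [abs_sub_comm] at this
  simpa using this

lemma signPattern_hardThreshold_eq {V V₀ : Matrix (Fin p) (Fin p) ℝ} {e τ : ℝ}
    (he : ∀ i j, |V i j - V₀ i j| ≤ e) (hτ : e < τ) (hθ : 2 * τ < thetaMin V₀) :
    signPattern (hardThreshold τ V) = signPattern V₀ := by
  funext i j
  have he0 : 0 ≤ e := (abs_nonneg _).trans (he i j)
  have hij := abs_le.1 (he i j)
  simp only [signPattern, hardThreshold, Matrix.of_apply]
  by_cases h0 : V₀ i j = 0
  · rw [h0, sub_zero] at hij
    have : ¬ τ ≤ |V i j| := by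
      rw [not_le]
      exact (abs_le.2 hij).trans_lt hτ
    simp [this, h0]
  · have hmin : thetaMin V₀ ≤ |V₀ i j| := by
      refine csInf_le ⟨0, ?_⟩ ⟨i, j, h0, rfl⟩
      rintro t ⟨i, j, -, rfl⟩
      exact abs_nonneg _
    rcases lt_or_gt_of_ne h0 with hneg | hpos
    · rw [abs_of_neg hneg] at hmin
      have hV : V i j < 0 := by linarith
      have : τ ≤ |V i j| := by rw [abs_of_neg hV]; linarith
      rw [if_pos this, sign_neg hV, sign_neg hneg]
    · rw [abs_of_pos hpos] at hmin
      have hV : 0 < V i j := by linarith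
      have : τ ≤ |V i j| := by rw [abs_of_pos hV]; linarith
      rw [if_pos this, sign_pos hV, sign_pos hpos]

/-- Sign consistency of the thresholded SCLIME estimator, given uniform closeness of the scaled
sample covariance to the inverse of the target. -/
theorem sclime_sign_consistent {n : ℕ} {x : Fin n → EuclideanSpace ℝ (Fin p)}
    {mhat : EuclideanSpace ℝ (Fin p)} {Lam V₀ : Matrix (Fin p) (Fin p) ℝ} {T δ τ : ℝ}
    (hT : 0 ≤ T) (hδ : 0 ≤ δ)
    (hS : ∀ i j, |(p : ℝ) * sampleSpatialSignCov x mhat i j - Lam i j| ≤ δ)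
    (hV : ∀ j, ∑ i, |V₀ i j| ≤ T) (hsymm : ∀ i j, V₀ i j = V₀ j i) (hLV : Lam * V₀ = 1)
    (hVL : V₀ * Lam = 1) (hτ : 4 * T * (T * δ) < τ) (hθ : 2 * τ < thetaMin V₀) :
    (∃ V, IsSclimeEstimator x mhat (T * δ) V) ∧
      ∀ V, IsSclimeEstimator x mhat (T * δ) V →
        signPattern (hardThreshold τ V) = signPattern V₀ := by
  constructor
  · obtain ⟨V₁, h₁⟩ := exists_isSclimeSolution (isFeasible_of_close hδ hS hV hLV)
    obtain ⟨V, h⟩ := exists_isSymmetrization V₁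
    exact ⟨V, V₁, h₁, h⟩
  · rintro V ⟨V₁, h₁, h⟩
    have herr := h₁.abs_sub_le hT hδ hS hV hsymm hLV hVL
    refine signPattern_hardThreshold_eq (e := 2 * T * (T * δ)) (fun i j => ?_) ?_ hθ
    -- Whichever of the two entries symmetrization picks, it estimates the same number, as V₀ is
    -- symmetric.
    · rcases (h i j).2.1 with h' | h' <;> rw [h']
      · exact herr i j
      · rw [hsymm i j]; exact herr j i
    · have : 0 ≤ T * (T * δ) := by positivity
      linarith

end Clime

/-! ### The precision matrix -/

section Precision

variable {p : ℕ} {Sig : Matrix (Fin p) (Fin p) ℝ}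

lemma trace_pos_of_posDef (hS : Sig.PosDef) (hp : 0 < p) : 0 < Sig.trace := by
  have : Nonempty (Fin p) := ⟨⟨0, hp⟩⟩
  exact hS.trace_pos

lemma isUnit_det_shapeMatrix (hS : Sig.PosDef) (hp : 0 < p) : IsUnit (shapeMatrix Sig).det := by
  have hp' : (0 : ℝ) < p := by exact_mod_cast hp
  have := trace_pos_of_posDef hS hp
  rw [shapeMatrix, Matrix.det_smul, isUnit_iff_ne_zero]
  have := hS.det_pos
  positivity

lemma precisionMatrix_symm (hS : Sig.PosDef) (i j : Fin p) :
    precisionMatrix Sig i j = precisionMatrix Sig j i := by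
  have h : (shapeMatrix Sig).transpose = shapeMatrix Sig := by
    have := hS.isHermitian.eq
    rw [Matrix.conjTranspose_eq_transpose_of_trivial] at this
    rw [shapeMatrix, Matrix.transpose_smul, this]
  have h2 : (precisionMatrix Sig).transpose = precisionMatrix Sig := by
    rw [precisionMatrix, Matrix.transpose_nonsing_inv, h]
  conv_rhs => rw [← h2]
  rfl

/-- An invertible matrix has a nonzero entry, and every entry is bounded by its column sum. This
turns the signal condition into an upper bound on the tuning parameter. -/
lemma thetaMin_precisionMatrix_le (hS : Sig.PosDef) (hp : 0 < p) {T : ℝ}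
    (hT : ∀ j, ∑ i, |precisionMatrix Sig i j| ≤ T) : thetaMin (precisionMatrix Sig) ≤ T := by
  have hne : precisionMatrix Sig ≠ 0 := by
    intro h0
    have h1 := Matrix.mul_nonsing_inv _ (isUnit_det_shapeMatrix hS hp)
    rw [← precisionMatrix, h0, mul_zero] at h1
    have := congrFun (congrFun h1 ⟨0, hp⟩) ⟨0, hp⟩
    simp at this
  obtain ⟨i, j, hij⟩ : ∃ i j, precisionMatrix Sig i j ≠ 0 := by
    by_contra hc
    push Not at hc
    exact hne (by ext i j; exact hc i j)
  calc _ ≤ |precisionMatrix Sig i j| := by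
        refine csInf_le ⟨0, ?_⟩ ⟨i, j, hij, rfl⟩
        rintro t ⟨i, j, -, rfl⟩
        exact abs_nonneg _
    _ ≤ ∑ i, |precisionMatrix Sig i j| :=
        Finset.single_le_sum (f := fun i => |precisionMatrix Sig i j|) (fun _ _ => abs_nonneg _)
          (Finset.mem_univ i)
    _ ≤ T := hT j

end Precision

/-! ### Consequences of the radial conditions -/

section RadialConditions

variable {p : ℕ} {L : Measure (EuclideanSpace ℝ (Fin p))}
  {m : EuclideanSpace ℝ (Fin p)} {ζ ψ K : ℝ}

lemma RadialConditions.invMoment_one_pos [IsProbabilityMeasure L] (h : RadialConditions L m ζ ψ K) :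
    0 < invMoment L m 1 := by
  have hi := h.integrable 1 (by simp)
  unfold invMoment
  rw [integral_pos_iff_support_of_nonneg (fun x => by positivity) hi]
  have : ∀ᵐ x ∂L, x ∈ Function.support fun x => ‖x - m‖⁻¹ ^ 1 := by
    filter_upwards [h.ae_ne] with x hx
    simpa [sub_eq_zero] using hx
  have h1 : L (Function.support fun x => ‖x - m‖⁻¹ ^ 1) = 1 := by
    exact (measure_congr (Filter.eventuallyEq_univ.2 this)).trans measure_univ
  rw [h1]
  exact one_pos

lemma RadialConditions.eLpNorm_le (h : RadialConditions L m ζ ψ K) {k : ℕ} (hk : 1 ≤ k) :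
    eLpNorm (fun x => (invMoment L m 1)⁻¹ * ‖x - m‖⁻¹) (k : ℝ≥0∞) L ≤
      ENNReal.ofReal (K * √k) := by
  have hk' : (0 : ℝ) < k := by exact_mod_cast hk
  have h1 := (le_iSup₂ (f := fun (k : ℕ) (_ : 1 ≤ k) => ENNReal.ofReal ((k : ℝ) ^ (-(1 / 2) : ℝ)) *
    eLpNorm (fun x => (invMoment L m 1)⁻¹ * ‖x - m‖⁻¹) (k : ℝ≥0∞) L) k hk).trans h.subGaussian
  have h2 : ENNReal.ofReal √k * ENNReal.ofReal ((k : ℝ) ^ (-(1 / 2) : ℝ)) = 1 := by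
    rw [← ENNReal.ofReal_mul (by positivity), Real.sqrt_eq_rpow, ← Real.rpow_add hk']
    simp
  calc _ = ENNReal.ofReal √k * (ENNReal.ofReal ((k : ℝ) ^ (-(1 / 2) : ℝ)) *
        eLpNorm (fun x => (invMoment L m 1)⁻¹ * ‖x - m‖⁻¹) (k : ℝ≥0∞) L) := by
        rw [← mul_assoc, h2, one_mul]
    _ ≤ ENNReal.ofReal √k * ENNReal.ofReal K := by gcongr
    _ = _ := by rw [← ENNReal.ofReal_mul (by positivity), mul_comm]

lemma RadialConditions.subGaussianRatio [IsProbabilityMeasure L] (h : RadialConditions L m ζ ψ K) (hK : 0 < K) :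
    SubGaussianRatio L (fun x => (invMoment L m 1)⁻¹ * ‖x - m‖⁻¹) K where
  measurable := by fun_prop
  nonneg x := mul_nonneg (inv_nonneg.2 h.invMoment_one_pos.le) (by positivity)
  integrable := by
    have := (h.integrable 1 (by simp)).const_mul (invMoment L m 1)⁻¹
    simpa only [pow_one] using this
  mean := by
    rw [integral_const_mul]
    have : ∫ x, ‖x - m‖⁻¹ ∂L = invMoment L m 1 := by simp [invMoment]
    rw [this, inv_mul_cancel₀ h.invMoment_one_pos.ne']
  moments k hk := by
    set ν := fun x => (invMoment L m 1)⁻¹ * ‖x - m‖⁻¹ with hν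
    have hν0 : ∀ x, 0 ≤ ν x := fun x => mul_nonneg (inv_nonneg.2 h.invMoment_one_pos.le) (by positivity)
    -- The ψ₂ bound at exponent 2k gives (K√(2k))^{2k} = (2K²k)^k.
    have h1 := h.eLpNorm_le (k := 2 * k) (by omega)
    have h2 := eLpNorm_eq_lintegral_rpow_enorm_toReal (μ := L) (f := ν) (p := ((2 * k : ℕ) : ℝ≥0∞))
      (by simp; omega) (ENNReal.natCast_ne_top _)
    rw [h2] at h1
    have h3 : (0 : ℝ) < (((2 * k : ℕ) : ℝ≥0∞)).toReal := by
      rw [ENNReal.toReal_natCast]; exact_mod_cast (by omega : 0 < 2 * k)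
    have h4 := ENNReal.rpow_le_rpow h1 h3.le
    rw [← ENNReal.rpow_mul, one_div_mul_cancel h3.ne', ENNReal.rpow_one] at h4
    rw [ENNReal.toReal_natCast] at h4
    simp only [ENNReal.rpow_natCast] at h4
    have h5 : ∀ x, ENNReal.ofReal (ν x ^ (2 * k)) = ‖ν x‖ₑ ^ (2 * k) := fun x => by
      rw [ENNReal.ofReal_pow (hν0 x), Real.enorm_of_nonneg (hν0 x)]
    change ∫⁻ x, ENNReal.ofReal (ν x ^ (2 * k)) ∂L ≤ _
    rw [lintegral_congr h5]
    refine h4.trans (le_of_eq ?_)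
    rw [← ENNReal.ofReal_pow (by positivity), pow_mul, mul_pow, Real.sq_sqrt (by positivity)]
    congr 2
    push_cast
    ring

/-- The first term of the supremum defining the ψ₂ norm is E ν = 1. -/
lemma RadialConditions.one_le [IsProbabilityMeasure L] (h : RadialConditions L m ζ ψ K) (hK : 0 < K) : 1 ≤ K := by
  have hν := h.subGaussianRatio hK
  have h1 := h.eLpNorm_le (k := 1) le_rfl
  rw [Nat.cast_one, eLpNorm_one_eq_lintegral_enorm,
    ← ofReal_integral_norm_eq_lintegral_enorm hν.integrable] at h1
  have h2 := (ENNReal.ofReal_le_ofReal_iff (by positivity)).1 h1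
  have h3 : ∫ x, ‖(invMoment L m 1)⁻¹ * ‖x - m‖⁻¹‖ ∂L = 1 := by
    rw [← hν.mean]
    exact integral_congr_ae (Filter.Eventually.of_forall fun x => Real.norm_of_nonneg (hν.nonneg x))
  rw [h3] at h2
  simpa using h2

end RadialConditions

/-! ### Transfer to the sample space and the size thresholds -/

section Assembly

variable {p : ℕ}

/-- The form equals p E⟪e, U⟫², and `integral_sq_le` applies after normalising e. This supplies the
hypothesis `hR` of the deterministic lemmas. -/
lemma SubGaussianDirection.sum_mul_cov_le {E : Type*} [MeasurableSpace E] {μ : Measure E}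
    [IsProbabilityMeasure μ] {U : E → EuclideanSpace ℝ (Fin p)} {D : ℝ}
    (hU : SubGaussianDirection μ U D) (hp : 0 < p) (hD : 0 < D) (e : EuclideanSpace ℝ (Fin p)) :
    ∑ j, ∑ k, e j * e k * (p * ∫ y, U y j * U y k ∂μ) ≤ 16 * D * ‖e‖ ^ 2 := by
  have hp' : (0 : ℝ) < p := by exact_mod_cast hp
  have hint : ∀ j k, Integrable (fun y => U y j * U y k) μ := fun j k => by
    refine hU.integrable_of_abs_le (f := fun y => y j * y k) (by fun_prop) (B := 1) fun x hx => ?_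
    rw [abs_mul]
    have h1 : ∀ j, |x j| ≤ 1 := fun j => (PiLp.norm_apply_le x j).trans hx
    exact mul_le_one₀ (h1 j) (abs_nonneg _) (h1 k)
  have h1 : ∑ j, ∑ k, e j * e k * (p * ∫ y, U y j * U y k ∂μ) =
      p * ∫ y, (inner ℝ e (U y)) ^ 2 ∂μ := by
    have h2 : ∀ y, (inner ℝ e (U y)) ^ 2 = ∑ j, ∑ k, e j * e k * (U y j * U y k) := fun y => by
      rw [PiLp.inner_apply, sq, Finset.sum_mul_sum]
      refine Finset.sum_congr rfl fun j _ => Finset.sum_congr rfl fun k _ => ?_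
      simp only [RCLike.inner_apply, conj_trivial]
      ring
    simp only [h2]
    rw [integral_finsetSum _ fun j _ => integrable_finsetSum _ fun k _ => (hint j k).const_mul _,
      Finset.mul_sum]
    refine Finset.sum_congr rfl fun j _ => ?_
    rw [integral_finsetSum _ fun k _ => (hint j k).const_mul _, Finset.mul_sum]
    refine Finset.sum_congr rfl fun k _ => ?_
    rw [integral_const_mul]
    ring
  rw [h1]
  rcases eq_or_ne e 0 with rfl | he
  · simp
  have hn : 0 < ‖e‖ := norm_pos_iff.2 he
  have h3 := hU.integral_sq_le hp hD (e := ‖e‖⁻¹ • e) (norm_smul_inv_norm he)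
  simp only [real_inner_smul_left, mul_pow] at h3
  rw [integral_const_mul, inv_pow, inv_mul_le_iff₀ (by positivity)] at h3
  calc _ ≤ p * (‖e‖ ^ 2 * (16 * D / p)) := by gcongr
    _ = _ := by field_simp

lemma one_le_inv_sq_of_eigenvalues (hp : 0 < p) {Sig : Matrix (Fin p) (Fin p) ℝ} {η : ℝ}
    (hη0 : 0 < η) {h : Sig.IsHermitian}
    (hη : ∀ i, η < h.eigenvalues i ∧ h.eigenvalues i < 1 / η) : 1 ≤ 1 / η ^ 2 := by
  have h1 := (hη ⟨0, hp⟩).1.trans (hη ⟨0, hp⟩).2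
  rw [lt_div_iff₀ hη0] at h1
  rw [le_div_iff₀ (by positivity)]
  nlinarith

/-- Independent copies of a law fall in a set of points of small product measure with the same
small probability; the exceptional set may be taken measurable. -/
lemma exists_measurableSet_of_pi {E Ω : Type*} [MeasurableSpace E] [MeasurableSpace Ω]
    {P : Measure Ω} [IsProbabilityMeasure P] {n : ℕ} {L : Measure E} {X : Fin n → Ω → E}
    (hind : iIndepFun X P) (hlaw : ∀ i, HasLaw (X i) L P) {B : Set (Fin n → E)} :
    ∃ A : Set Ω, MeasurableSet A ∧ 1 - (Measure.pi fun _ : Fin n => L).real B ≤ P.real A ∧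
      ∀ ω ∈ A, (fun i => X i ω) ∉ B := by
  have hX : ∀ i, AEMeasurable (X i) P := fun i => (hlaw i).aemeasurable
  have h1 : P.map (fun ω i => X i ω) = Measure.pi fun _ => L := by
    rw [(iIndepFun_iff_map_fun_eq_pi_map hX).1 hind]
    simp only [(hlaw _).map_eq]
  have hm : AEMeasurable (fun ω i => X i ω) P := aemeasurable_pi_lambda _ hX
  have hprob : IsProbabilityMeasure (Measure.pi fun _ : Fin n => L) := by
    rw [← h1]; exact Measure.isProbabilityMeasure_map hm
  -- Measurability of this preimage is not assumed; its measurable hull has the same measure, at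
  -- most that of B under the product law.
  set S := (fun ω i => X i ω) ⁻¹' B
  refine ⟨(toMeasurable P S)ᶜ, (measurableSet_toMeasurable _ _).compl, ?_, fun ω hω hB =>
    hω (subset_toMeasurable P S hB)⟩
  rw [probReal_compl_eq_one_sub (measurableSet_toMeasurable _ _), measureReal_def P,
    measure_toMeasurable]
  have h2 : P S ≤ (Measure.pi fun _ : Fin n => L) B := by
    rw [← h1]; exact Measure.le_map_apply hm B
  have := ENNReal.toReal_mono (measure_ne_top _ _) h2
  rw [← measureReal_def (Measure.pi _)] at this
  linarith

lemma eventually_log_two_mul_le {c : ℝ} (hc : 0 < c) :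
    ∀ᶠ n : ℕ in Filter.atTop, Real.log (2 * n) ≤ c * n := by
  have h1 := Real.isLittleO_log_id_atTop.bound (half_pos hc)
  have h2 : Filter.Tendsto (fun n : ℕ => (2 : ℝ) * n) Filter.atTop Filter.atTop :=
    tendsto_natCast_atTop_atTop.const_mul_atTop two_pos
  filter_upwards [h2.eventually h1] with n hn
  simp only [id, Real.norm_eq_abs] at hn
  rw [abs_of_nonneg (by positivity : (0 : ℝ) ≤ 2 * n)] at hn
  linarith [le_abs_self (Real.log (2 * n))]

/-- Since 405600 = 2 · 202800, log(2n) takes half of the budget n/(202800K²D²); the other half is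
kept for 3 log p, which no threshold on n alone could bound. -/
lemma exists_threshold {η K : ℝ} (hη : 0 < η) (hK : 0 < K) :
    ∃ N : ℕ, ∀ n p : ℕ, N ≤ n → N ≤ p → 4 ≤ n ∧ 4 ≤ p ∧
      Real.log (2 * n) ≤ n / (405600 * K ^ 2 * (1 / η ^ 2) ^ 2) ∧ 3 * Real.log p ≤ p ∧
      7 * K ≤ p ∧ 10 ^ 7 * K ^ 2 * (1 / η ^ 2) ≤ p := by
  have h1 := eventually_log_two_mul_le
    (c := 1 / (405600 * K ^ 2 * (1 / η ^ 2) ^ 2)) (by positivity)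
  have h2 := eventually_log_two_mul_le (c := 1 / 3) (by norm_num)
  have h3 := tendsto_natCast_atTop_atTop (R := ℝ) |>.eventually_ge_atTop (7 * K)
  have h4 := tendsto_natCast_atTop_atTop (R := ℝ) |>.eventually_ge_atTop
    (10 ^ 7 * K ^ 2 * (1 / η ^ 2))
  obtain ⟨N, hN⟩ := Filter.eventually_atTop.1
    ((h1.and h2).and ((h3.and h4).and (Filter.eventually_ge_atTop 4)))
  refine ⟨N, fun n p hn hp => ?_⟩
  obtain ⟨⟨g1, -⟩, -, g2⟩ := hN n hn
  obtain ⟨⟨-, g3⟩, ⟨g4, g5⟩, g6⟩ := hN p hp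
  refine ⟨g2, g6, g1.trans_eq (by ring), ?_, g4, g5⟩
  have hp' : (0 : ℝ) < p := by exact_mod_cast (by omega : 0 < p)
  have := Real.log_le_log hp' (by linarith : (p : ℝ) ≤ 2 * p)
  linarith

end Assembly

/-! ### Choice of the constants and conclusion -/

section Main

/-- The constant that depends on the covariance bounds. -/
noncomputable def covarianceConst (c₀ η T : ℝ) : ℝ :=
  -- The middle term dominates the sampling constant 10¹⁰D⁴, and through 1/T so does T times the
  -- whole; the last term dominates the bias. The leading 1 and the absolute values give positivity
  -- at all real arguments.
  1 + 10 ^ 10 * (1 / η ^ 2) ^ 4 * (1 + |1 / T|) + |5 / (2 * η ^ 3 * c₀)|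

lemma covarianceConst_pos (c₀ η T : ℝ) : 0 < covarianceConst c₀ η T := by
  unfold covarianceConst
  positivity

variable {n p : ℕ} {c₀ η T K : ℝ}

/-- The error bound in the tuning parameter dominates the sampling error and the bias. -/
lemma error_le_tuning (hη : 0 < η) :
    10 ^ 10 * K ^ 4 * (1 / η ^ 2) ^ 4 * √(Real.log p / n) + 5 / (2 * η ^ 3 * c₀) / √p ≤
      √2 * (K ^ 4 + 1) * (8 + η ^ 2 * covarianceConst c₀ η T) / η ^ 2 * √(Real.log p / n) +
        covarianceConst c₀ η T / √p := by
  set A := covarianceConst c₀ η T with hA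
  have hA0 : 0 < A := covarianceConst_pos c₀ η T
  have hD : 0 < 10 ^ 10 * (1 / η ^ 2) ^ 4 := by positivity
  have h1 : 10 ^ 10 * (1 / η ^ 2) ^ 4 ≤ A := by
    rw [hA, covarianceConst]
    nlinarith [abs_nonneg (1 / T), abs_nonneg (5 / (2 * η ^ 3 * c₀))]
  have h2 : 5 / (2 * η ^ 3 * c₀) ≤ A := by
    rw [hA, covarianceConst]
    nlinarith [abs_nonneg (1 / T), le_abs_self (5 / (2 * η ^ 3 * c₀))]
  have h3 : A ≤ (8 + η ^ 2 * A) / η ^ 2 := by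
    rw [le_div_iff₀ (by positivity)]; linarith
  have h4 : 1 ≤ √2 := by rw [Real.one_le_sqrt]; norm_num
  have hK : 0 ≤ K ^ 4 := by positivity
  gcongr ?_ * _ + ?_ / _
  calc _ = 1 * K ^ 4 * (10 ^ 10 * (1 / η ^ 2) ^ 4) := by ring
    _ ≤ √2 * (K ^ 4 + 1) * ((8 + η ^ 2 * A) / η ^ 2) := by
        gcongr
        · linarith
        · exact h1.trans h3
    _ = _ := by ring

/-- If the tuning parameter is small, then the sample is large. -/
lemma rate_le_of_tuning_le (hη : 0 < η) (hT : 0 < T)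
    (h : tuning n p η T (covarianceConst c₀ η T) (K ^ 4 + 1) ≤ 1 / 8) :
    8 * (10 ^ 10 * K ^ 4 * (1 / η ^ 2) ^ 4 * √(Real.log p / n)) ≤ 1 := by
  set A := covarianceConst c₀ η T with hA
  have hA0 : 0 < A := covarianceConst_pos c₀ η T
  have hD : 0 < 10 ^ 10 * (1 / η ^ 2) ^ 4 := by positivity
  have h1 : 10 ^ 10 * (1 / η ^ 2) ^ 4 ≤ T * A := by
    have : 10 ^ 10 * (1 / η ^ 2) ^ 4 * (1 / T) ≤ A := by
      rw [hA, covarianceConst]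
      nlinarith [le_abs_self (1 / T), abs_nonneg (5 / (2 * η ^ 3 * c₀))]
    calc _ = T * (10 ^ 10 * (1 / η ^ 2) ^ 4 * (1 / T)) := by field_simp
      _ ≤ _ := by gcongr
  have h3 : A ≤ (8 + η ^ 2 * A) / η ^ 2 := by
    rw [le_div_iff₀ (by positivity)]; linarith
  have h4 : 1 ≤ √2 := by rw [Real.one_le_sqrt]; norm_num
  have hK : 0 ≤ K ^ 4 := by positivity
  have h5 : 10 ^ 10 * K ^ 4 * (1 / η ^ 2) ^ 4 * √(Real.log p / n) ≤
      tuning n p η T A (K ^ 4 + 1) := by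
    calc _ = 1 * K ^ 4 * (10 ^ 10 * (1 / η ^ 2) ^ 4) * √(Real.log p / n) := by ring
      _ ≤ √2 * (K ^ 4 + 1) * (T * ((8 + η ^ 2 * A) / η ^ 2)) * √(Real.log p / n) := by
        have h6 : 1 * K ^ 4 ≤ √2 * (K ^ 4 + 1) :=
          mul_le_mul h4 (by linarith) hK (Real.sqrt_nonneg _)
        have h7 : T * A ≤ T * ((8 + η ^ 2 * A) / η ^ 2) := by gcongr
        exact mul_le_mul_of_nonneg_right
          (mul_le_mul h6 (h1.trans h7) hD.le (by positivity)) (Real.sqrt_nonneg _)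
      _ = T * (√2 * (K ^ 4 + 1) * (8 + η ^ 2 * A) / η ^ 2 * √(Real.log p / n) + 0) := by ring
      _ ≤ _ := by unfold tuning; gcongr; positivity
  linarith

/-- In terms of s = √(L/N) and w = K²D² ≥ 1 the hypothesis reads 8 · 10¹⁰w²s ≤ 1, while √(NL) = Ns
and L = Ns². -/
lemma sample_size_of_rate_le {D L N : ℝ} (hN : 0 < N) (hL : 0 ≤ L) (hK : 1 ≤ K) (hD : 1 ≤ D)
    (h : 8 * (10 ^ 10 * K ^ 4 * D ^ 4 * √(L / N)) ≤ 1) :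
    10 ^ 9 * K ^ 2 * D ^ 2 * √(N * L) ≤ N ∧ 3 * L ≤ N / (405600 * K ^ 2 * D ^ 2) := by
  set s := √(L / N) with hs
  have hs0 : 0 ≤ s := Real.sqrt_nonneg _
  have hL' : L = N * s ^ 2 := by rw [hs, Real.sq_sqrt (by positivity)]; field_simp
  have hNL : √(N * L) = N * s := by
    rw [hL', show N * (N * s ^ 2) = (N * s) ^ 2 by ring]
    exact Real.sqrt_sq (by positivity)
  set w := K ^ 2 * D ^ 2 with hw
  have hw1 : 1 ≤ w := one_le_mul_of_one_le_of_one_le (one_le_pow₀ hK) (one_le_pow₀ hD)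
  have h1 : 8 * (10 ^ 10 * w ^ 2 * s) ≤ 1 := by
    refine le_trans (le_of_eq ?_) h
    rw [hw]; ring
  have h2 : w * s ≤ w ^ 2 * s := by gcongr; nlinarith
  have h3 : s ≤ w * s := le_mul_of_one_le_left hs0 hw1
  constructor
  · rw [hNL]
    calc _ = N * (10 ^ 9 * (w * s)) := by rw [hw]; ring
      _ ≤ N * 1 := by gcongr; linarith
      _ = N := mul_one N
  · rw [le_div_iff₀ (by positivity)]
    calc _ = N * (1216800 * (w * s) * s) := by rw [hL', hw]; ring
      _ ≤ N * 1 := by gcongr; nlinarith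
      _ = N := mul_one N

lemma one_sub_two_mul_lt {p : ℕ} (hp : 4 ≤ p) :
    1 - 2 * ((p : ℝ) ^ 2)⁻¹ < 1 - 7 * Real.exp (-3 * Real.log p) := by
  have hp' : (4 : ℝ) ≤ p := by exact_mod_cast hp
  have h1 : Real.exp (-3 * Real.log p) = ((p : ℝ) ^ 3)⁻¹ := by
    rw [neg_mul, Real.exp_neg]
    congr 1
    rw [show 3 * Real.log p = ((3 : ℕ) : ℝ) * Real.log p by norm_num, ← Real.log_pow,
      Real.exp_log (by positivity)]
  have h2 : 7 * ((p : ℝ) ^ 3)⁻¹ < 2 * ((p : ℝ) ^ 2)⁻¹ := by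
    rw [← div_eq_mul_inv, ← div_eq_mul_inv, div_lt_div_iff₀ (by positivity) (by positivity)]
    have : (0 : ℝ) < p ^ 2 := by positivity
    nlinarith
  rw [h1]
  linarith

/-- The radial conditions and the eigenvalue bounds make the spatial signs and inverse radii of
almost every sample of large enough size regular. -/
lemma measureReal_irregular_le {m : EuclideanSpace ℝ (Fin p)} {L : Measure (EuclideanSpace ℝ (Fin p))}
    [IsProbabilityMeasure L] {ζ ψ D : ℝ} (hn : 0 < n) (hp : 3 ≤ p) (hD : 1 ≤ D) (hK : 0 < K)
    (hU : SubGaussianDirection L (fun x => spatialSign (x - m)) D)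
    (hL : RadialConditions L m ζ ψ K)
    (hsmall : Real.log (2 * n) + 3 * Real.log p ≤ n / (202800 * K ^ 2 * D ^ 2))
    (hlog : 3 * Real.log p ≤ p) (hKp : 7 * K ≤ p) :
    (Measure.pi fun _ : Fin n => L).real
      ({x | ¬ GoodSample D K (fun j k => p * spatialSignCov L m j k)
        (fun i => spatialSign (x i - m)) (fun i => (invMoment L m 1)⁻¹ * ‖x i - m‖⁻¹)} ∪
        {x | ∃ i, x i = m}) ≤ 7 * Real.exp (-3 * Real.log p) := by
  have h1 := measureReal_not_goodSample_le hU (hL.subGaussianRatio hK) hD (hL.one_le hK) hn hp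
    hsmall hlog hKp
  have h2 : (Measure.pi fun _ : Fin n => L).real {x | ∃ i, x i = m} = 0 := by
    have h3 : L.real {m} = 0 := by
      rw [measureReal_def, show L {m} = 0 by simpa [ae_iff] using hL.ae_ne, ENNReal.toReal_zero]
    refine le_antisymm ?_ measureReal_nonneg
    have h4 : {x : Fin n → EuclideanSpace ℝ (Fin p) | ∃ i, x i = m} = ⋃ i, {x | x i ∈ ({m} : Set _)} := by
      ext x; simp
    rw [h4]
    refine (measureReal_iUnion_fintype_le _).trans (le_of_eq ?_)
    refine Finset.sum_eq_zero fun i _ => ?_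
    rw [measureReal_pi_eval n i (measurableSet_singleton m), h3]
  refine (measureReal_union_le _ _).trans ?_
  rw [h2, add_zero]
  exact h1

end Main

end Sclime

theorem theorem3 :
    ∃ (A : ℝ → ℝ → ℝ → ℝ → ℝ) (C : ℝ → ℝ → ℝ → ℝ),
      (∀ c₀ η T M, 0 < A c₀ η T M) ∧ (∀ ζ ψ K, 0 < C ζ ψ K) ∧
      ∀ c₀ η T M ζ ψ K : ℝ, 0 < c₀ → 0 < η → 0 < T → 0 < M → 0 < ζ → 0 < ψ → 0 < K →
        ∃ N : ℕ, ∀ n p : ℕ, N ≤ n → N ≤ p → (3 * Real.log p) ^ (1 / 3 : ℝ) < (n : ℝ) →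
          ∀ {Ω : Type*} [MeasurableSpace Ω] (P : Measure Ω) [IsProbabilityMeasure P]
            (X : Fin n → Ω → EuclideanSpace ℝ (Fin p)) (m : EuclideanSpace ℝ (Fin p))
            (Sig : Matrix (Fin p) (Fin p) ℝ) (ρ : Measure ℝ),
            Sclime.IsEllipticalSample P X m Sig ρ →
            ∀ q s₀ : ℝ, 0 ≤ q → q < 1 → 0 < s₀ →
            Sclime.SparsePrecision (Sclime.precisionMatrix Sig) T q s₀ →
            Sclime.BoundedCovariance Sig c₀ η M →
            Sclime.RadialConditions (Sclime.ellipticalLaw m Sig ρ) m ζ ψ K →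
            ∀ lam τ : ℝ, lam = Sclime.tuning n p η T (A c₀ η T M) (C ζ ψ K) →
              4 * T * lam < τ → 2 * τ < Sclime.thetaMin (Sclime.precisionMatrix Sig) →
              ∃ E : Set Ω, MeasurableSet E ∧ 1 - 2 * ((p : ℝ) ^ 2)⁻¹ < P.real E ∧
                ∀ ω ∈ E,
                  (∃ mhat, Sclime.IsSpatialMedian (fun i => X i ω) mhat) ∧
                  ∀ mhat, Sclime.IsSpatialMedian (fun i => X i ω) mhat →
                    (∃ V, Sclime.IsSclimeEstimator (fun i => X i ω) mhat lam V) ∧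
                    ∀ V, Sclime.IsSclimeEstimator (fun i => X i ω) mhat lam V →
                      Sclime.signPattern (Sclime.hardThreshold τ V) =
                        Sclime.signPattern (Sclime.precisionMatrix Sig) := by
  open Sclime in
  -- K⁴ is the dependence of the sampling error on K; adding 1 makes the constant positive for every
  -- real K.
  refine ⟨fun c₀ η T _ => covarianceConst c₀ η T, fun _ _ K => K ^ 4 + 1,
    fun c₀ η T _ => covarianceConst_pos c₀ η T, fun _ _ K => by positivity, ?_⟩
  intro c₀ η T M ζ ψ K hc₀ hη hT _ _ _ hK
  obtain ⟨N, hN⟩ := exists_threshold hη hK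
  refine ⟨N, fun n p hn hp _ Ω _ P _ X m Sig ρ hX q s₀ _ _ _ hV hSig hL lam τ hlam hτ hθ => ?_⟩
  obtain ⟨hn4, hp4, hlogn, hlogp, hKp, hKDp⟩ := hN n p hn hp
  have hn0 : 0 < n := by omega
  have hp0 : 0 < p := by omega
  have hn' : (0 : ℝ) < n := by exact_mod_cast hn0
  have hp' : (4 : ℝ) ≤ p := by exact_mod_cast hp4
  have := hX.isProbabilityMeasure
  have := isProbabilityMeasure_ellipticalLaw hp0 m Sig ρ
  obtain ⟨hH, heig⟩ := hSig.eigenvalues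
  have hD := one_le_inv_sq_of_eigenvalues hp0 hη heig
  have hK1 := hL.one_le hK
  have hlog1 : 1 ≤ Real.log p := by
    rw [Real.le_log_iff_exp_le (by linarith)]
    linarith [Real.exp_one_lt_d9]
  have hU : SubGaussianDirection (ellipticalLaw m Sig ρ) (fun x => spatialSign (x - m)) (1 / η ^ 2) :=
    ⟨measurable_spatialSign.comp (by fun_prop), fun x => norm_spatialSign_le _,
      integral_exp_inner_spatialSign_le hp0 m hX.posDef hη heig ρ⟩
  -- From 4Tλ < τ < θ_min/2 ≤ T/2. This is where the signal condition makes the sample large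
  -- relative to log p.
  have hlam8 : lam ≤ 1 / 8 := by
    have h1 := thetaMin_precisionMatrix_le hX.posDef hp0 hV.colSum
    have h2 : T * (8 * lam) < T * 1 := by linarith
    linarith [lt_of_mul_lt_mul_left h2 hT.le]
  have hrate := rate_le_of_tuning_le hη hT (hlam ▸ hlam8)
  obtain ⟨hsize, hsize2⟩ := sample_size_of_rate_le hn' (by linarith) hK1 hD hrate
  have hsmall : Real.log (2 * n) + 3 * Real.log p ≤ n / (202800 * K ^ 2 * (1 / η ^ 2) ^ 2) := by
    refine (add_le_add hlogn hsize2).trans (le_of_eq ?_)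
    rw [show 405600 * K ^ 2 * (1 / η ^ 2) ^ 2 = (202800 * K ^ 2 * (1 / η ^ 2) ^ 2) * 2 by ring,
      ← div_div, add_halves]
  obtain ⟨E, hE, hPE, hEB⟩ := exists_measurableSet_of_pi hX.indep hX.law (B :=
    {x | ¬ GoodSample (1 / η ^ 2) K (fun j k => p * spatialSignCov (ellipticalLaw m Sig ρ) m j k)
      (fun i => spatialSign (x i - m))
      (fun i => (invMoment (ellipticalLaw m Sig ρ) m 1)⁻¹ * ‖x i - m‖⁻¹)} ∪ {x | ∃ i, x i = m})
  have hB := measureReal_irregular_le hn0 (by omega) hD hK hU hL hsmall hlogp hKp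
  refine ⟨E, hE, (one_sub_two_mul_lt hp4).trans_le (by linarith), fun ω hω =>
    ⟨exists_isSpatialMedian hn0 _, fun mhat hm => ?_⟩⟩
  have hgood := hEB ω hω
  rw [Set.mem_union, not_or] at hgood
  have hG := not_not.1 hgood.1
  have hne : ∀ i, X i ω ≠ m := fun i hi => hgood.2 ⟨i, hi⟩
  have hdet := isUnit_det_shapeMatrix hX.posDef hp0
  rw [hlam, tuning]
  rw [hlam, tuning] at hτ
  refine sclime_sign_consistent (Lam := shapeMatrix Sig) hT.le ?_ (fun i j => ?_) hV.colSum
    (precisionMatrix_symm hX.posDef) (Matrix.mul_nonsing_inv _ hdet)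
    (Matrix.nonsing_inv_mul _ hdet) hτ hθ
  · have := covarianceConst_pos c₀ η T
    positivity
  -- The error splits at p times the population sign covariance into sampling error and bias.
  · refine le_trans ?_ (error_le_tuning hη)
    refine (abs_sub_le _ ((p : ℝ) * spatialSignCov (ellipticalLaw m Sig ρ) m i j) _).trans
      (add_le_add ?_ ?_)
    · exact abs_sampleSpatialSignCov_sub_le hn0 hp0 hD hK1 hlog1 m hne hL.invMoment_one_pos hG
        (hU.sum_mul_cov_le hp0 (by positivity)) hsize hKDp hm i j
    · exact abs_spatialSignCov_sub_le hp0 m hX.posDef hη hc₀ heig hSig.trace_lower ρ hL.ae_ne i j
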